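/- Let $y_1<\dots<y_n$ be real numbers, $Y=\{y_1,\dots,y_n\}$, and let $H^k(\mathbb R\setminus Y;\mathbb C^2)$, $k=1,2$, be the space of those $\Psi\in L^2(\mathbb R;\mathbb C^2)$ whose distributional derivatives in $\mathbb R\setminus Y$ up to order $k$ are in $L^2$. For $f$ with one-sided limits at $y$ put $\langle f\rangle_y=\frac12(f(y^-)+f(y^+))$ and $[f]_y=f(y^+)-f(y^-)$. Let $\sigma_1=\begin{bmatrix}0&1\\1&0\end{bmatrix}$, $\sigma_3=\begin{bmatrix}1&0\\0&-1\end{bmatrix}$. For $\Psi\in H^1(\mathbb R\setminus Y;\mathbb C^2)$ define $\tau\Psi,\rho\Psi\in\mathbb C^{2n}$ as the vectors with blocks $\langle\Psi\rangle_{y_k}$ and $i\sigma_1[\Psi]_{y_k}$, $1\le k\le n$. For scalar $\psi\in H^2(\mathbb R\setminus Y)$ define $\hat\tau\psi,\hat\rho\psi\in\mathbb C^{2n}$ as the vectors with blocks $(\langle\psi\rangle_{y_k},\langle\psi'\rangle_{y_k})$ and $([\psi']_{y_k},-[\psi]_{y_k})$, and for $\Psi=(\psi_1,\psi_2)\in H^2(\mathbb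 R\setminus Y;\mathbb C^2)$ put $(\hat\tau\mathbb 1)\Psi=\hat\tau\psi_1\oplus\hat\tau\psi_2$ and $(\hat\rho\mathbb 1)\Psi=\hat\rho\psi_1\oplus\hat\rho\psi_2$ in $\mathbb C^{4n}=\mathbb C^{2n}\oplus\mathbb C^{2n}$. For an orthogonal projector $\Pi$ in $\mathbb C^{2n}$ and a symmetric operator $\Theta:\operatorname{ran}\Pi\to\operatorname{ran}\Pi$ let $D_{\Pi,\Theta}$ be the operator in $L^2(\mathbb R;\mathbb C^2)$ acting as $-i\sigma_1\frac{d}{dx}+\frac12\sigma_3$ on $\mathbb R\setminus Y$, with domain $\{\Psi\in H^1(\mathbb R\setminus Y;\mathbb C^2):\rho\Psi\in\operatorname{ran}\Pi,\ \Pi\tau\Psi=\Theta\rho\Psi\}$. For an orthogonal projector $\widehat\Pi$ in $\mathbb C^{4n}$ and a symmetric operator $\widehat\Theta:\operatorname{ran}\widehat\Pi\to\operatorname{ran}\widehat\Pi$ let $\widehat H_{\widehat\Pi,\widehat\Theta}$ be the operator in $L^2(\mathbb R;\mathbb C^2)$ acting as $-\frac{d^2}{dx^2}$ on $\mathbb R\setminus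 Y$, with domain $\{\Psi\in H^2(\mathbb R\setminus Y;\mathbb C^2):(\hat\rho\mathbb 1)\Psi\in\operatorname{ran}\widehat\Pi,\ \widehat\Pi(\hat\tau\mathbb 1)\Psi=\widehat\Theta(\hat\rho\mathbb 1)\Psi\}$. Let $U(\xi_1,\dots,\xi_{2n})=(\xi_1,\xi_{n+1},\xi_2,\xi_{n+2},\dots,\xi_n,\xi_{2n})$ for $\xi_k\in\mathbb C^2$, a unitary operator in $\mathbb C^{4n}$, let $M_j^\oplus=M_j\oplus\dots\oplus M_j$ ($n$ copies), where $$M_1=\begin{bmatrix}1&0&0&0\\0&\frac i2&0&i\\0&1&0&0\\-\frac i2&0&i&0\end{bmatrix},\qquad M_2=\begin{bmatrix}\frac12&0&1&0\\0&i&0&0\\0&-\frac12&0&1\\i&0&0&0\end{bmatrix},$$ and put $N_j=U^*M_j^\oplus U$, $j=1,2$. Then the operators $D_{\Pi,\Theta}$ are self-adjoint extensions of $-i\sigma_1\frac{d}{dx}+\frac12\sigma_3$ on $C^\infty_{comp}(\mathbb R\setminus Y;\mathbb C^2)$, and each self-adjoint extension of the latter is $D_{\Pi,\Theta}$ for exactly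 one couple $(\Pi,\Theta)$. For every couple $(\Pi,\Theta)$ there is a couple $(\widehat\Pi,\widehat\Theta)$, with $\widehat\Pi$ an orthogonal projector in $\mathbb C^{4n}$ and $\widehat\Theta$ a symmetric operator in $\operatorname{ran}\widehat\Pi$, such that the following holds. 1. $\operatorname{ran}\widehat\Pi=\operatorname{ran}\big(N_2(\Pi\oplus\Pi)\big)=\operatorname{ran}\big(N_2(\Pi\oplus\Pi)N_1^{-1}\big)$. Moreover, with $N:\operatorname{ran}(\Pi\oplus\Pi)\to\mathbb C^{4n}$ the restriction of $N_2$, the operator $N^*N$ is invertible in $\operatorname{ran}(\Pi\oplus\Pi)$ and $\widehat\Pi=N(N^*N)^{-1}N^*$; and $\dim\operatorname{ran}\widehat\Pi=2\dim\operatorname{ran}\Pi$. 2. $K=N_2(\Pi\oplus\Pi)N_1^{-1}$ maps $\operatorname{ran}\widehat\Pi$ bijectively onto itself, and $\widehat\Theta=K^{-1}N_2(\Theta\oplus\Theta)N_2^{-1}$ on $\operatorname{ran}\widehat\Pi$. If $\Pi=\mathbb 1$, then $\widehat\Pi=\mathbb 1$ and $\widehat\Theta=N_1(\Theta\oplus\Theta)N_2^{-1}$,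 which for $n=1$ is $M_1(\Theta\oplus\Theta)M_2^{-1}$. 3. $\widehat H_{\widehat\Pi,\widehat\Theta}$ is a self-adjoint extension of $-\frac{d^2}{dx^2}$ on $C^\infty_{comp}(\mathbb R\setminus Y;\mathbb C^2)$ and, including equality of the domains, $$(D_{\Pi,\Theta})^2=\widehat H_{\widehat\Pi,\widehat\Theta}+\tfrac14 .$$ 4. For every $z\in\mathbb C$, both $z$ and $-z$ are in the resolvent set of $D_{\Pi,\Theta}$ if and only if $z^2-\frac14$ is in the resolvent set of $\widehat H_{\widehat\Pi,\widehat\Theta}$; equivalently, at least one of $\lambda,-\lambda$ is in $\sigma(D_{\Pi,\Theta})$ if and only if $\lambda^2-\frac14\in\sigma(\widehat H_{\widehat\Pi,\widehat\Theta})$. For such $z$, $$(-D_{\Pi,\Theta}+z)^{-1}=(D_{\Pi,\Theta}+z)\big(-\widehat H_{\widehat\Pi,\widehat\Theta}+z^2-\tfrac14\big)^{-1}.$$ -/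

import Mathlib

open MeasureTheory Filter Topology
open scoped ContDiff Kronecker ENNReal

noncomputable section

namespace DiracSchr

/-! ### Spaces -/

/-- `ℂ²` with its Hermitian inner product. -/
abbrev C2 : Type := EuclideanSpace ℂ (Fin 2)

/-- The Hilbert space `L²(ℝ; ℂ²)`. -/
abbrev L2 : Type := Lp C2 2 (volume : Measure ℝ)

/-- `ℂ²ⁿ = ℂ² ⊕ ⋯ ⊕ ℂ²`; the index `(k, i)` is the `i`-th entry of the `k`-th block. -/
abbrev C2n (n : ℕ) : Type := EuclideanSpace ℂ (Fin n × Fin 2)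

/-- `ℂ⁴ⁿ = ℂ²ⁿ ⊕ ℂ²ⁿ`; the index `(j, k, i)` is the entry `(k, i)` of the `j`-th summand. -/
abbrev C4n (n : ℕ) : Type := EuclideanSpace ℂ (Fin 2 × Fin n × Fin 2)

/-- `ℂ⁴ⁿ = ℂ⁴ ⊕ ⋯ ⊕ ℂ⁴`, with `ℂ⁴ = ℂ² ⊕ ℂ²`; the index `(k, j, i)` is the `i`-th entry of the
`j`-th `ℂ²` inside the `k`-th `ℂ⁴`. -/
abbrev C4nBlock (n : ℕ) : Type := EuclideanSpace ℂ (Fin n × Fin 2 × Fin 2)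

/-! ### Weak derivative on `ℝ \ Y`, Sobolev spaces and one-sided limits -/

/-- Smooth real test functions with compact support contained in `ℝ \ {y₁, …, yₙ}`. -/
def IsTest {n : ℕ} (y : Fin n → ℝ) (φ : ℝ → ℝ) : Prop :=
  ContDiff ℝ ∞ φ ∧ HasCompactSupport φ ∧ tsupport φ ⊆ (Set.range y)ᶜ

theorem integrable_smul_L2 {φ : ℝ → ℝ} (hφ : Continuous φ) (hs : HasCompactSupport φ) (f : L2) :
    Integrable (fun x => φ x • f x) volume := by
  have h : LocallyIntegrable (fun x => f x) (volume : Measure ℝ) :=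
    (Lp.memLp f).locallyIntegrable (by norm_num)
  exact h.integrable_smul_left_of_hasCompactSupport hφ hs

theorem IsTest.integrable {n : ℕ} {y : Fin n → ℝ} {φ : ℝ → ℝ} (h : IsTest y φ) (f : L2) :
    Integrable (fun x => φ x • f x) volume :=
  integrable_smul_L2 h.1.continuous h.2.1 f

theorem IsTest.integrable_deriv {n : ℕ} {y : Fin n → ℝ} {φ : ℝ → ℝ} (h : IsTest y φ) (f : L2) :
    Integrable (fun x => deriv φ x • f x) volume :=
  integrable_smul_L2 (h.1.continuous_deriv (by simp)) h.2.1.deriv f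

/-- The pairs `(f, g)` in `L²(ℝ; ℂ²)` such that `g` is the distributional derivative of `f` in the
open set `ℝ \ {y₁, …, yₙ}`. -/
def weakDerivGraph {n : ℕ} (y : Fin n → ℝ) : Submodule ℂ (L2 × L2) where
  carrier := {p | ∀ φ : ℝ → ℝ, IsTest y φ →
    ∫ x, deriv φ x • p.1 x = - ∫ x, φ x • p.2 x}
  zero_mem' := by
    intro φ _
    have h0 : ((0 : L2) : ℝ → C2) =ᵐ[volume] 0 := Lp.coeFn_zero _ _ _
    have h1 : ∫ x, deriv φ x • (0 : L2) x = 0 := by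
      rw [integral_congr_ae (g := fun _ => (0 : C2)) (h0.mono fun x _ => by simp)]
      simp
    have h2 : ∫ x, φ x • (0 : L2) x = 0 := by
      rw [integral_congr_ae (g := fun _ => (0 : C2)) (h0.mono fun x _ => by simp)]
      simp
    exact h1.trans (neg_eq_zero.mpr h2).symm
  add_mem' := by
    rintro ⟨f, g⟩ ⟨f', g'⟩ h h' φ hφ
    have e1 : ∫ x, deriv φ x • (f + f' : L2) x
        = (∫ x, deriv φ x • f x) + ∫ x, deriv φ x • f' x := by
      rw [← integral_add (hφ.integrable_deriv f) (hφ.integrable_deriv f')]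
      exact integral_congr_ae ((Lp.coeFn_add f f').mono fun x hx => by
        simp only [hx, Pi.add_apply]; exact smul_add _ _ _)
    have e2 : ∫ x, φ x • (g + g' : L2) x = (∫ x, φ x • g x) + ∫ x, φ x • g' x := by
      rw [← integral_add (hφ.integrable g) (hφ.integrable g')]
      exact integral_congr_ae ((Lp.coeFn_add g g').mono fun x hx => by
        simp only [hx, Pi.add_apply]; exact smul_add _ _ _)
    have a := h φ hφ
    have b := h' φ hφ
    simp only [Prod.fst_add, Prod.snd_add] at a b ⊢
    rw [e1, e2, a, b, neg_add]
  smul_mem' := by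
    rintro c ⟨f, g⟩ h φ hφ
    have e1 : ∫ x, deriv φ x • (c • f : L2) x = c • ∫ x, deriv φ x • f x := by
      rw [← integral_smul]
      exact integral_congr_ae ((Lp.coeFn_smul c f).mono fun x hx => by
        simp only [hx, Pi.smul_apply]; exact smul_comm _ _ _)
    have e2 : ∫ x, φ x • (c • g : L2) x = c • ∫ x, φ x • g x := by
      rw [← integral_smul]
      exact integral_congr_ae ((Lp.coeFn_smul c g).mono fun x hx => by
        simp only [hx, Pi.smul_apply]; exact smul_comm _ _ _)
    have a := h φ hφ
    simp only [Prod.smul_fst, Prod.smul_snd] at a ⊢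
    rw [e1, e2, a, smul_neg]

/-- Uniqueness of the weak derivative. -/
theorem weakDerivGraph_unique {n : ℕ} (y : Fin n → ℝ) (p : L2 × L2) (hp : p ∈ weakDerivGraph y)
    (h0 : p.1 = 0) : p.2 = 0 := by
  obtain ⟨f, g⟩ := p
  obtain rfl : f = 0 := h0
  have hfin : (Set.range y).Finite := Set.finite_range y
  have hloc : LocallyIntegrable (fun x => g x) (volume : Measure ℝ) :=
    (Lp.memLp g).locallyIntegrable (by norm_num)
  have key : ∀ᵐ x ∂(volume : Measure ℝ), x ∈ (Set.range y)ᶜ → g x = 0 := by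
    refine hfin.isClosed.isOpen_compl.ae_eq_zero_of_integral_contDiff_smul_eq_zero
      (hloc.locallyIntegrableOn _) fun φ h1 h2 h3 => ?_
    have h := hp φ ⟨h1, h2, h3⟩
    have hz : ∫ x, deriv φ x • (0 : L2) x = 0 := by
      rw [integral_congr_ae (g := fun _ => (0 : C2))
        ((Lp.coeFn_zero C2 2 (volume : Measure ℝ)).mono fun x _ => by simp)]
      simp
    exact neg_eq_zero.mp (h.symm.trans hz)
  have hnull : ∀ᵐ x ∂(volume : Measure ℝ), x ∈ (Set.range y)ᶜ :=
    compl_mem_ae_iff.mpr (hfin.measure_zero _)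
  refine Lp.ext ?_
  filter_upwards [key, hnull, Lp.coeFn_zero C2 2 (volume : Measure ℝ)] with x h1 h2 h3
  rw [h1 h2, h3]; rfl

/-- The weak derivative `f ↦ f'` on `ℝ \ {y₁, …, yₙ}`, as an unbounded operator in `L²(ℝ; ℂ²)`
whose domain is `H¹(ℝ \ Y; ℂ²)`. -/
def wderiv {n : ℕ} (y : Fin n → ℝ) : L2 →ₗ.[ℂ] L2 := (weakDerivGraph y).toLinearPMap

theorem wderiv_graph {n : ℕ} (y : Fin n → ℝ) : (wderiv y).graph = weakDerivGraph y :=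
  Submodule.toLinearPMap_graph_eq _ (weakDerivGraph_unique y)

/-- The Sobolev space `H¹(ℝ \ Y; ℂ²)`. -/
abbrev H1 {n : ℕ} (y : Fin n → ℝ) : Submodule ℂ L2 := (wderiv y).domain

/-- `l k = f(y_k⁻)` and `r k = f(y_k⁺)`. The limits are essential ones (null sets are ignored), as
`f` stands for its a.e. class. They are unique, and they exist when `f ∈ H¹(ℝ \ Y; ℂ²)`, where
they are the one-sided limits of the continuous representative of `f` on `ℝ \ Y`. -/
def HasSideLimits {n : ℕ} (y : Fin n → ℝ) (f : ℝ → C2) (l r : Fin n → C2) : Prop :=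
  ∀ k, Tendsto f (𝓝[<] (y k) ⊓ ae volume) (𝓝 (l k)) ∧
    Tendsto f (𝓝[>] (y k) ⊓ ae volume) (𝓝 (r k))

theorem HasSideLimits.zero {n : ℕ} (y : Fin n → ℝ) :
    HasSideLimits y ((0 : L2) : ℝ → C2) 0 0 := by
  have h0 : ((0 : L2) : ℝ → C2) =ᵐ[volume] fun _ => (0 : C2) := Lp.coeFn_zero _ _ _
  exact fun k => ⟨tendsto_const_nhds.congr' (h0.symm.filter_mono inf_le_right),
    tendsto_const_nhds.congr' (h0.symm.filter_mono inf_le_right)⟩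

theorem HasSideLimits.add {n : ℕ} {y : Fin n → ℝ} {f f' : L2} {l r l' r' : Fin n → C2}
    (h : HasSideLimits y f l r) (h' : HasSideLimits y f' l' r') :
    HasSideLimits y ((f + f' : L2) : ℝ → C2) (l + l') (r + r') := by
  have e : ((f + f' : L2) : ℝ → C2) =ᵐ[volume] fun x => f x + f' x := Lp.coeFn_add _ _
  exact fun k => ⟨((h k).1.add (h' k).1).congr' (e.symm.filter_mono inf_le_right),
    ((h k).2.add (h' k).2).congr' (e.symm.filter_mono inf_le_right)⟩

theorem HasSideLimits.smul {n : ℕ} {y : Fin n → ℝ} {f : L2} {l r : Fin n → C2} (c : ℂ)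
    (h : HasSideLimits y f l r) :
    HasSideLimits y ((c • f : L2) : ℝ → C2) (c • l) (c • r) := by
  have e : ((c • f : L2) : ℝ → C2) =ᵐ[volume] fun x => c • f x := Lp.coeFn_smul _ _
  exact fun k => ⟨((h k).1.const_smul c).congr' (e.symm.filter_mono inf_le_right),
    ((h k).2.const_smul c).congr' (e.symm.filter_mono inf_le_right)⟩

/-! ### General notions for unbounded operators -/

/-- Composition `B A` with its natural domain `{x ∈ dom A : A x ∈ dom B}`. -/
def pcomp {H : Type*} [NormedAddCommGroup H] [NormedSpace ℂ H] (B A : H →ₗ.[ℂ] H) :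
    H →ₗ.[ℂ] H where
  domain :=
    { carrier := {x | ∃ h : x ∈ A.domain, A ⟨x, h⟩ ∈ B.domain}
      zero_mem' := ⟨A.domain.zero_mem, by
        have : A ⟨0, A.domain.zero_mem⟩ = 0 := A.map_zero
        rw [this]; exact B.domain.zero_mem⟩
      add_mem' := by
        rintro x x' ⟨h, hB⟩ ⟨h', hB'⟩
        refine ⟨A.domain.add_mem h h', ?_⟩
        have : A ⟨x + x', A.domain.add_mem h h'⟩ = A ⟨x, h⟩ + A ⟨x', h'⟩ :=
          A.map_add ⟨x, h⟩ ⟨x', h'⟩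
        rw [this]; exact B.domain.add_mem hB hB'
      smul_mem' := by
        rintro c x ⟨h, hB⟩
        refine ⟨A.domain.smul_mem c h, ?_⟩
        have : A ⟨c • x, A.domain.smul_mem c h⟩ = c • A ⟨x, h⟩ := A.map_smul c ⟨x, h⟩
        rw [this]; exact B.domain.smul_mem c hB }
  toFun :=
    { toFun := fun x => B ⟨A ⟨x.1, x.2.1⟩, x.2.2⟩
      map_add' := by
        intro x x'
        rw [← B.map_add]
        congr 1
        exact Subtype.ext (A.map_add ⟨x.1, x.2.1⟩ ⟨x'.1, x'.2.1⟩)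
      map_smul' := by
        intro c x
        rw [RingHom.id_apply, ← B.map_smul]
        congr 1
        exact Subtype.ext (A.map_smul c ⟨x.1, x.2.1⟩) }

/-- The operator `A + c`, with the domain of `A`. -/
def addConst {H : Type*} [NormedAddCommGroup H] [NormedSpace ℂ H] (A : H →ₗ.[ℂ] H) (c : ℂ) :
    H →ₗ.[ℂ] H := (c • (LinearMap.id : H →ₗ[ℂ] H)) +ᵥ A

/-- `R = (-A + z)⁻¹`: the bounded operator `R` is a two-sided inverse of `-A + z`. -/
def IsResolventAt {H : Type*} [NormedAddCommGroup H] [NormedSpace ℂ H] (A : H →ₗ.[ℂ] H)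
    (z : ℂ) (R : H →L[ℂ] H) : Prop :=
  (∀ Φ : H, ∃ h : R Φ ∈ A.domain, -A ⟨R Φ, h⟩ + z • R Φ = Φ) ∧
    ∀ Ψ : A.domain, R (-A Ψ + z • (Ψ : H)) = Ψ

/-- The resolvent set `ϱ(A)`. -/
def resolventSet {H : Type*} [NormedAddCommGroup H] [NormedSpace ℂ H] (A : H →ₗ.[ℂ] H) :
    Set ℂ := {z | ∃ R : H →L[ℂ] H, IsResolventAt A z R}

/-- The spectrum `σ(A)`. -/
def spectrum {H : Type*} [NormedAddCommGroup H] [NormedSpace ℂ H] (A : H →ₗ.[ℂ] H) :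
    Set ℂ := (resolventSet A)ᶜ

/-! ### The couples `(Π, Θ)` -/

/-- A couple `(Π, Θ)`: an orthogonal projector `Π` in `V` and a symmetric operator
`Θ : ran Π → ran Π`. -/
structure SymPair (V : Type) [NormedAddCommGroup V] [InnerProductSpace ℂ V] where
  proj : V →ₗ[ℂ] V
  isProj : proj.IsSymmetricProjection
  op : LinearMap.range proj →ₗ[ℂ] LinearMap.range proj
  isSymm : op.IsSymmetric

/-- The boundary condition `ρ ∈ ran Π`, `Π τ = Θ ρ`, for boundary values `τ, ρ ∈ V`. -/
def SymPair.BC {V : Type} [NormedAddCommGroup V] [InnerProductSpace ℂ V] (P : SymPair V)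
    (τ ρ : V) : Prop :=
  ∃ h : ρ ∈ LinearMap.range P.proj, P.proj τ = (P.op ⟨ρ, h⟩ : V)

theorem SymPair.BC.zero {V : Type} [NormedAddCommGroup V] [InnerProductSpace ℂ V]
    (P : SymPair V) : P.BC 0 0 :=
  ⟨Submodule.zero_mem _, by
    have : (⟨0, Submodule.zero_mem _⟩ : LinearMap.range P.proj) = 0 := rfl
    rw [this, LinearMap.map_zero, LinearMap.map_zero]; rfl⟩

theorem SymPair.BC.add {V : Type} [NormedAddCommGroup V] [InnerProductSpace ℂ V]
    {P : SymPair V} {τ ρ τ' ρ' : V} (h : P.BC τ ρ) (h' : P.BC τ' ρ') :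
    P.BC (τ + τ') (ρ + ρ') := by
  obtain ⟨m, e⟩ := h
  obtain ⟨m', e'⟩ := h'
  refine ⟨Submodule.add_mem _ m m', ?_⟩
  have : (⟨ρ + ρ', Submodule.add_mem _ m m'⟩ : LinearMap.range P.proj) = ⟨ρ, m⟩ + ⟨ρ', m'⟩ := rfl
  rw [this, LinearMap.map_add, LinearMap.map_add, e, e']; rfl

theorem SymPair.BC.smul {V : Type} [NormedAddCommGroup V] [InnerProductSpace ℂ V]
    {P : SymPair V} {τ ρ : V} (c : ℂ) (h : P.BC τ ρ) : P.BC (c • τ) (c • ρ) := by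
  obtain ⟨m, e⟩ := h
  refine ⟨Submodule.smul_mem _ c m, ?_⟩
  have : (⟨c • ρ, Submodule.smul_mem _ c m⟩ : LinearMap.range P.proj) = c • ⟨ρ, m⟩ := rfl
  rw [this, LinearMap.map_smul, LinearMap.map_smul, e]; rfl

/-- `Θ` followed by the inclusion and preceded by `Π`, i.e. `ΠΘΠ : V → V`. -/
def SymPair.ext {V : Type} [NormedAddCommGroup V] [InnerProductSpace ℂ V] (P : SymPair V) :
    V →ₗ[ℂ] V :=
  (LinearMap.range P.proj).subtype ∘ₗ P.op ∘ₗ P.proj.rangeRestrict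

/-! ### The Dirac operator -/

def sigma1 : Matrix (Fin 2) (Fin 2) ℂ := !![0, 1; 1, 0]

def sigma3 : Matrix (Fin 2) (Fin 2) ℂ := !![1, 0; 0, -1]

/-- A matrix acting on `ℂ²`. -/
def matC2 (A : Matrix (Fin 2) (Fin 2) ℂ) : C2 →L[ℂ] C2 :=
  LinearMap.toContinuousLinearMap (Matrix.toEuclideanLin A)

/-- A constant matrix acting pointwise on `L²(ℝ; ℂ²)`. -/
def matL2 (A : Matrix (Fin 2) (Fin 2) ℂ) : L2 →ₗ[ℂ] L2 :=
  ((matC2 A).compLpL 2 (volume : Measure ℝ) : L2 →L[ℂ] L2)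

/-- The Dirac operator `-i σ₁ d/dx + σ₃/2` on `ℝ \ Y`, with domain `H¹(ℝ \ Y; ℂ²)`. -/
def diracMax {n : ℕ} (y : Fin n → ℝ) : L2 →ₗ.[ℂ] L2 :=
  ((1 / 2 : ℂ) • matL2 sigma3) +ᵥ ((-Complex.I) • (matL2 sigma1).compPMap (wderiv y))

/-- `τΨ`: the blocks are the mean values `(Ψ(y_k⁻) + Ψ(y_k⁺))/2`. -/
def tauD {n : ℕ} (l r : Fin n → C2) : C2n n :=
  WithLp.toLp 2 fun p => (l p.1 p.2 + r p.1 p.2) / 2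

/-- `ρΨ`: the blocks are `i σ₁ (Ψ(y_k⁺) - Ψ(y_k⁻))`. -/
def rhoD {n : ℕ} (l r : Fin n → C2) : C2n n :=
  WithLp.toLp 2 fun p => Complex.I * matC2 sigma1 (r p.1 - l p.1) p.2

/-- The functions in `L²(ℝ; ℂ²)` with one-sided limits at the points of `Y` that satisfy
`ρΨ ∈ ran Π`, `Π τΨ = Θ ρΨ`. -/
def diracBC {n : ℕ} (y : Fin n → ℝ) (P : SymPair (C2n n)) : Submodule ℂ L2 where
  carrier := {Ψ | ∃ l r : Fin n → C2, HasSideLimits y Ψ l r ∧ P.BC (tauD l r) (rhoD l r)}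
  zero_mem' := by
    refine ⟨0, 0, HasSideLimits.zero y, ?_⟩
    have e1 : tauD (0 : Fin n → C2) 0 = 0 := by ext p; simp [tauD]
    have e2 : rhoD (0 : Fin n → C2) 0 = 0 := by ext p; simp [rhoD]
    rw [e1, e2]; exact SymPair.BC.zero P
  add_mem' := by
    rintro f f' ⟨l, r, h, b⟩ ⟨l', r', h', b'⟩
    refine ⟨l + l', r + r', h.add h', ?_⟩
    have e1 : tauD (l + l') (r + r') = tauD l r + tauD l' r' := by
      ext p; simp [tauD]; ring
    have e2 : rhoD (l + l') (r + r') = rhoD l r + rhoD l' r' := by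
      ext p; simp [rhoD]; ring
    rw [e1, e2]; exact b.add b'
  smul_mem' := by
    rintro c f ⟨l, r, h, b⟩
    refine ⟨c • l, c • r, h.smul c, ?_⟩
    have e1 : tauD (c • l) (c • r) = c • tauD l r := by
      ext p; simp [tauD]; ring
    have e2 : rhoD (c • l) (c • r) = c • rhoD l r := by
      ext p; simp [rhoD]; ring
    rw [e1, e2]; exact b.smul c

/-- The operator `D_{Π,Θ}`: the Dirac operator on `ℝ \ Y` with domain
`{Ψ ∈ H¹(ℝ \ Y; ℂ²) : ρΨ ∈ ran Π, Π τΨ = Θ ρΨ}`. -/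
def dirac {n : ℕ} (y : Fin n → ℝ) (P : SymPair (C2n n)) : L2 →ₗ.[ℂ] L2 :=
  (diracMax y).domRestrict (diracBC y P)

/-- `A` extends `D|C_comp^∞(ℝ \ Y; ℂ²)`. -/
def ExtendsDirac {n : ℕ} (y : Fin n → ℝ) (A : L2 →ₗ.[ℂ] L2) : Prop :=
  ∀ φ : ℝ → C2, ContDiff ℝ ∞ φ → HasCompactSupport φ → tsupport φ ⊆ (Set.range y)ᶜ →
    ∀ Ψ : L2, Ψ =ᵐ[volume] φ → ∃ h : Ψ ∈ A.domain, A ⟨Ψ, h⟩ =ᵐ[volume]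
      fun x => (-Complex.I) • matC2 sigma1 (deriv φ x) + (1 / 2 : ℂ) • matC2 sigma3 (φ x)

/-! ### The Schrödinger operator -/

/-- The Schrödinger operator `-d²/dx²` on `ℝ \ Y`, with domain
`H²(ℝ \ Y; ℂ²) = {Ψ ∈ H¹(ℝ \ Y; ℂ²) : Ψ' ∈ H¹(ℝ \ Y; ℂ²)}`. -/
def schrMax {n : ℕ} (y : Fin n → ℝ) : L2 →ₗ.[ℂ] L2 := -(pcomp (wderiv y) (wderiv y))

/-- `τ̂ψ` for a scalar function `ψ` with one-sided limits `l, r`, and `l', r'` for `ψ'`: the blocks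
are the mean values of `ψ` and of `ψ'` at `y_k`. -/
def tauS {n : ℕ} (l r l' r' : Fin n → ℂ) : C2n n :=
  WithLp.toLp 2 fun p => ![(l p.1 + r p.1) / 2, (l' p.1 + r' p.1) / 2] p.2

/-- `ρ̂ψ` for a scalar function `ψ`: the blocks are `([ψ']_{y_k}, -[ψ]_{y_k})`. -/
def rhoS {n : ℕ} (l r l' r' : Fin n → ℂ) : C2n n :=
  WithLp.toLp 2 fun p => ![r' p.1 - l' p.1, -(r p.1 - l p.1)] p.2

/-- The direct sum `a ⊕ b ∈ ℂ²ⁿ ⊕ ℂ²ⁿ = ℂ⁴ⁿ`. -/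
def dsumVec {n : ℕ} (a b : C2n n) : C4n n := WithLp.toLp 2 fun q => (![a, b] q.1) q.2

/-- `(τ̂ 𝟙)Ψ = τ̂ψ₁ ⊕ τ̂ψ₂`. -/
def tauH {n : ℕ} (l r l' r' : Fin n → C2) : C4n n :=
  dsumVec (tauS (fun k => l k 0) (fun k => r k 0) (fun k => l' k 0) (fun k => r' k 0))
    (tauS (fun k => l k 1) (fun k => r k 1) (fun k => l' k 1) (fun k => r' k 1))

/-- `(ρ̂ 𝟙)Ψ = ρ̂ψ₁ ⊕ ρ̂ψ₂`. -/
def rhoH {n : ℕ} (l r l' r' : Fin n → C2) : C4n n :=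
  dsumVec (rhoS (fun k => l k 0) (fun k => r k 0) (fun k => l' k 0) (fun k => r' k 0))
    (rhoS (fun k => l k 1) (fun k => r k 1) (fun k => l' k 1) (fun k => r' k 1))

theorem tauH_add {n : ℕ} (l r l' r' m s m' s' : Fin n → C2) :
    tauH (l + m) (r + s) (l' + m') (r' + s') = tauH l r l' r' + tauH m s m' s' := by
  ext ⟨j, k, i⟩
  fin_cases j <;> fin_cases i <;> simp [tauH, tauS, dsumVec] <;> ring

theorem rhoH_add {n : ℕ} (l r l' r' m s m' s' : Fin n → C2) :
    rhoH (l + m) (r + s) (l' + m') (r' + s') = rhoH l r l' r' + rhoH m s m' s' := by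
  ext ⟨j, k, i⟩
  fin_cases j <;> fin_cases i <;> simp [rhoH, rhoS, dsumVec] <;> ring

theorem tauH_smul {n : ℕ} (c : ℂ) (l r l' r' : Fin n → C2) :
    tauH (c • l) (c • r) (c • l') (c • r') = c • tauH l r l' r' := by
  ext ⟨j, k, i⟩
  fin_cases j <;> fin_cases i <;> simp [tauH, tauS, dsumVec] <;> ring

theorem rhoH_smul {n : ℕ} (c : ℂ) (l r l' r' : Fin n → C2) :
    rhoH (c • l) (c • r) (c • l') (c • r') = c • rhoH l r l' r' := by
  ext ⟨j, k, i⟩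
  fin_cases j <;> fin_cases i <;> simp [rhoH, rhoS, dsumVec] <;> ring

/-- The functions `Ψ ∈ H¹(ℝ \ Y; ℂ²)` such that `Ψ, Ψ'` have one-sided limits at the points of `Y`
that satisfy `(ρ̂ 𝟙)Ψ ∈ ran Π̂`, `Π̂ (τ̂ 𝟙)Ψ = Θ̂ (ρ̂ 𝟙)Ψ`. -/
def schrBC {n : ℕ} (y : Fin n → ℝ) (P : SymPair (C4n n)) : Submodule ℂ L2 where
  carrier := {Ψ | ∃ (h : Ψ ∈ H1 y) (l r l' r' : Fin n → C2),
    HasSideLimits y Ψ l r ∧ HasSideLimits y (wderiv y ⟨Ψ, h⟩) l' r' ∧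
      P.BC (tauH l r l' r') (rhoH l r l' r')}
  zero_mem' := by
    refine ⟨Submodule.zero_mem _, 0, 0, 0, 0, HasSideLimits.zero y, ?_, ?_⟩
    · have : wderiv y ⟨0, Submodule.zero_mem _⟩ = 0 := (wderiv y).map_zero
      rw [this]; exact HasSideLimits.zero y
    · have e1 : tauH (0 : Fin n → C2) 0 0 0 = 0 := by
        simpa using tauH_smul (0 : ℂ) (0 : Fin n → C2) 0 0 0
      have e2 : rhoH (0 : Fin n → C2) 0 0 0 = 0 := by
        simpa using rhoH_smul (0 : ℂ) (0 : Fin n → C2) 0 0 0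
      rw [e1, e2]; exact SymPair.BC.zero P
  add_mem' := by
    rintro f g ⟨hf, l, r, l', r', h1, h2, b⟩ ⟨hg, m, s, m', s', k1, k2, c⟩
    refine ⟨Submodule.add_mem _ hf hg, l + m, r + s, l' + m', r' + s', h1.add k1, ?_, ?_⟩
    · have : wderiv y ⟨f + g, Submodule.add_mem _ hf hg⟩ = wderiv y ⟨f, hf⟩ + wderiv y ⟨g, hg⟩ :=
        (wderiv y).map_add ⟨f, hf⟩ ⟨g, hg⟩
      rw [this]; exact h2.add k2
    · rw [tauH_add, rhoH_add]; exact b.add c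
  smul_mem' := by
    rintro c f ⟨hf, l, r, l', r', h1, h2, b⟩
    refine ⟨Submodule.smul_mem _ c hf, c • l, c • r, c • l', c • r', h1.smul c, ?_, ?_⟩
    · have : wderiv y ⟨c • f, Submodule.smul_mem _ c hf⟩ = c • wderiv y ⟨f, hf⟩ :=
        (wderiv y).map_smul c ⟨f, hf⟩
      rw [this]; exact h2.smul c
    · rw [tauH_smul, rhoH_smul]; exact b.smul c

/-- The operator `Ĥ_{Π̂,Θ̂}`: the Schrödinger operator on `ℝ \ Y` with domain
`{Ψ ∈ H²(ℝ \ Y; ℂ²) : (ρ̂ 𝟙)Ψ ∈ ran Π̂, Π̂ (τ̂ 𝟙)Ψ = Θ̂ (ρ̂ 𝟙)Ψ}`. -/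
def schr {n : ℕ} (y : Fin n → ℝ) (P : SymPair (C4n n)) : L2 →ₗ.[ℂ] L2 :=
  (schrMax y).domRestrict (schrBC y P)

/-- `A` extends `(-d²/dx²) 𝟙|C_comp^∞(ℝ \ Y; ℂ²)`. -/
def ExtendsSchr {n : ℕ} (y : Fin n → ℝ) (A : L2 →ₗ.[ℂ] L2) : Prop :=
  ∀ φ : ℝ → C2, ContDiff ℝ ∞ φ → HasCompactSupport φ → tsupport φ ⊆ (Set.range y)ᶜ →
    ∀ Ψ : L2, Ψ =ᵐ[volume] φ → ∃ h : Ψ ∈ A.domain, A ⟨Ψ, h⟩ =ᵐ[volume] fun x => -deriv (deriv φ) x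

/-! ### The matrices `M₁`, `M₂` and the unitary `U` -/

def M1 : Matrix (Fin 4) (Fin 4) ℂ :=
  !![1, 0, 0, 0;
     0, Complex.I / 2, 0, Complex.I;
     0, 1, 0, 0;
     -Complex.I / 2, 0, Complex.I, 0]

def M2 : Matrix (Fin 4) (Fin 4) ℂ :=
  !![1 / 2, 0, 1, 0;
     0, Complex.I, 0, 0;
     0, -1 / 2, 0, 1;
     Complex.I, 0, 0, 0]

/-- The unitary `U : ℂ²ⁿ ⊕ ℂ²ⁿ → ℂ⁴ ⊕ ⋯ ⊕ ℂ⁴`,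
`U(ξ₁, …, ξ₂ₙ) = (ξ₁, ξₙ₊₁, ξ₂, ξₙ₊₂, …, ξₙ, ξ₂ₙ)` with `ξ_k ∈ ℂ²`: it sends the entry of index
`(j, k, i)` to the entry of index `(k, j, i)`. -/
def U (n : ℕ) : C4n n ≃ₗᵢ[ℂ] C4nBlock n :=
  LinearIsometryEquiv.piLpCongrLeft 2 ℂ ℂ
    { toFun := fun q => (q.2.1, q.1, q.2.2)
      invFun := fun q => (q.2.1, q.1, q.2.2)
      left_inv := fun _ => rfl
      right_inv := fun _ => rfl }

/-- `M^⊕ = M ⊕ ⋯ ⊕ M` (`n` copies) on `ℂ⁴ ⊕ ⋯ ⊕ ℂ⁴`; here `ℂ² ⊕ ℂ² = ℂ⁴` by concatenation, i.e.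
`(j, i)` is identified with `i + 2 j`. -/
def blockSum (n : ℕ) (M : Matrix (Fin 4) (Fin 4) ℂ) :
    Matrix (Fin n × Fin 2 × Fin 2) (Fin n × Fin 2 × Fin 2) ℂ :=
  (1 : Matrix (Fin n) (Fin n) ℂ) ⊗ₖ M.submatrix finProdFinEquiv finProdFinEquiv

/-- `U* B U : ℂ⁴ⁿ → ℂ⁴ⁿ`. -/
def conjU {n : ℕ} (B : Matrix (Fin n × Fin 2 × Fin 2) (Fin n × Fin 2 × Fin 2) ℂ) :
    C4n n →ₗ[ℂ] C4n n :=
  (U n).symm.toLinearEquiv.toLinearMap ∘ₗ Matrix.toEuclideanLin B ∘ₗ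
    (U n).toLinearEquiv.toLinearMap

/-- `T ⊕ T` on `ℂ²ⁿ ⊕ ℂ²ⁿ = ℂ⁴ⁿ`. -/
def dsum {n : ℕ} (T : C2n n →ₗ[ℂ] C2n n) : C4n n →ₗ[ℂ] C4n n where
  toFun ξ := dsumVec (T (WithLp.toLp 2 fun p => ξ (0, p))) (T (WithLp.toLp 2 fun p => ξ (1, p)))
  map_add' := by
    intro ξ η
    have e : ∀ j : Fin 2, (WithLp.toLp 2 (fun p => (ξ + η) (j, p)) : C2n n)
        = WithLp.toLp 2 (fun p => ξ (j, p)) + WithLp.toLp 2 (fun p => η (j, p)) := by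
      intro j; ext p; simp
    rw [e 0, e 1, LinearMap.map_add, LinearMap.map_add]
    ext ⟨j, p⟩
    fin_cases j <;> simp [dsumVec]
  map_smul' := by
    intro c ξ
    have e : ∀ j : Fin 2, (WithLp.toLp 2 (fun p => (c • ξ) (j, p)) : C2n n)
        = c • WithLp.toLp 2 (fun p => ξ (j, p)) := by
      intro j; ext p; simp
    rw [e 0, e 1, LinearMap.map_smul, LinearMap.map_smul]
    ext ⟨j, p⟩
    fin_cases j <;> simp [dsumVec]

/-- The matrix inverses of `M₁^⊕` and `M₂^⊕` are genuine inverses. -/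
theorem isUnit_det_blockSum (n : ℕ) : IsUnit (blockSum n M1).det ∧ IsUnit (blockSum n M2).det := by
  have key : ∀ M N : Matrix (Fin 4) (Fin 4) ℂ, M * N = 1 → IsUnit (blockSum n M).det := by
    intro M N h
    refine (Matrix.isUnit_iff_isUnit_det _).mp (IsUnit.of_mul_eq_one (blockSum n N) ?_)
    rw [blockSum, blockSum, ← Matrix.mul_kronecker_mul, Matrix.submatrix_mul_equiv, h, one_mul,
      Matrix.submatrix_one_equiv, Matrix.one_kronecker_one]
  constructor
  · refine key M1 !![1, 0, 0, 0; 0, 0, 1, 0; 1 / 2, 0, 0, -Complex.I;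
      0, -Complex.I, -1 / 2, 0] ?_
    ext i j
    fin_cases i <;> fin_cases j <;> simp [M1, Matrix.mul_apply, Fin.sum_univ_four] <;>
      ring_nf
  · refine key M2 !![0, 0, 0, -Complex.I; 0, -Complex.I, 0, 0; 1, 0, 0, Complex.I / 2;
      0, -Complex.I / 2, 1, 0] ?_
    ext i j
    fin_cases i <;> fin_cases j <;> simp [M2, Matrix.mul_apply, Fin.sum_univ_four] <;>
      ring_nf

end DiracSchr

end

/-!
The maximal Dirac operator `D = -i σ₁ d/dx + σ₃/2` on `H¹(ℝ \ Y; ℂ²)` satisfies Green's identity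
`⟪DΨ, Φ⟫ - ⟪Ψ, DΦ⟫ = ⟪ρΨ, τΦ⟫ - ⟪τΨ, ρΦ⟫` (`inner_diracMax_sub`), the boundary map `(τ, ρ)` is onto
`ℂ²ⁿ × ℂ²ⁿ` (`tauD_rhoD_surjective`, `exists_mem_H1_hasSideLimits`), and `D` is the adjoint of its
restriction to test functions (`diracMax_of_forall_test`). So the self-adjoint extensions of that
restriction correspond to the subspaces `L` of `ℂ²ⁿ × ℂ²ⁿ` which are Lagrangian for the form
`⟪τ, ρ'⟫ - ⟪ρ, τ'⟫`, and these are exactly the graphs `{(τ, ρ) : ρ ∈ ran Π, Π τ = Θ ρ}` for a unique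
couple `(Π, Θ)` (`SymPair.BC_iff_forall`, `exists_symPair_of_lagrangian`).

The analytic input is that a function with a weak derivative `g` on an interval is a.e. a primitive
of `g`, by the du Bois-Reymond lemma. This gives the one-sided limits and the product rule between
neighbouring points of `Y`; the contributions of the intervals are added up by observing that
`x ↦ ∫₀ˣ v - u(x⁻) + ∑_{y_k < x} [u]_{y_k}` is locally constant when `v` is the derivative of `u`
off `Y` (`integral_eq_neg_sum_jumps`).

Since `σ₁` and `σ₃` anticommute, `D²` acts as `-d²/dx² + 1/4`. The boundary conditions for
`D_{Π,Θ}²` are those of `(Π, Θ)` for both `Ψ` and `DΨ`, and `N₁`, `N₂` carry `τΨ ⊕ τDΨ`, `ρΨ ⊕ ρDΨ`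
to the boundary values of `Ψ` for the Schrödinger operator (`tauH_rhoH_eq`). The two matrices are
tied by `N₁* N₂ = J`, the flip of the two summands (`inner_conjU_M1_conjU_M2`). As `J` commutes with
`Π ⊕ Π`, `K = N₂ (Π ⊕ Π) N₁⁻¹ = N J N*` on `ran N`, where `N` is the restriction of `N₂` to
`ran (Π ⊕ Π)`; this gives the couple `(Π̂, Θ̂)`, its symmetry and the equivalence of the boundary
conditions (`exists_symPair_hat`).

The rest is abstract: the square of a self-adjoint operator is self-adjoint because `A² + 1` is onto
(`exists_pcomp_add_self_eq`), and the statements on resolvents come from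
`-A² + z² = (-A + z)(A + z)`, with the closed graph theorem for the boundedness of the inverses.
-/

noncomputable section

namespace DiracSchr

open scoped InnerProductSpace

/-! ### Unbounded operators: squares, self-adjointness, resolvents -/

section Unbounded

variable {H : Type*} [NormedAddCommGroup H]

theorem isResolventAt_addConst [NormedSpace ℂ H] (A : H →ₗ.[ℂ] H) (c w : ℂ) (R : H →L[ℂ] H) :
    IsResolventAt (addConst A c) w R ↔ IsResolventAt A (w - c) R := by
  have e : ∀ x : A.domain, -(addConst A c x) + w • (x : H) = -A x + (w - c) • (x : H) := by
    intro x
    have : addConst A c x = c • (x : H) + A x := rfl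
    rw [this, sub_smul]
    abel
  constructor
  · rintro ⟨h1, h2⟩
    refine ⟨fun Φ => ?_, fun Ψ => ?_⟩
    · obtain ⟨h, hh⟩ := h1 Φ
      exact ⟨h, (e ⟨R Φ, h⟩).symm.trans hh⟩
    · exact (congrArg R (e Ψ)).symm.trans (h2 Ψ)
  · rintro ⟨h1, h2⟩
    refine ⟨fun Φ => ?_, fun Ψ => ?_⟩
    · obtain ⟨h, hh⟩ := h1 Φ
      exact ⟨h, (e ⟨R Φ, h⟩).trans hh⟩
    · exact (congrArg R (e Ψ)).trans (h2 Ψ)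

/-- For a closed operator bijectivity of `-A + z` suffices: by the closed graph theorem the inverse
is bounded. -/
theorem mem_resolventSet_of_bijective [NormedSpace ℂ H] [CompleteSpace H] {A : H →ₗ.[ℂ] H}
    (hA : A.IsClosed) (z : ℂ) (hinj : ∀ Ψ : A.domain, -A Ψ + z • (Ψ : H) = 0 → Ψ = 0)
    (hsurj : ∀ Φ : H, ∃ Ψ : A.domain, -A Ψ + z • (Ψ : H) = Φ) : z ∈ resolventSet A := by
  let T : A.domain →ₗ[ℂ] H := -A.toFun + z • A.domain.subtype
  have hT : ∀ Ψ : A.domain, T Ψ = -A Ψ + z • (Ψ : H) := fun Ψ => rfl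
  have hbij : Function.Bijective T :=
    ⟨(injective_iff_map_eq_zero T).mpr hinj, hsurj⟩
  let e := LinearEquiv.ofBijective T hbij
  let R : H →ₗ[ℂ] H := A.domain.subtype ∘ₗ e.symm.toLinearMap
  have hgraph : IsClosed (R.graph : Set (H × H)) := by
    have : (R.graph : Set (H × H)) =
        (fun p : H × H => (p.2, z • p.2 - p.1)) ⁻¹' (A.graph : Set (H × H)) := by
      ext ⟨Φ, Ψ⟩
      simp only [SetLike.mem_coe, LinearMap.mem_graph_iff, Set.mem_preimage,
        LinearPMap.mem_graph_iff]
      constructor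
      · rintro rfl
        refine ⟨e.symm Φ, rfl, ?_⟩
        have h : -A (e.symm Φ) + z • ((e.symm Φ : A.domain) : H) = Φ := e.apply_symm_apply Φ
        change _ = z • ((e.symm Φ : A.domain) : H) - Φ
        rw [eq_sub_iff_add_eq, ← eq_sub_iff_add_eq', sub_eq_neg_add]
        exact h.symm
      · rintro ⟨Ψ', rfl, h⟩
        have : e Ψ' = Φ := by
          change -A Ψ' + z • (Ψ' : H) = Φ
          rw [h]; abel
        rw [← this]
        change (Ψ' : H) = (e.symm (e Ψ') : A.domain)
        rw [e.symm_apply_apply]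
    rw [this]
    exact IsClosed.preimage (by fun_prop) hA
  refine ⟨ContinuousLinearMap.ofIsClosedGraph hgraph, fun Φ => ?_, fun Ψ => ?_⟩
  · exact ⟨(e.symm Φ).2, e.apply_symm_apply Φ⟩
  · exact congrArg Subtype.val (e.symm_apply_apply Ψ)

/-- The factorization `-A² + z² = (-A + z)(A + z)` relates the resolvents of `A` and `A²`. -/
theorem mem_resolventSet_pcomp_iff [NormedSpace ℂ H] [CompleteSpace H] {A : H →ₗ.[ℂ] H}
    (hA : A.IsClosed) (z : ℂ) :
    (z ∈ resolventSet A ∧ -z ∈ resolventSet A) ↔ z ^ 2 ∈ resolventSet (pcomp A A) := by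
  constructor
  · rintro ⟨⟨R, hR1, hR2⟩, ⟨Q, hQ1, hQ2⟩⟩
    refine ⟨-(Q ∘L R), fun Φ => ?_, fun Ψ => ?_⟩
    · obtain ⟨h, hh⟩ := hR1 Φ
      obtain ⟨k, hk⟩ := hQ1 (R Φ)
      have hAQ : A ⟨Q (R Φ), k⟩ = -(R Φ) - z • Q (R Φ) := by
        have e : A ⟨Q (R Φ), k⟩ = (-z) • Q (R Φ) - (-A ⟨Q (R Φ), k⟩ + -z • Q (R Φ)) := by module
        rw [hk] at e
        rw [e]
        module
      have hm : A ⟨Q (R Φ), k⟩ ∈ A.domain := by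
        rw [hAQ]
        exact A.domain.sub_mem (A.domain.neg_mem h) (A.domain.smul_mem z k)
      have hmem : Q (R Φ) ∈ (pcomp A A).domain := ⟨k, hm⟩
      have hmem' : -(Q (R Φ)) ∈ (pcomp A A).domain := (pcomp A A).domain.neg_mem hmem
      refine ⟨hmem', ?_⟩
      have e1 : pcomp A A ⟨-(Q (R Φ)), hmem'⟩ = -pcomp A A ⟨Q (R Φ), hmem⟩ :=
        (pcomp A A).map_neg ⟨Q (R Φ), hmem⟩
      have e2 : pcomp A A ⟨Q (R Φ), hmem⟩ = A ⟨A ⟨Q (R Φ), k⟩, hm⟩ := rfl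
      have e3 : A ⟨A ⟨Q (R Φ), k⟩, hm⟩ = -A ⟨R Φ, h⟩ - z • A ⟨Q (R Φ), k⟩ := by
        rw [← A.map_neg, ← A.map_smul, ← A.map_sub]
        congr 1
        exact Subtype.ext hAQ
      change -pcomp A A ⟨-(Q (R Φ)), hmem'⟩ + z ^ 2 • -(Q (R Φ)) = Φ
      rw [e1, e2, e3, hAQ]
      refine Eq.trans ?_ hh
      module
    · obtain ⟨x, hx, hAx⟩ := Ψ
      change -(Q (R (-A ⟨A ⟨x, hx⟩, hAx⟩ + z ^ 2 • x))) = x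
      have e1 : -A ⟨A ⟨x, hx⟩, hAx⟩ + z ^ 2 • x = -A (⟨A ⟨x, hx⟩, hAx⟩ + z • ⟨x, hx⟩)
          + z • (((⟨A ⟨x, hx⟩, hAx⟩ + z • ⟨x, hx⟩ : A.domain)) : H) := by
        rw [A.map_add, A.map_smul, Submodule.coe_add, Submodule.coe_smul]
        module
      rw [e1, hR2, ← map_neg]
      have e2 : -(((⟨A ⟨x, hx⟩, hAx⟩ + z • ⟨x, hx⟩ : A.domain)) : H)
          = -A ⟨x, hx⟩ + (-z) • ((⟨x, hx⟩ : A.domain) : H) := by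
        rw [Submodule.coe_add, Submodule.coe_smul]
        module
      rw [e2, hQ2]
  · suffices h : ∀ w : ℂ, w ^ 2 ∈ resolventSet (pcomp A A) → w ∈ resolventSet A from
      fun hz => ⟨h z hz, h (-z) (by rwa [neg_sq])⟩
    rintro w ⟨S, hS1, hS2⟩
    refine mem_resolventSet_of_bijective hA w (fun Ψ hΨ => ?_) fun Φ => ?_
    · have hAΨ : A Ψ = w • (Ψ : H) := (neg_add_eq_zero.mp hΨ)
      have hm : A Ψ ∈ A.domain := by
        rw [hAΨ]; exact A.domain.smul_mem w Ψ.2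
      have e : A ⟨A Ψ, hm⟩ = w • A Ψ := by
        rw [← A.map_smul]
        congr 1
        exact Subtype.ext hAΨ
      have := hS2 ⟨Ψ, Ψ.2, hm⟩
      change S (-A ⟨A Ψ, hm⟩ + w ^ 2 • (Ψ : H)) = Ψ at this
      rw [e, hAΨ] at this
      have e0 : -(w • w • (Ψ : H)) + w ^ 2 • (Ψ : H) = 0 := by module
      rw [e0, map_zero] at this
      exact Subtype.ext this.symm
    · obtain ⟨⟨h, hm⟩, hh⟩ := hS1 Φ
      change -A ⟨A ⟨S Φ, h⟩, hm⟩ + w ^ 2 • S Φ = Φ at hh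
      refine ⟨⟨A ⟨S Φ, h⟩, hm⟩ + w • ⟨S Φ, h⟩, ?_⟩
      rw [A.map_add, A.map_smul, Submodule.coe_add, Submodule.coe_smul]
      refine Eq.trans ?_ hh
      module

/-- `(-A + z)⁻¹ = (A + z)(-A² + z²)⁻¹`. -/
theorem resolvent_eq_of_resolvent_pcomp [NormedSpace ℂ H] {A : H →ₗ.[ℂ] H} {z : ℂ}
    {R S : H →L[ℂ] H} (hR : IsResolventAt A z R) (hS : IsResolventAt (pcomp A A) (z ^ 2) S)
    (Φ : H) : ∃ h : S Φ ∈ A.domain, R Φ = A ⟨S Φ, h⟩ + z • S Φ := by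
  obtain ⟨⟨h, hm⟩, hh⟩ := hS.1 Φ
  change -A ⟨A ⟨S Φ, h⟩, hm⟩ + z ^ 2 • S Φ = Φ at hh
  refine ⟨h, ?_⟩
  have := hR.2 (⟨A ⟨S Φ, h⟩, hm⟩ + z • ⟨S Φ, h⟩)
  rw [A.map_add, A.map_smul, Submodule.coe_add, Submodule.coe_smul] at this
  refine Eq.trans (congrArg R ?_) this
  refine hh.symm.trans ?_
  module

variable [InnerProductSpace ℂ H] [CompleteSpace H]

/-- Von Neumann's theorem on `A* A + 1`, for self-adjoint `A`: since the graph of `A` is closed, the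
vector `(Φ, 0)` splits into a point of the graph and a vector orthogonal to it. -/
theorem exists_pcomp_add_self_eq {A : H →ₗ.[ℂ] H} (hA : IsSelfAdjoint A) (Φ : H) :
    ∃ x : (pcomp A A).domain, pcomp A A x + (x : H) = Φ := by
  let G : Submodule ℂ (WithLp 2 (H × H)) :=
    A.graph.map (WithLp.linearEquiv 2 ℂ (H × H)).symm.toLinearMap
  have hGc : IsClosed (G : Set (WithLp 2 (H × H))) := by
    have : (G : Set (WithLp 2 (H × H))) = WithLp.ofLp ⁻¹' (A.graph : Set (H × H)) := by
      ext p
      constructor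
      · rintro ⟨q, hq, rfl⟩; exact hq
      · intro hp; exact ⟨_, hp, rfl⟩
    rw [this]
    exact IsClosed.preimage (WithLp.prod_continuous_ofLp 2 H H) hA.isClosed
  have : CompleteSpace G := hGc.completeSpace_coe
  obtain ⟨p, hp, q, hq, hpq⟩ := G.exists_add_mem_mem_orthogonal (WithLp.toLp 2 (Φ, (0 : H)))
  obtain ⟨⟨x, Ax⟩, hx, rfl⟩ := hp
  obtain ⟨⟨x, hxd⟩, hx1, hx2⟩ := (LinearPMap.mem_graph_iff _).mp hx
  dsimp only at hx1 hx2
  subst hx1 hx2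
  have h1 : Φ = x + q.fst := congrArg WithLp.fst hpq
  have h2 : (0 : H) = A ⟨x, hxd⟩ + q.snd := congrArg WithLp.snd hpq
  have key : ∀ u : A.domain, ⟪q.fst, (u : H)⟫_ℂ = ⟪A ⟨x, hxd⟩, A u⟫_ℂ := by
    intro u
    have hu : WithLp.toLp 2 ((u : H), A u) ∈ G := ⟨_, A.mem_graph u, rfl⟩
    have := (Submodule.mem_orthogonal' _ _).mp hq _ hu
    rw [WithLp.prod_inner_apply] at this
    change ⟪q.fst, (u : H)⟫_ℂ + ⟪q.snd, A u⟫_ℂ = 0 at this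
    have e : q.snd = -A ⟨x, hxd⟩ := by
      rw [eq_neg_iff_add_eq_zero, add_comm]; exact h2.symm
    rw [e, inner_neg_left] at this
    exact add_neg_eq_zero.mp this
  have hm : A ⟨x, hxd⟩ ∈ A.domain := by
    have := LinearPMap.mem_adjoint_domain_of_exists (T := A) (A ⟨x, hxd⟩) ⟨_, key⟩
    rwa [LinearPMap.isSelfAdjoint_def.mp hA] at this
  have hval : A ⟨A ⟨x, hxd⟩, hm⟩ = q.fst := by
    refine hA.dense_domain.eq_of_inner_left ℂ fun u hu => ?_
    have hsym := LinearPMap.adjoint_isFormalAdjoint (T := A) hA.dense_domain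
    rw [LinearPMap.isSelfAdjoint_def.mp hA] at hsym
    rw [key ⟨u, hu⟩]
    exact hsym ⟨A ⟨x, hxd⟩, hm⟩ ⟨u, hu⟩
  refine ⟨⟨x, hxd, hm⟩, ?_⟩
  change A ⟨A ⟨x, hxd⟩, hm⟩ + x = Φ
  rw [hval, h1, add_comm]

/-- A densely defined symmetric operator `T` such that `T + c` is onto for a real `c` is
self-adjoint. -/
theorem isSelfAdjoint_of_isFormalAdjoint_of_surjective {T : H →ₗ.[ℂ] H}
    (hd : Dense (T.domain : Set H)) (hs : T.IsFormalAdjoint T) (c : ℝ)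
    (hsurj : ∀ Φ : H, ∃ x : T.domain, T x + (c : ℂ) • (x : H) = Φ) : IsSelfAdjoint T := by
  rw [LinearPMap.isSelfAdjoint_def]
  refine (LinearPMap.eq_of_le_of_domain_eq (hs.le_adjoint hd) ?_).symm
  refine le_antisymm (hs.le_adjoint hd).1 fun x hx => ?_
  obtain ⟨u, hu⟩ := hsurj (T.adjoint ⟨x, hx⟩ + (c : ℂ) • x)
  have hadj := LinearPMap.adjoint_isFormalAdjoint hd
  have : x = u := by
    obtain ⟨v, hv⟩ := hsurj (x - u)
    rw [← sub_eq_zero, ← inner_self_eq_zero (𝕜 := ℂ)]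
    nth_rewrite 2 [← hv]
    have e1 : ⟪x, T v⟫_ℂ = ⟪T.adjoint ⟨x, hx⟩, (v : H)⟫_ℂ := (hadj ⟨x, hx⟩ v).symm
    have e2 : ⟪(u : H), T v⟫_ℂ = ⟪T u, (v : H)⟫_ℂ := (hs u v).symm
    have e3 : ⟪(T u + (c : ℂ) • (u : H)) , (v : H)⟫_ℂ
        = ⟪T.adjoint ⟨x, hx⟩ + (c : ℂ) • x, (v : H)⟫_ℂ := by rw [hu]
    simp only [inner_add_left, inner_smul_left, Complex.conj_ofReal] at e3
    simp only [inner_add_right, inner_sub_left, inner_smul_right, e1, e2]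
    linear_combination -e3
  rw [this]
  exact u.2

theorem isFormalAdjoint_of_isSelfAdjoint {A : H →ₗ.[ℂ] H} (hA : IsSelfAdjoint A) :
    A.IsFormalAdjoint A := by
  have hsym := LinearPMap.adjoint_isFormalAdjoint (T := A) hA.dense_domain
  rwa [LinearPMap.isSelfAdjoint_def.mp hA] at hsym

/-- If `A` is self-adjoint, so is `B = A² - c` for real `c`, as soon as `B` is densely defined. -/
theorem isSelfAdjoint_of_pcomp_eq_addConst {A B : H →ₗ.[ℂ] H} (hA : IsSelfAdjoint A) (c : ℝ)
    (h : pcomp A A = addConst B (c : ℂ)) (hd : Dense (B.domain : Set H)) : IsSelfAdjoint B := by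
  have hdom : (pcomp A A).domain = B.domain := by rw [h]; rfl
  have hval : ∀ (x : H) (h1 : x ∈ (pcomp A A).domain) (h2 : x ∈ B.domain),
      pcomp A A ⟨x, h1⟩ = (c : ℂ) • x + B ⟨x, h2⟩ := by
    rw [h]; intro x h1 h2; rfl
  refine isSelfAdjoint_of_isFormalAdjoint_of_surjective hd ?_ (c + 1) fun Φ => ?_
  · rintro ⟨x, hx⟩ ⟨y, hy⟩
    obtain ⟨hx1, hx2⟩ : x ∈ (pcomp A A).domain := hdom ▸ hx
    obtain ⟨hy1, hy2⟩ : y ∈ (pcomp A A).domain := hdom ▸ hy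
    have ex : A ⟨A ⟨x, hx1⟩, hx2⟩ = (c : ℂ) • x + B ⟨x, hx⟩ := hval x ⟨hx1, hx2⟩ hx
    have ey : A ⟨A ⟨y, hy1⟩, hy2⟩ = (c : ℂ) • y + B ⟨y, hy⟩ := hval y ⟨hy1, hy2⟩ hy
    have s := isFormalAdjoint_of_isSelfAdjoint hA
    have s1 : ⟪A ⟨A ⟨x, hx1⟩, hx2⟩, y⟫_ℂ = ⟪A ⟨x, hx1⟩, A ⟨y, hy1⟩⟫_ℂ := s ⟨_, hx2⟩ ⟨y, hy1⟩
    have s2 : ⟪A ⟨x, hx1⟩, A ⟨y, hy1⟩⟫_ℂ = ⟪x, A ⟨A ⟨y, hy1⟩, hy2⟩⟫_ℂ := s ⟨x, hx1⟩ ⟨_, hy2⟩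
    rw [ex] at s1
    rw [ey] at s2
    rw [← s1] at s2
    simp only [inner_add_left, inner_add_right, inner_smul_left, inner_smul_right,
      Complex.conj_ofReal] at s2
    exact add_left_cancel s2
  · obtain ⟨⟨x, hx⟩, e⟩ := exists_pcomp_add_self_eq hA Φ
    have hx' : x ∈ B.domain := hdom ▸ hx
    refine ⟨⟨x, hx'⟩, ?_⟩
    rw [hval x hx hx'] at e
    rw [← e]
    push_cast
    module

end Unbounded

/-! ### Couples `(Π, Θ)` and Lagrangian subspaces -/

section Pairs

variable {V : Type} [NormedAddCommGroup V] [InnerProductSpace ℂ V]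

theorem SymPair.proj_eq_self (P : SymPair V) {v : V} (hv : v ∈ LinearMap.range P.proj) :
    P.proj v = v := by
  obtain ⟨u, rfl⟩ := hv
  exact LinearMap.congr_fun P.isProj.isIdempotentElem u

theorem SymPair.ext_apply (P : SymPair V) (v : V) :
    P.ext v = (P.op ⟨P.proj v, LinearMap.mem_range_self _ v⟩ : V) := rfl

theorem SymPair.proj_ext (P : SymPair V) (v : V) : P.proj (P.ext v) = P.ext v :=
  P.proj_eq_self (P.op _).2

theorem SymPair.ext_isSymmetric (P : SymPair V) : P.ext.IsSymmetric := by
  intro x y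
  have h := P.isSymm ⟨P.proj x, LinearMap.mem_range_self _ x⟩
    ⟨P.proj y, LinearMap.mem_range_self _ y⟩
  rw [Submodule.coe_inner, Submodule.coe_inner] at h
  change ⟪P.ext x, P.proj y⟫_ℂ = ⟪P.proj x, P.ext y⟫_ℂ at h
  rwa [← P.isProj.isSymmetric, P.proj_ext, P.isProj.isSymmetric, P.proj_ext] at h

theorem SymPair.BC_iff (P : SymPair V) (τ ρ : V) :
    P.BC τ ρ ↔ P.proj ρ = ρ ∧ P.proj τ = P.ext ρ := by
  constructor
  · rintro ⟨h, e⟩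
    have h' := P.proj_eq_self h
    refine ⟨h', e.trans ?_⟩
    rw [SymPair.ext_apply]
    congr 2
    exact Subtype.ext h'.symm
  · rintro ⟨h, e⟩
    refine ⟨⟨ρ, h⟩, e.trans ?_⟩
    rw [SymPair.ext_apply]
    congr 2
    exact Subtype.ext h

/-- The boundary condition of a couple defines a Lagrangian subspace for the form
`⟪τ, ρ'⟫_ℂ - ⟪ρ, τ'⟫_ℂ`. -/
theorem SymPair.BC_iff_forall (P : SymPair V) (τ ρ : V) :
    P.BC τ ρ ↔ ∀ τ' ρ', P.BC τ' ρ' → ⟪τ, ρ'⟫_ℂ = ⟪ρ, τ'⟫_ℂ := by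
  simp only [SymPair.BC_iff]
  constructor
  · rintro ⟨h1, h2⟩ τ' ρ' ⟨h1', h2'⟩
    rw [← h1', ← P.isProj.isSymmetric, h2, P.ext_isSymmetric, ← h2', ← P.isProj.isSymmetric, h1]
  · intro h
    have h1 : P.proj ρ = ρ := by
      -- the pair `(ρ - Π ρ, 0)` satisfies the boundary condition
      have := h (ρ - P.proj ρ) 0 ⟨by simp, by
        rw [map_sub, P.proj_eq_self (LinearMap.mem_range_self _ ρ), sub_self, map_zero]⟩
      rw [inner_zero_right] at this
      have h0 : ⟪P.proj ρ, ρ - P.proj ρ⟫_ℂ = 0 := by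
        rw [P.isProj.isSymmetric, map_sub, P.proj_eq_self (LinearMap.mem_range_self _ ρ),
          sub_self, inner_zero_right]
      have h3 : ⟪ρ - P.proj ρ, ρ - P.proj ρ⟫_ℂ = 0 := by
        rw [inner_sub_left, ← this, h0, sub_self]
      exact (sub_eq_zero.mp (inner_self_eq_zero.mp h3)).symm
    refine ⟨h1, ext_inner_right ℂ fun v => ?_⟩
    have := h (P.ext (P.proj v)) (P.proj v)
      ⟨P.proj_eq_self (LinearMap.mem_range_self _ v), P.proj_ext _⟩
    rw [P.isProj.isSymmetric, this, ← P.ext_isSymmetric, ← P.isProj.isSymmetric, P.proj_ext]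

/-- A couple is determined by its boundary condition: `(Θ ρ, ρ)` satisfies it for `ρ ∈ ran Π`. -/
theorem SymPair.eq_of_BC_iff {P Q : SymPair V} (h : ∀ τ ρ, P.BC τ ρ ↔ Q.BC τ ρ) : P = Q := by
  have hr : ∀ {P Q : SymPair V}, (∀ τ ρ, P.BC τ ρ ↔ Q.BC τ ρ) →
      LinearMap.range P.proj ≤ LinearMap.range Q.proj := by
    intro P Q h v hv
    have hv' := P.proj_eq_self hv
    have : P.BC (P.ext v) v := (P.BC_iff _ _).mpr ⟨hv', P.proj_ext v⟩
    exact ((h _ _).mp this).1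
  have hp : P.proj = Q.proj :=
    P.isProj.ext Q.isProj (le_antisymm (hr h) (hr fun τ ρ => (h τ ρ).symm))
  have ho : ∀ (v : V) (h1 : v ∈ LinearMap.range P.proj) (h2 : v ∈ LinearMap.range Q.proj),
      (P.op ⟨v, h1⟩ : V) = Q.op ⟨v, h2⟩ := by
    intro v h1 h2
    obtain ⟨h3, e⟩ := (h (P.op ⟨v, h1⟩) v).mp ⟨h1, P.proj_eq_self (P.op _).2⟩
    rw [← e, ← hp, P.proj_eq_self (P.op _).2]
  obtain ⟨p, hp1, o, ho1⟩ := P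
  obtain ⟨q, hq1, o', ho1'⟩ := Q
  dsimp only at hp
  subst hp
  congr 1
  ext ⟨v, hv⟩
  exact ho v hv hv

/-- Every Lagrangian subspace comes from a couple: `ran Π` is its projection onto the `ρ`-component,
and `Θ ρ = Π τ` for `(τ, ρ)` in the subspace. -/
theorem exists_symPair_of_lagrangian [FiniteDimensional ℂ V] (L : Submodule ℂ (V × V))
    (hL : ∀ p, p ∈ L ↔ ∀ q ∈ L, ⟪p.1, q.2⟫_ℂ = ⟪p.2, q.1⟫_ℂ) :
    ∃ P : SymPair V, ∀ τ ρ, (τ, ρ) ∈ L ↔ P.BC τ ρ := by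
  let R : Submodule ℂ V := L.map (LinearMap.snd ℂ V V)
  let p : V →ₗ[ℂ] V := R.starProjection.toLinearMap
  have hpR : LinearMap.range p = R := R.range_starProjection
  have hpself : ∀ v ∈ R, p v = v := fun v hv => Submodule.starProjection_eq_self_iff.mpr hv
  have hpsymm : p.IsSymmetric := fun x y => R.inner_starProjection_left_eq_right x y
  have hp : p.IsSymmetricProjection :=
    ⟨LinearMap.ext fun x => hpself _ (hpR ▸ LinearMap.mem_range_self p x), hpsymm⟩
  let f : L →ₗ[ℂ] LinearMap.range p := p.rangeRestrict ∘ₗ LinearMap.snd ℂ V V ∘ₗ L.subtype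
  have hf : ∀ q : L, (f q : V) = q.1.2 := fun q => hpself _ ⟨q.1, q.2, rfl⟩
  have hfs : LinearMap.range f = ⊤ := by
    rw [LinearMap.range_eq_top]
    rintro ⟨v, hv⟩
    obtain ⟨q, hq, rfl⟩ := hpR ▸ hv
    exact ⟨⟨q, hq⟩, Subtype.ext (hf _)⟩
  obtain ⟨s, hs⟩ := f.exists_rightInverse_of_surjective hfs
  have hs' : ∀ r : LinearMap.range p, (s r).1.2 = r := fun r => by
    rw [← hf, ← LinearMap.comp_apply, hs]; rfl
  let o : LinearMap.range p →ₗ[ℂ] LinearMap.range p :=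
    p.rangeRestrict ∘ₗ LinearMap.fst ℂ V V ∘ₗ L.subtype ∘ₗ s
  have ho : ∀ r, (o r : V) = p (s r).1.1 := fun r => rfl
  have hrange : ∀ r : LinearMap.range p, p r = r := fun r => hpself _ (hpR ▸ r.2)
  have ho' : ∀ r r' : LinearMap.range p, ⟪(o r : V), (r' : V)⟫_ℂ = ⟪(s r).1.1, (r' : V)⟫_ℂ := by
    intro r r'
    rw [ho, hpsymm, hrange]
  have hsymm : o.IsSymmetric := by
    intro r r'
    rw [Submodule.coe_inner, Submodule.coe_inner, ho', ← inner_conj_symm (r : V), ho',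
      inner_conj_symm]
    have := (hL (s r).1).mp (s r).2 (s r').1 (s r').2
    rwa [hs', hs'] at this
  let P : SymPair V := ⟨p, hp, o, hsymm⟩
  -- `L` is contained in the Lagrangian subspace of `P`, hence equal to it
  have hle : ∀ τ ρ, (τ, ρ) ∈ L → P.BC τ ρ := by
    intro τ ρ h
    have hρ : ρ ∈ LinearMap.range p := hpR ▸ ⟨(τ, ρ), h, rfl⟩
    refine ⟨hρ, ?_⟩
    change p τ = o ⟨ρ, hρ⟩
    rw [ho, ← sub_eq_zero, ← map_sub]
    have hm : (τ - (s ⟨ρ, hρ⟩).1.1, (0 : V)) ∈ L := by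
      have := L.sub_mem h (s ⟨ρ, hρ⟩).2
      have e : (τ, ρ) - (s ⟨ρ, hρ⟩).1 = (τ - (s ⟨ρ, hρ⟩).1.1, 0) :=
        Prod.ext rfl ((congrArg (ρ - ·) (hs' ⟨ρ, hρ⟩)).trans (sub_self ρ))
      rwa [e] at this
    refine ext_inner_right ℂ fun v => ?_
    obtain ⟨q, hq, hqv⟩ : p v ∈ R := hpR ▸ LinearMap.mem_range_self p v
    have := (hL _).mp hm q hq
    rw [inner_zero_left] at this
    rw [hpsymm, ← hqv, inner_zero_left]
    exact this
  refine ⟨P, fun τ ρ => ⟨hle τ ρ, fun h => ?_⟩⟩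
  rw [hL]
  intro q hq
  exact (P.BC_iff_forall τ ρ).mp h q.1 q.2 (hle _ _ hq)

/-- The couple `(Π̂, Θ̂)` in an abstract setting. Here `T` and `E` play the roles of `Π ⊕ Π` and
`Π Θ Π ⊕ Π Θ Π`, and `J` that of the flip of the two summands. By `h12`, `N₁⁻¹` is `J N₂*`, so that
`K = N₂ T N₁⁻¹` equals `(N₂ T) J (N₂ T)*`, which is injective on `ran (N₂ T)`. -/
theorem exists_symPair_hat [FiniteDimensional ℂ V] {T E J N₁ N₂ N₁' N₂' : V →ₗ[ℂ] V}
    (hT : T.IsSymmetricProjection) (hE : E.IsSymmetric) (hTE : ∀ x, T (E x) = E x)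
    (hJ : J.IsSymmetric) (hJJ : ∀ x, J (J x) = x) (hJT : ∀ x, J (T x) = T (J x))
    (hJE : ∀ x, J (E x) = E (J x)) (h12 : ∀ a b, ⟪N₁ a, N₂ b⟫_ℂ = ⟪J a, b⟫_ℂ)
    (h1 : ∀ x, N₁ (N₁' x) = x) (h1' : ∀ x, N₁' (N₁ x) = x) (h2 : ∀ x, N₂ (N₂' x) = x)
    (h2' : ∀ x, N₂' (N₂ x) = x) :
    ∃ Q : SymPair V,
      LinearMap.range Q.proj = LinearMap.range (N₂ ∘ₗ T) ∧
      LinearMap.range Q.proj = LinearMap.range (N₂ ∘ₗ T ∘ₗ N₁') ∧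
      (∃ (N : LinearMap.range T →ₗ[ℂ] V) (N' : V →ₗ[ℂ] LinearMap.range T)
          (G : LinearMap.range T ≃ₗ[ℂ] LinearMap.range T),
        N = N₂ ∘ₗ (LinearMap.range T).subtype ∧
        N' = LinearMap.adjoint (𝕜 := ℂ) (E := LinearMap.range T) (F := V) N ∧
        G.toLinearMap = N' ∘ₗ N ∧ Q.proj = N ∘ₗ G.symm.toLinearMap ∘ₗ N') ∧
      Module.finrank ℂ (LinearMap.range Q.proj) = Module.finrank ℂ (LinearMap.range T) ∧
      (∃ K : LinearMap.range Q.proj ≃ₗ[ℂ] LinearMap.range Q.proj,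
        (∀ v : LinearMap.range Q.proj, (K v : V) = N₂ (T (N₁' v))) ∧
        ∀ v : LinearMap.range Q.proj, (K (Q.op v) : V) = N₂ (E (N₂' v))) ∧
      (T = LinearMap.id → Q.proj = LinearMap.id ∧
        ∀ v : LinearMap.range Q.proj, (Q.op v : V) = N₁ (E (N₂' v))) ∧
      ∀ t r, Q.BC (N₁ t) (N₂ r) ↔ T r = r ∧ T t = E r := by
  have hTT : ∀ x, T (T x) = T x := fun x => LinearMap.congr_fun hT.isIdempotentElem x
  have hTs := hT.isSymmetric
  have hinj : Function.Injective N₂ := Function.LeftInverse.injective h2'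
  have h1J : ∀ a b, ⟪N₁' a, J b⟫_ℂ = ⟪a, N₂ b⟫_ℂ := by
    intro a b
    rw [← hJ, ← h12, h1]
  -- the projector
  let N : LinearMap.range T →ₗ[ℂ] V := N₂ ∘ₗ (LinearMap.range T).subtype
  have hN : ∀ r : LinearMap.range T, N r = N₂ r := fun r => rfl
  let N' : V →ₗ[ℂ] LinearMap.range T :=
    LinearMap.adjoint (𝕜 := ℂ) (E := LinearMap.range T) (F := V) N
  have hN' : ∀ x r, ⟪N' x, r⟫_ℂ = ⟪x, N r⟫_ℂ := fun x r => LinearMap.adjoint_inner_left N r x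
  have hN'' : ∀ r x, ⟪r, N' x⟫_ℂ = ⟪N r, x⟫_ℂ := fun r x => LinearMap.adjoint_inner_right N r x
  have hGinj : Function.Injective (N' ∘ₗ N) := by
    rw [injective_iff_map_eq_zero]
    intro r hr
    have : ⟪N r, N r⟫_ℂ = 0 := by
      rw [← hN', ← LinearMap.comp_apply, hr, inner_zero_left]
    exact Subtype.ext (hinj ((inner_self_eq_zero.mp this).trans (map_zero N₂).symm))
  let G : LinearMap.range T ≃ₗ[ℂ] LinearMap.range T := LinearEquiv.ofInjectiveEndo _ hGinj
  have hG : ∀ r, G r = N' (N r) := fun r => rfl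
  have hGs : ∀ r, G.symm (N' (N r)) = r := fun r => by rw [← hG, G.symm_apply_apply]
  have hGsymm : ∀ a b, ⟪G.symm a, b⟫_ℂ = ⟪a, G.symm b⟫_ℂ := by
    intro a b
    obtain ⟨a, rfl⟩ := G.surjective a
    obtain ⟨b, rfl⟩ := G.surjective b
    rw [G.symm_apply_apply, G.symm_apply_apply, hG, hG, hN', hN'']
  let p : V →ₗ[ℂ] V := N ∘ₗ G.symm.toLinearMap ∘ₗ N'
  have hpa : ∀ x, p x = N (G.symm (N' x)) := fun x => rfl
  have hpN : ∀ r, p (N r) = N r := fun r => by rw [hpa, hGs]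
  have hpsymm : p.IsSymmetric := by
    intro x y
    rw [hpa, hpa, ← hN'', hGsymm, hN']
  have hp : p.IsSymmetricProjection := ⟨LinearMap.ext fun x => hpN _, hpsymm⟩
  have hmem : ∀ v, v ∈ LinearMap.range p ↔ ∃ r, T r = r ∧ N₂ r = v := by
    intro v
    constructor
    · rintro ⟨x, rfl⟩
      obtain ⟨⟨_, r, rfl⟩, hr⟩ : ∃ r, N r = p x := ⟨_, rfl⟩
      exact ⟨T r, hTT r, hr⟩
    · rintro ⟨r, hr, rfl⟩
      exact ⟨_, hpN ⟨r, r, hr⟩⟩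
  have hr1 : LinearMap.range p = LinearMap.range (N₂ ∘ₗ T) := by
    ext v
    rw [hmem]
    constructor
    · rintro ⟨r, hr, rfl⟩
      exact ⟨r, congrArg N₂ hr⟩
    · rintro ⟨r, rfl⟩
      exact ⟨T r, hTT r, rfl⟩
  have hr2 : LinearMap.range p = LinearMap.range (N₂ ∘ₗ T ∘ₗ N₁') := by
    rw [hr1]
    ext v
    constructor
    · rintro ⟨r, rfl⟩
      exact ⟨N₁ r, by simp [h1']⟩
    · rintro ⟨r, rfl⟩
      exact ⟨N₁' r, rfl⟩
  have hfr : Module.finrank ℂ (LinearMap.range p) = Module.finrank ℂ (LinearMap.range T) := by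
    rw [hr1, LinearMap.range_comp]
    exact LinearEquiv.finrank_eq (Submodule.equivMapOfInjective N₂ hinj _).symm
  -- `K`, injective because `⟪T N₁⁻¹ v, J r⟫_ℂ = ⟪v, v⟫_ℂ` for `v = N₂ r`, `T r = r`
  let K₀ : LinearMap.range p →ₗ[ℂ] LinearMap.range p :=
    LinearMap.codRestrict _ (N₂ ∘ₗ T ∘ₗ N₁' ∘ₗ (LinearMap.range p).subtype)
      fun v => (hmem _).mpr ⟨_, hTT _, rfl⟩
  have hK₀ : ∀ v, (K₀ v : V) = N₂ (T (N₁' v)) := fun v => rfl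
  have hTJ : ∀ x r, T r = r → ⟪T (N₁' x), J r⟫_ℂ = ⟪x, N₂ r⟫_ℂ := by
    intro x r hr
    rw [hTs, ← hJT, hr, h1J]
  have hK₀inj : Function.Injective K₀ := by
    rw [injective_iff_map_eq_zero]
    rintro ⟨v, hv⟩ h
    obtain ⟨r, hr, rfl⟩ := (hmem v).mp hv
    have e : T (N₁' (N₂ r)) = 0 :=
      hinj ((congrArg Subtype.val h).trans (map_zero N₂).symm)
    have := hTJ (N₂ r) r hr
    rw [e, inner_zero_left] at this
    exact Subtype.ext (inner_self_eq_zero.mp this.symm)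
  let K : LinearMap.range p ≃ₗ[ℂ] LinearMap.range p := LinearEquiv.ofInjectiveEndo K₀ hK₀inj
  have hK : ∀ v, (K v : V) = N₂ (T (N₁' v)) := fun v => rfl
  -- the operator `Θ̂`
  let S : LinearMap.range p →ₗ[ℂ] LinearMap.range p :=
    LinearMap.codRestrict _ (N₂ ∘ₗ E ∘ₗ N₂' ∘ₗ (LinearMap.range p).subtype)
      fun v => (hmem _).mpr ⟨_, hTE _, rfl⟩
  let o : LinearMap.range p →ₗ[ℂ] LinearMap.range p := K.symm.toLinearMap ∘ₗ S
  have hKo : ∀ v, (K (o v) : V) = N₂ (E (N₂' v)) := fun v =>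
    congrArg Subtype.val (K.apply_symm_apply (S v))
  have hTo : ∀ v, T (N₁' (o v)) = E (N₂' v) := fun v => hinj ((hK (o v)).symm.trans (hKo v))
  have hoJ : ∀ v r, T r = r → ⟪(o v : V), N₂ r⟫_ℂ = ⟪E (N₂' v), J r⟫_ℂ := by
    intro v r hr
    rw [← hTJ _ _ hr, hTo]
  have hosymm : o.IsSymmetric := by
    rintro ⟨v, hv⟩ ⟨w, hw⟩
    obtain ⟨r, hr, rfl⟩ := (hmem v).mp hv
    obtain ⟨s, hs, rfl⟩ := (hmem w).mp hw
    rw [Submodule.coe_inner, Submodule.coe_inner, ← inner_conj_symm (N₂ r), hoJ _ _ hs,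
      hoJ _ _ hr, inner_conj_symm, h2', h2', hE, hJ, hJE]
  let Q : SymPair V := ⟨p, hp, o, hosymm⟩
  refine ⟨Q, hr1, hr2, ⟨N, N', G, rfl, rfl, rfl, rfl⟩, hfr, ⟨K, hK, hKo⟩, ?_, ?_⟩
  · intro hid
    constructor
    · refine hp.ext ⟨LinearMap.ext fun x => rfl, fun x y => rfl⟩ ?_
      ext v
      rw [hmem]
      exact ⟨fun _ => ⟨v, rfl⟩, fun _ => ⟨N₂' v, by rw [hid]; rfl, h2 v⟩⟩
    · intro v
      have := hTo v
      rw [hid, LinearMap.id_apply] at this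
      rw [← this, h1]
  · intro t r
    constructor
    · rintro ⟨h, e⟩
      obtain ⟨r', hr', hrr⟩ := (hmem _).mp h
      obtain rfl := hinj hrr
      refine ⟨hr', ext_inner_right ℂ fun b => ?_⟩
      -- test the identity against `N₂ (J (T b))`
      have hb : T (J (T b)) = J (T b) := by rw [← hJT, hTT]
      change p (N₁ t) = o ⟨N₂ r', h⟩ at e
      have e1 : ⟪p (N₁ t), N₂ (J (T b))⟫_ℂ = ⟪N₁ t, N₂ (J (T b))⟫_ℂ := by
        rw [hpsymm]
        exact congrArg _ (hpN ⟨_, _, hb⟩)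
      rw [e, hoJ _ _ hb, h2', h12, hJJ, hJ, hJJ, ← hTs, hTE] at e1
      rw [hTs]
      exact e1.symm
    · rintro ⟨hr, e⟩
      have h : N₂ r ∈ LinearMap.range p := (hmem _).mpr ⟨r, hr, rfl⟩
      refine ⟨h, ?_⟩
      change p (N₁ t) = o ⟨N₂ r, h⟩
      refine ext_inner_right ℂ fun w => ?_
      obtain ⟨b, hb, hbw⟩ := (hmem (p w)).mp ⟨w, rfl⟩
      have ho : (o ⟨N₂ r, h⟩ : V) = p (o ⟨N₂ r, h⟩) := by
        obtain ⟨x, hx⟩ := (o ⟨N₂ r, h⟩).2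
        rw [← hx]
        exact (LinearMap.congr_fun hp.isIdempotentElem x).symm
      rw [ho, hpsymm, hpsymm, ← hbw, hoJ _ _ hb, h12, h2', ← e, hTs, ← hJT, hb, hJ]

end Pairs

/-! ### Primitives of locally integrable functions -/

section Primitives

theorem intervalIntegrable_of_locallyIntegrable {f : ℝ → ℂ} (hf : LocallyIntegrable f volume)
    (a b : ℝ) : IntervalIntegrable f volume a b :=
  (hf.integrableOn_isCompact isCompact_uIcc).intervalIntegrable

theorem continuous_primitive {f : ℝ → ℂ} (hf : LocallyIntegrable f volume) (c : ℂ) (a : ℝ) :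
    Continuous fun x => c + ∫ t in a..x, f t :=
  continuous_const.add
    (intervalIntegral.continuous_primitive (intervalIntegrable_of_locallyIntegrable hf) a)

/-- The increments of the primitive of `f` are bounded by those of the primitive of `‖f‖`, which is
absolutely continuous. -/
theorem absolutelyContinuousOnInterval_primitive {f : ℝ → ℂ} (hf : LocallyIntegrable f volume)
    (c : ℂ) (a b : ℝ) :
    AbsolutelyContinuousOnInterval (fun x => c + ∫ t in a..x, f t) a b := by
  have hi := intervalIntegrable_of_locallyIntegrable hf
  have hN := (hi a b).norm.absolutelyContinuousOnInterval_intervalIntegral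
    (c := a) Set.left_mem_uIcc
  rw [absolutelyContinuousOnInterval_iff] at hN ⊢
  intro ε hε
  obtain ⟨δ, hδ, h⟩ := hN ε hε
  refine ⟨δ, hδ, fun E hE hs => lt_of_le_of_lt (Finset.sum_le_sum fun i _ => ?_) (h E hE hs)⟩
  rw [dist_add_left, dist_eq_norm, dist_eq_norm,
    intervalIntegral.integral_interval_sub_left (hi _ _) (hi _ _),
    intervalIntegral.integral_interval_sub_left (hi _ _).norm (hi _ _).norm]
  exact intervalIntegral.norm_integral_le_abs_integral_norm

theorem LocallyIntegrable.mul_continuous {f g : ℝ → ℂ} (hf : LocallyIntegrable f volume)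
    (hg : Continuous g) : LocallyIntegrable (fun x => f x * g x) volume := by
  rw [← locallyIntegrableOn_univ] at hf ⊢
  exact hf.mul_continuousOn hg.continuousOn isOpen_univ.isLocallyClosed

/-- The product rule for primitives, in integrated form. -/
theorem integral_mul_primitive {f g : ℝ → ℂ} (hf : LocallyIntegrable f volume)
    (hg : LocallyIntegrable g volume) (c d : ℂ) (a b : ℝ) :
    ∫ x in a..b, (f x * (d + ∫ t in a..x, g t) + g x * (c + ∫ t in a..x, f t)) =
      (c + ∫ t in a..b, f t) * (d + ∫ t in a..b, g t) - c * d := by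
  set F : ℝ → ℂ := fun x => c + ∫ t in a..x, f t with hF
  set G : ℝ → ℂ := fun x => d + ∫ t in a..x, g t with hG
  have hFc : Continuous F := continuous_primitive hf c a
  have hGc : Continuous G := continuous_primitive hg d a
  set k : ℝ → ℂ := fun x => f x * G x + g x * F x with hk
  have hkl : LocallyIntegrable k volume := (LocallyIntegrable.mul_continuous hf hGc).add
    (LocallyIntegrable.mul_continuous hg hFc)
  have hac : AbsolutelyContinuousOnInterval
      (fun x => F x * G x - (0 + ∫ t in a..x, k t)) a b :=
    ((absolutelyContinuousOnInterval_primitive hf c a b).fun_smul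
      (absolutelyContinuousOnInterval_primitive hg d a b)).fun_sub
      (absolutelyContinuousOnInterval_primitive hkl 0 a b)
  have hd : ∀ᵐ x, x ∈ Set.uIcc a b →
      HasDerivAt (fun x => F x * G x - (0 + ∫ t in a..x, k t)) 0 x := by
    filter_upwards [LocallyIntegrable.ae_hasDerivAt_integral hf,
      LocallyIntegrable.ae_hasDerivAt_integral hg,
      LocallyIntegrable.ae_hasDerivAt_integral hkl] with x h1 h2 h3 _
    have := (((h1 a).const_add c).mul ((h2 a).const_add d)).sub ((h3 a).const_add 0)
    refine HasDerivAt.congr_deriv this ?_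
    simp only [hk, hF, hG]
    ring
  obtain ⟨C, hC⟩ := hac.const_of_ae_hasDerivAt_zero hd
  have h1 := hC a Set.left_mem_uIcc
  have h2 := hC b Set.right_mem_uIcc
  have hFa : F a = c := by simp [hF]
  have hGa : G a = d := by simp [hG]
  rw [intervalIntegral.integral_same, hFa, hGa] at h1
  change ∫ x in a..b, k x = F b * G b - c * d
  linear_combination h1 - h2

/-- A compact subset of an open interval lies in a closed subinterval. -/
theorem exists_Icc_of_isCompact_subset_Ioo {a b : ℝ} (hab : a < b) {K : Set ℝ} (hK : IsCompact K)
    (h : K ⊆ Set.Ioo a b) : ∃ a' b', a < a' ∧ b' < b ∧ K ⊆ Set.Icc a' b' := by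
  rcases K.eq_empty_or_nonempty with rfl | hne
  · exact ⟨b, a, hab, hab, Set.empty_subset _⟩
  · obtain ⟨m, hm⟩ := hK.exists_isLeast hne
    obtain ⟨M, hM⟩ := hK.exists_isGreatest hne
    exact ⟨m, M, (h hm.1).1, (h hM.1).2, fun x hx => ⟨hm.2 hx, hM.2 hx⟩⟩

/-- A test function in an interval with integral zero is the derivative of a test function. -/
theorem exists_deriv_eq_of_integral_eq_zero {a b : ℝ} (hab : a < b) {ψ : ℝ → ℝ}
    (hψ : ContDiff ℝ ∞ ψ) (hs : HasCompactSupport ψ) (hsub : tsupport ψ ⊆ Set.Ioo a b)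
    (h0 : ∫ x, ψ x = 0) :
    ∃ φ : ℝ → ℝ, ContDiff ℝ ∞ φ ∧ HasCompactSupport φ ∧ tsupport φ ⊆ Set.Ioo a b ∧
      deriv φ = ψ := by
  obtain ⟨a', b', ha, hb, hK⟩ := exists_Icc_of_isCompact_subset_Ioo hab hs hsub
  have hψ0 : ∀ x, x ∉ Set.Icc a' b' → ψ x = 0 := fun x hx =>
    image_eq_zero_of_notMem_tsupport fun h => hx (hK h)
  have hd : ∀ x, HasDerivAt (fun x => ∫ t in a..x, ψ t) (ψ x) x := fun x =>
    hψ.continuous.integral_hasStrictDerivAt a x |>.hasDerivAt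
  have hderiv : deriv (fun x => ∫ t in a..x, ψ t) = ψ := funext fun x => (hd x).deriv
  have hz : ∀ x, x ∉ Set.Icc a' b' → ∫ t in a..x, ψ t = 0 := by
    intro x hx
    rcases not_and_or.mp hx with h | h
    · refine intervalIntegral.integral_zero_ae
        (Eventually.of_forall fun t ht => hψ0 t fun ht' => ?_)
      rcases Set.mem_uIoc.mp ht with h' | h'
      · exact h (ht'.1.trans h'.2)
      · linarith [ht'.1, h'.2]
    · rw [intervalIntegral.integral_eq_integral_of_support_subset, h0]
      intro t ht
      have ht' : t ∈ Set.Icc a' b' := by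
        by_contra hc
        exact ht (hψ0 t hc)
      exact ⟨ha.trans_le ht'.1, ht'.2.trans (not_le.mp h).le⟩
  have hts : tsupport (fun x => ∫ t in a..x, ψ t) ⊆ Set.Icc a' b' :=
    closure_minimal (fun x hx => by
      by_contra hc
      exact hx (hz x hc)) isClosed_Icc
  refine ⟨fun x => ∫ t in a..x, ψ t, ?_, ?_, ?_, hderiv⟩
  · rw [contDiff_infty_iff_deriv, hderiv]
    exact ⟨fun x => (hd x).differentiableAt, hψ⟩
  · exact HasCompactSupport.of_support_subset_isCompact isCompact_Icc
      (subset_closure.trans hts)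
  · exact hts.trans fun x hx => ⟨ha.trans_le hx.1, hx.2.trans_lt hb⟩

/-- The du Bois-Reymond lemma. -/
theorem ae_eq_const_of_integral_deriv_smul_eq_zero {a b : ℝ} (hab : a < b) {h : ℝ → ℂ}
    (hh : LocallyIntegrable h volume)
    (H : ∀ φ : ℝ → ℝ, ContDiff ℝ ∞ φ → HasCompactSupport φ → tsupport φ ⊆ Set.Ioo a b →
      ∫ x, deriv φ x • h x = 0) :
    ∃ c : ℂ, ∀ᵐ x, x ∈ Set.Ioo a b → h x = c := by
  -- a test function `χ` in the interval with integral `1`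
  let B : ContDiffBump ((a + b) / 2) :=
    ⟨(b - a) / 8, (b - a) / 4, by linarith, by linarith⟩
  let χ : ℝ → ℝ := B.normed volume
  have hχ : ContDiff ℝ ∞ χ := B.contDiff_normed
  have hχs : HasCompactSupport χ := B.hasCompactSupport_normed
  have hχ1 : ∫ x, χ x = 1 := B.integral_normed
  have hχt : tsupport χ ⊆ Set.Ioo a b := by
    rw [B.tsupport_normed_eq, Real.closedBall_eq_Icc]
    change Set.Icc ((a + b) / 2 - (b - a) / 4) ((a + b) / 2 + (b - a) / 4) ⊆ _
    intro x hx
    exact ⟨by linarith [hx.1], by linarith [hx.2]⟩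
  let c : ℂ := ∫ x, χ x • h x
  refine ⟨c, ?_⟩
  have hint : ∀ ψ : ℝ → ℝ, ContDiff ℝ ∞ ψ → HasCompactSupport ψ →
      ∀ k : ℝ → ℂ, LocallyIntegrable k volume → Integrable fun x => ψ x • k x :=
    fun ψ h1 h2 k hk => hk.integrable_smul_left_of_hasCompactSupport h1.continuous h2
  have key := isOpen_Ioo.ae_eq_zero_of_integral_contDiff_smul_eq_zero (μ := volume)
    (f := fun x => h x - c) (U := Set.Ioo a b)
    ((hh.sub (locallyIntegrable_const c)).locallyIntegrableOn _) fun ψ h1 h2 h3 => by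
    -- subtracting a multiple of `χ` makes the integral of `ψ` vanish
    let m : ℝ := ∫ x, ψ x
    obtain ⟨φ, p1, p2, p3, p4⟩ := exists_deriv_eq_of_integral_eq_zero hab
      (ψ := ψ - m • χ) (h1.sub (hχ.const_smul m))
      (h2.sub (hχs.smul_left (f := fun _ => m)))
      ((tsupport_sub _ _).trans (Set.union_subset h3
        ((closure_mono (Function.support_const_smul_subset m χ)).trans hχt)))
      (by
        simp only [Pi.sub_apply, Pi.smul_apply, smul_eq_mul]
        rw [integral_sub (h1.continuous.integrable_of_hasCompactSupport h2)
          ((hχ.continuous.integrable_of_hasCompactSupport hχs).const_mul m),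
          integral_const_mul, hχ1]
        simp [m])
    have e := H φ p1 p2 p3
    rw [p4] at e
    simp only [Pi.sub_apply, Pi.smul_apply, smul_eq_mul, sub_smul, mul_smul] at e
    have hm : Integrable fun x => m • χ x • h x := (hint χ hχ hχs h hh).smul m
    rw [integral_sub (hint ψ h1 h2 h hh) hm, integral_smul] at e
    simp only [smul_sub]
    rw [integral_sub (hint ψ h1 h2 h hh) (hint ψ h1 h2 _ (locallyIntegrable_const c)),
      integral_smul_const]
    exact e
  filter_upwards [key] with x hx hxm
  exact sub_eq_zero.mp (hx hxm)

end Primitives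

/-! ### Weak derivatives of scalar functions and one-sided limits -/

section Weak

variable {n : ℕ} {y : Fin n → ℝ}

/-- `g` is the distributional derivative of the scalar function `f` in `ℝ \ {y₁, …, yₙ}`, both
being locally integrable on `ℝ`. -/
structure IsWeakDeriv (y : Fin n → ℝ) (f g : ℝ → ℂ) : Prop where
  left : LocallyIntegrable f volume
  right : LocallyIntegrable g volume
  integral_eq : ∀ φ : ℝ → ℝ, IsTest y φ → ∫ x, deriv φ x • f x = -∫ x, φ x • g x

/-- On an interval without points of `Y`, a function with a weak derivative is a.e. equal to a
primitive of it. -/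
theorem IsWeakDeriv.exists_ae_eq_primitive {f g : ℝ → ℂ} (h : IsWeakDeriv y f g) {a b : ℝ}
    (hab : a < b) (hfree : ∀ k, y k ∉ Set.Ioo a b) :
    ∃ c : ℂ, ∀ᵐ x, x ∈ Set.Ioo a b → f x = c + ∫ t in a..x, g t := by
  have hG : Continuous fun x => (0 : ℂ) + ∫ t in a..x, g t := continuous_primitive h.right 0 a
  obtain ⟨c, hc⟩ := ae_eq_const_of_integral_deriv_smul_eq_zero hab
    (h := fun x => f x - (0 + ∫ t in a..x, g t)) (h.left.sub hG.locallyIntegrable) (by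
    intro φ h1 h2 h3
    have hφ : IsTest y φ := ⟨h1, h2, fun x hx => by
      rintro ⟨k, rfl⟩
      exact hfree k (h3 hx)⟩
    have hd : Continuous (deriv φ) := h1.continuous_deriv (by simp)
    have hsupp : ∀ {k : ℝ → ℂ} {χ : ℝ → ℝ}, tsupport χ ⊆ Set.Ioo a b →
        ∫ x, χ x • k x = ∫ x in a..b, χ x • k x := by
      intro k χ hχ
      refine (intervalIntegral.integral_eq_integral_of_support_subset ?_).symm
      exact ((Function.support_smul_subset_left χ k).trans (subset_closure.trans hχ)).trans
        Set.Ioo_subset_Ioc_self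
    have hds : tsupport (deriv φ) ⊆ Set.Ioo a b := (tsupport_deriv_subset (𝕜 := ℝ)).trans h3
    have hφa : φ a = 0 := image_eq_zero_of_notMem_tsupport fun hm => lt_irrefl _ (h3 hm).1
    have hφb : φ b = 0 := image_eq_zero_of_notMem_tsupport fun hm => lt_irrefl _ (h3 hm).2
    have hprim : ∀ x, (0 : ℂ) + ∫ t in a..x, ((deriv φ t : ℝ) : ℂ) = φ x := by
      intro x
      rw [intervalIntegral.integral_ofReal, intervalIntegral.integral_deriv_eq_sub
        (fun t _ => (h1.differentiable (by simp)).differentiableAt)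
        (hd.intervalIntegrable _ _), hφa]
      simp
    have hp := integral_mul_primitive (f := fun t => ((deriv φ t : ℝ) : ℂ)) (g := g)
      (Complex.continuous_ofReal.comp hd).locallyIntegrable h.right 0 0 a b
    simp only [hprim, hφb, Complex.ofReal_zero, zero_mul, mul_zero, sub_zero] at hp
    have i1 : IntervalIntegrable (fun x => ((deriv φ x : ℝ) : ℂ) * (0 + ∫ t in a..x, g t))
        volume a b := ((Complex.continuous_ofReal.comp hd).mul hG).intervalIntegrable _ _
    have i2 : IntervalIntegrable (fun x => g x * (φ x : ℂ)) volume a b :=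
      intervalIntegrable_of_locallyIntegrable (LocallyIntegrable.mul_continuous h.right
        (Complex.continuous_ofReal.comp h1.continuous)) _ _
    rw [intervalIntegral.integral_add i1 i2] at hp
    simp only [smul_sub]
    rw [integral_sub (h.left.integrable_smul_left_of_hasCompactSupport hd h2.deriv)
      (hG.locallyIntegrable.integrable_smul_left_of_hasCompactSupport hd h2.deriv),
      h.integral_eq φ hφ, hsupp h3, hsupp hds]
    simp only [Complex.real_smul]
    simp only [mul_comm (g _)] at hp
    linear_combination -hp)
  refine ⟨c, ?_⟩
  filter_upwards [hc] with x hx hxm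
  have := hx hxm
  linear_combination this

end Weak

/-! ### One-sided limits and the jump formula -/

section SideLimits

variable {n : ℕ} {y : Fin n → ℝ}

/-- Essential right limits are unique: one-sided neighbourhoods have positive measure. -/
theorem neBot_nhdsGT_inf_ae (x : ℝ) : (𝓝[>] x ⊓ ae (volume : Measure ℝ)).NeBot := by
  rw [inf_neBot_iff]
  intro s hs t ht
  obtain ⟨u, hu, hus⟩ := mem_nhdsGT_iff_exists_Ioo_subset.mp hs
  by_contra h
  have : Set.Ioo x u ⊆ tᶜ := fun z hz hzt => h ⟨z, hus hz, hzt⟩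
  have h0 : volume (Set.Ioo x u) = 0 := measure_mono_null this ht
  rw [Real.volume_Ioo, ENNReal.ofReal_eq_zero] at h0
  linarith [Set.mem_Ioi.mp hu]

theorem neBot_nhdsLT_inf_ae (x : ℝ) : (𝓝[<] x ⊓ ae (volume : Measure ℝ)).NeBot := by
  rw [inf_neBot_iff]
  intro s hs t ht
  obtain ⟨u, hu, hus⟩ := mem_nhdsLT_iff_exists_Ioo_subset.mp hs
  by_contra h
  have : Set.Ioo u x ⊆ tᶜ := fun z hz hzt => h ⟨z, hus hz, hzt⟩
  have h0 : volume (Set.Ioo u x) = 0 := measure_mono_null this ht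
  rw [Real.volume_Ioo, ENNReal.ofReal_eq_zero] at h0
  linarith [Set.mem_Iio.mp hu]

theorem HasSideLimits.unique {f : ℝ → C2} {l r l' r' : Fin n → C2} (h : HasSideLimits y f l r)
    (h' : HasSideLimits y f l' r') : l = l' ∧ r = r' := by
  constructor
  · funext k
    have := neBot_nhdsLT_inf_ae (y k)
    exact tendsto_nhds_unique (h k).1 (h' k).1
  · funext k
    have := neBot_nhdsGT_inf_ae (y k)
    exact tendsto_nhds_unique (h k).2 (h' k).2

/-- `l` and `r` are the essential one-sided limits of the scalar function `f` at `x`. -/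
def SideLim (f : ℝ → ℂ) (x : ℝ) (l r : ℂ) : Prop :=
  Tendsto f (𝓝[<] x ⊓ ae volume) (𝓝 l) ∧ Tendsto f (𝓝[>] x ⊓ ae volume) (𝓝 r)

theorem SideLim.unique {f : ℝ → ℂ} {x : ℝ} {l r l' r' : ℂ} (h : SideLim f x l r)
    (h' : SideLim f x l' r') : l = l' ∧ r = r' := by
  have := neBot_nhdsLT_inf_ae x
  have := neBot_nhdsGT_inf_ae x
  exact ⟨tendsto_nhds_unique h.1 h'.1, tendsto_nhds_unique h.2 h'.2⟩

theorem tendsto_right_of_ae_eq {f F : ℝ → ℂ} {a b x : ℝ} (hF : Continuous F)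
    (h : ∀ᵐ t, t ∈ Set.Ioo a b → f t = F t) (hx : x ∈ Set.Ico a b) :
    Tendsto f (𝓝[>] x ⊓ ae volume) (𝓝 (F x)) := by
  have h1 : Tendsto F (𝓝[>] x ⊓ ae volume) (𝓝 (F x)) :=
    hF.continuousAt.mono_left (inf_le_left.trans nhdsWithin_le_nhds)
  refine h1.congr' ?_
  have h2 : ∀ᶠ t in 𝓝[>] x ⊓ ae volume, t ∈ Set.Ioo x b :=
    (Ioo_mem_nhdsGT hx.2 : Set.Ioo x b ∈ 𝓝[>] x) |> mem_inf_of_left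
  have h3 : ∀ᶠ t in 𝓝[>] x ⊓ ae volume, t ∈ Set.Ioo a b → f t = F t := mem_inf_of_right h
  filter_upwards [h2, h3] with t ht1 ht2
  exact (ht2 ⟨hx.1.trans_lt ht1.1, ht1.2⟩).symm

theorem tendsto_left_of_ae_eq {f F : ℝ → ℂ} {a b x : ℝ} (hF : Continuous F)
    (h : ∀ᵐ t, t ∈ Set.Ioo a b → f t = F t) (hx : x ∈ Set.Ioc a b) :
    Tendsto f (𝓝[<] x ⊓ ae volume) (𝓝 (F x)) := by
  have h1 : Tendsto F (𝓝[<] x ⊓ ae volume) (𝓝 (F x)) :=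
    hF.continuousAt.mono_left (inf_le_left.trans nhdsWithin_le_nhds)
  refine h1.congr' ?_
  have h2 : ∀ᶠ t in 𝓝[<] x ⊓ ae volume, t ∈ Set.Ioo a x :=
    (Ioo_mem_nhdsLT hx.1 : Set.Ioo a x ∈ 𝓝[<] x) |> mem_inf_of_left
  have h3 : ∀ᶠ t in 𝓝[<] x ⊓ ae volume, t ∈ Set.Ioo a b → f t = F t := mem_inf_of_right h
  filter_upwards [h2, h3] with t ht1 ht2
  exact (ht2 ⟨ht1.1, ht1.2.trans_le hx.2⟩).symm

/-- Every point has a punctured neighbourhood without points of `Y`. -/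
theorem exists_punctured_free (y : Fin n → ℝ) (x : ℝ) :
    ∃ δ > 0, ∀ k, y k ∈ Set.Ioo (x - δ) (x + δ) → y k = x := by
  have hfin : (Set.range y \ {x}).Finite := (Set.finite_range y).subset Set.sdiff_subset
  have hmem : (Set.range y \ {x})ᶜ ∈ 𝓝 x :=
    hfin.isClosed.isOpen_compl.mem_nhds fun h => h.2 rfl
  obtain ⟨δ, hδ, h⟩ := Metric.mem_nhds_iff.mp hmem
  refine ⟨δ, hδ, fun k hk => ?_⟩
  rw [Real.ball_eq_Ioo] at h
  by_contra hne
  exact h hk ⟨⟨k, rfl⟩, hne⟩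

theorem IsWeakDeriv.exists_sideLim {f g : ℝ → ℂ} (h : IsWeakDeriv y f g) (x : ℝ) :
    ∃ l r, SideLim f x l r := by
  obtain ⟨δ, hδ, hfree⟩ := exists_punctured_free y x
  obtain ⟨c, hc⟩ := h.exists_ae_eq_primitive (a := x - δ) (b := x) (by linarith) fun k hk =>
    hk.2.ne (hfree k ⟨hk.1, by linarith [hk.2]⟩)
  obtain ⟨d, hd⟩ := h.exists_ae_eq_primitive (a := x) (b := x + δ) (by linarith) fun k hk =>
    hk.1.ne' (hfree k ⟨by linarith [hk.1], hk.2⟩)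
  exact ⟨_, _, tendsto_left_of_ae_eq (continuous_primitive h.right c _) hc ⟨by linarith, le_rfl⟩,
    tendsto_right_of_ae_eq (continuous_primitive h.right d _) hd ⟨le_rfl, by linarith⟩⟩

/-- The left limits of a function with a weak derivative form a representative of it which is
continuous off `Y`. -/
theorem IsWeakDeriv.ae_eq_leftLim {f g : ℝ → ℂ} (h : IsWeakDeriv y f g) {L R : ℝ → ℂ}
    (hLR : ∀ x, SideLim f x (L x) (R x)) : L =ᵐ[volume] f := by
  have hnull : volume ({x | L x ≠ f x} \ Set.range y) = 0 := by
    refine measure_null_of_locally_null _ fun x hx => ?_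
    obtain ⟨δ, hδ, hfree⟩ := exists_punctured_free y x
    obtain ⟨c, hc⟩ := h.exists_ae_eq_primitive (a := x - δ) (b := x + δ) (by linarith)
      fun k hk => hx.2 ⟨k, hfree k hk⟩
    have hF := continuous_primitive h.right c (x - δ)
    refine ⟨({x | L x ≠ f x} \ Set.range y) ∩ Set.Ioo (x - δ) (x + δ),
      inter_mem_nhdsWithin _ (Ioo_mem_nhds (by linarith) (by linarith)), ?_⟩
    refine measure_mono_null (fun t ht => ?_) hc
    intro h'
    have e1 := h' ht.2
    have := neBot_nhdsLT_inf_ae t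
    have e2 := tendsto_nhds_unique (hLR t).1 (tendsto_left_of_ae_eq hF hc ⟨ht.2.1, ht.2.2.le⟩)
    exact ht.1.1 (e2.trans e1.symm)
  have h0 : volume (Set.range y) = 0 := (Set.finite_range y).measure_zero _
  have : volume {x | L x ≠ f x} = 0 :=
    measure_mono_null (t := ({x | L x ≠ f x} \ Set.range y) ∪ Set.range y)
      (fun x hx => by
        by_cases hy : x ∈ Set.range y
        · exact Or.inr hy
        · exact Or.inl ⟨hx, hy⟩) (measure_union_null hnull h0)
  exact this

theorem IsWeakDeriv.leftLim_eq_rightLim {f g : ℝ → ℂ} (h : IsWeakDeriv y f g) {x : ℝ} {l r : ℂ}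
    (hx : x ∉ Set.range y) (hl : SideLim f x l r) : l = r := by
  obtain ⟨δ, hδ, hfree⟩ := exists_punctured_free y x
  obtain ⟨c, hc⟩ := h.exists_ae_eq_primitive (a := x - δ) (b := x + δ) (by linarith)
    fun k hk => hx ⟨k, hfree k hk⟩
  have hF := continuous_primitive h.right c (x - δ)
  obtain ⟨e1, e2⟩ := hl.unique ⟨tendsto_left_of_ae_eq hF hc ⟨by linarith, by linarith⟩,
    tendsto_right_of_ae_eq hF hc ⟨by linarith, by linarith⟩⟩
  exact e1.trans e2.symm

/-- The product rule, integrated over an interval without points of `Y`. -/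
theorem IsWeakDeriv.integral_mul {f g f' g' : ℝ → ℂ} (h : IsWeakDeriv y f g)
    (h' : IsWeakDeriv y f' g') {a b : ℝ} (hab : a < b) (hfree : ∀ k, y k ∉ Set.Ioo a b)
    {l r l' r' s t s' t' : ℂ} (ha : SideLim f a s r) (ha' : SideLim f' a s' r')
    (hb : SideLim f b l t) (hb' : SideLim f' b l' t') :
    ∫ x in a..b, (g x * f' x + g' x * f x) = l * l' - r * r' := by
  obtain ⟨c, hc⟩ := h.exists_ae_eq_primitive hab hfree
  obtain ⟨c', hc'⟩ := h'.exists_ae_eq_primitive hab hfree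
  have hF := continuous_primitive h.right c a
  have hF' := continuous_primitive h'.right c' a
  have := neBot_nhdsLT_inf_ae b
  have := neBot_nhdsGT_inf_ae a
  have e1 := tendsto_nhds_unique ha.2 (tendsto_right_of_ae_eq hF hc ⟨le_rfl, hab⟩)
  have e2 := tendsto_nhds_unique ha'.2 (tendsto_right_of_ae_eq hF' hc' ⟨le_rfl, hab⟩)
  have e3 := tendsto_nhds_unique hb.1 (tendsto_left_of_ae_eq hF hc ⟨hab, le_rfl⟩)
  have e4 := tendsto_nhds_unique hb'.1 (tendsto_left_of_ae_eq hF' hc' ⟨hab, le_rfl⟩)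
  simp only [intervalIntegral.integral_same, add_zero] at e1 e2
  rw [e1, e2, e3, e4, ← integral_mul_primitive h.right h'.right]
  refine intervalIntegral.integral_congr_ae ?_
  have hb0 : ∀ᵐ x : ℝ, x ≠ b := by simp [ae_iff, measure_singleton]
  filter_upwards [hc, hc', hb0] with x h1 h2 h3 hx
  rw [Set.uIoc_of_le hab.le] at hx
  have hx' : x ∈ Set.Ioo a b := ⟨hx.1, lt_of_le_of_ne hx.2 h3⟩
  rw [h1 hx', h2 hx']

/-- The jump formula: the integral over `ℝ` of the derivative of an integrable function with
one-sided limits `L`, `R` is minus the sum of its jumps. The function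
`x ↦ ∫₀ˣ v - L x + ∑_{y_k < x} (R y_k - L y_k)` is locally constant, hence constant, and `L` tends
to `0` at both ends because it is integrable. -/
theorem integral_eq_neg_sum_jumps (hy : Function.Injective y) {v L R : ℝ → ℂ}
    (hv : Integrable v volume) (hL : Integrable L volume)
    (hfree : ∀ a b, a < b → (∀ k, y k ∉ Set.Ioo a b) → ∫ x in a..b, v x = L b - R a)
    (hLR : ∀ x, x ∉ Set.range y → L x = R x) :
    ∫ x, v x = -∑ k, (R (y k) - L (y k)) := by
  classical
  have hvi : ∀ a b, IntervalIntegrable v volume a b := fun a b => hv.intervalIntegrable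
  let S : ℝ → ℂ := fun x => ∑ k, if y k < x then R (y k) - L (y k) else 0
  let Φ : ℝ → ℂ := fun x => (∫ t in (0 : ℝ)..x, v t) - L x + S x
  have hΦ : ∀ x, ∃ δ > 0, ∀ x' ∈ Set.Ioo (x - δ) (x + δ), Φ x' = Φ x := by
    intro x
    obtain ⟨δ, hδ, h⟩ := exists_punctured_free y x
    refine ⟨δ, hδ, fun x' hx' => ?_⟩
    have hsplit : ∫ t in (0 : ℝ)..x', v t = (∫ t in (0 : ℝ)..x, v t) + ∫ t in x..x', v t :=
      (intervalIntegral.integral_add_adjacent_intervals (hvi _ _) (hvi _ _)).symm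
    rcases lt_trichotomy x' x with hlt | rfl | hgt
    · -- to the left of `x` the sum does not change
      have hS : S x' = S x := by
        refine Finset.sum_congr rfl fun k _ => ?_
        have : y k < x' ↔ y k < x := by
          refine ⟨fun h1 => h1.trans hlt, fun h1 => ?_⟩
          by_contra h2
          exact h1.ne (h k ⟨hx'.1.trans_le (not_lt.mp h2), by linarith⟩)
        simp only [this]
      have e := hfree x' x hlt fun k hk => hk.2.ne (h k ⟨hx'.1.trans hk.1, by linarith [hk.2]⟩)
      rw [intervalIntegral.integral_symm] at e
      have e' := hLR x' (by
        rintro ⟨k, rfl⟩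
        exact hlt.ne (h k hx'))
      simp only [Φ, hS, hsplit, e']
      linear_combination -e
    · rfl
    · have hS : S x' = S x + (R x - L x) := by
        -- the sum picks up the jump at `x`, which vanishes when `x` is not in `Y`
        have : R x - L x = ∑ k, if y k = x then R (y k) - L (y k) else 0 := by
          by_cases hxy : x ∈ Set.range y
          · obtain ⟨k, rfl⟩ := hxy
            rw [Finset.sum_eq_single k (fun j _ hj => if_neg fun e => hj (hy e)) (by simp),
              if_pos rfl]
          · rw [hLR x hxy, sub_self, Finset.sum_eq_zero]
            exact fun k _ => if_neg fun e => hxy ⟨k, e⟩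
        rw [this, ← Finset.sum_add_distrib]
        refine Finset.sum_congr rfl fun k _ => ?_
        rcases lt_trichotomy (y k) x with h1 | h1 | h1
        · simp [h1, h1.trans hgt, h1.ne]
        · simp [h1, hgt]
        · have h2 : ¬ y k < x' := fun h2 => h1.ne' (h k ⟨by linarith, h2.trans hx'.2⟩)
          simp [h1.not_gt, h2, h1.ne']
      have e := hfree x x' hgt fun k hk => hk.1.ne' (h k ⟨by linarith [hk.1], hk.2.trans hx'.2⟩)
      simp only [Φ, hS, hsplit, e]
      ring
  have hconst : ∀ x, Φ x = Φ 0 := by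
    have hlc : IsLocallyConstant Φ := by
      rw [IsLocallyConstant.iff_eventually_eq]
      intro x
      obtain ⟨δ, hδ, h⟩ := hΦ x
      exact Filter.eventually_of_mem (Ioo_mem_nhds (by linarith) (by linarith)) h
    exact fun x => hlc.apply_eq_of_preconnectedSpace x 0
  -- limits at `±∞`
  have hsmall : ∀ᶠ x in atBot, S x = 0 := by
    have : ∀ k, ∀ᶠ x in atBot, ¬ y k < x := fun k =>
      (eventually_le_atBot (y k)).mono fun x hx => not_lt.mpr hx
    filter_upwards [eventually_all.mpr this] with x hx
    exact Finset.sum_eq_zero fun k _ => if_neg (hx k)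
  have hlarge : ∀ᶠ x in atTop, S x = ∑ k, (R (y k) - L (y k)) := by
    have : ∀ k, ∀ᶠ x in atTop, y k < x := fun k => eventually_gt_atTop (y k)
    filter_upwards [eventually_all.mpr this] with x hx
    exact Finset.sum_congr rfl fun k _ => if_pos (hx k)
  have htop : Tendsto (fun x => ∫ t in (0 : ℝ)..x, v t) atTop (𝓝 (∫ t in Set.Ioi 0, v t)) :=
    intervalIntegral_tendsto_integral_Ioi 0 hv.integrableOn tendsto_id
  have hbot : Tendsto (fun x => ∫ t in x..(0 : ℝ), v t) atBot (𝓝 (∫ t in Set.Iic 0, v t)) :=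
    intervalIntegral_tendsto_integral_Iic 0 hv.integrableOn tendsto_id
  have hLtop : Tendsto L atTop
      (𝓝 ((∫ t in Set.Ioi 0, v t) + ∑ k, (R (y k) - L (y k)) - Φ 0)) := by
    refine ((htop.add_const _).sub_const _).congr' ?_
    filter_upwards [hlarge] with x hx
    rw [← hconst x]
    simp only [Φ, hx]
    ring
  have hLbot : Tendsto L atBot (𝓝 (-(∫ t in Set.Iic 0, v t) - Φ 0)) := by
    refine (hbot.neg.sub_const _).congr' ?_
    filter_upwards [hsmall] with x hx
    rw [← hconst x, ← intervalIntegral.integral_symm]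
    simp only [Φ, hx]
    ring
  have z1 := IntegrableAtFilter.eq_zero_of_tendsto (hL.integrableAtFilter atTop) (fun s hs => by
    obtain ⟨b, hb⟩ := mem_atTop_sets.1 hs
    rw [← top_le_iff, ← Real.volume_Ici (a := b)]
    exact measure_mono hb) hLtop
  have z2 := IntegrableAtFilter.eq_zero_of_tendsto (hL.integrableAtFilter atBot) (fun s hs => by
    obtain ⟨b, hb⟩ := mem_atBot_sets.1 hs
    rw [← top_le_iff, ← Real.volume_Iic (a := b)]
    exact measure_mono hb) hLbot
  rw [← intervalIntegral.integral_Iic_add_Ioi (b := 0) hv.integrableOn hv.integrableOn]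
  linear_combination z1 - z2

/-- Integration by parts on `ℝ \ Y`. -/
theorem IsWeakDeriv.integral_mul_add (hy : Function.Injective y) {f g f' g' : ℝ → ℂ}
    (h : IsWeakDeriv y f g) (h' : IsWeakDeriv y f' g') (i₀ : Integrable (fun x => f x * f' x))
    (i₁ : Integrable fun x => g x * f' x) (i₂ : Integrable fun x => g' x * f x)
    {l r l' r' : Fin n → ℂ} (hs : ∀ k, SideLim f (y k) (l k) (r k))
    (hs' : ∀ k, SideLim f' (y k) (l' k) (r' k)) :
    ∫ x, (g x * f' x + g' x * f x) = -∑ k, (r k * r' k - l k * l' k) := by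
  choose L R hLR using h.exists_sideLim
  choose L' R' hLR' using h'.exists_sideLim
  have e := integral_eq_neg_sum_jumps hy (v := fun x => g x * f' x + g' x * f x)
    (L := fun x => L x * L' x) (R := fun x => R x * R' x) (i₁.add i₂)
    (i₀.congr ((h.ae_eq_leftLim hLR).mul (h'.ae_eq_leftLim hLR')).symm)
    (fun a b hab hfree => h.integral_mul h' hab hfree (hLR a) (hLR' a) (hLR b) (hLR' b))
    (fun x hx => by
      rw [h.leftLim_eq_rightLim hx (hLR x), h'.leftLim_eq_rightLim hx (hLR' x)])
  rw [e]
  congr 1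
  refine Finset.sum_congr rfl fun k _ => ?_
  obtain ⟨e1, e2⟩ := (hs k).unique (hLR (y k))
  obtain ⟨e3, e4⟩ := (hs' k).unique (hLR' (y k))
  rw [e1, e2, e3, e4]

end SideLimits

/-! ### Functions in `H¹(ℝ \ Y; ℂ²)` -/

section Sobolev

variable {n : ℕ} {y : Fin n → ℝ}

theorem memLp_coord (f : L2) (i : Fin 2) : MemLp (fun x => f x i) 2 (volume : Measure ℝ) :=
  (EuclideanSpace.proj (𝕜 := ℂ) i : C2 →L[ℂ] ℂ).comp_memLp' (Lp.memLp f)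

theorem memLp_conj_coord (f : L2) (i : Fin 2) :
    MemLp (fun x => (starRingEnd ℂ) (f x i)) 2 (volume : Measure ℝ) :=
  (memLp_coord f i).star

theorem integrable_mul_of_memLp {f g : ℝ → ℂ} (hf : MemLp f 2 (volume : Measure ℝ))
    (hg : MemLp g 2 (volume : Measure ℝ)) : Integrable fun x => f x * g x :=
  hf.integrable_mul hg

theorem integral_smul_apply {φ : ℝ → ℝ} (hφ : Continuous φ) (hs : HasCompactSupport φ) (f : L2)
    (i : Fin 2) : (∫ x, φ x • f x) i = ∫ x, φ x • f x i :=
  ((EuclideanSpace.proj (𝕜 := ℂ) i : C2 →L[ℂ] ℂ).integral_comp_comm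
    (integrable_smul_L2 hφ hs f)).symm

theorem mem_weakDerivGraph (y : Fin n → ℝ) {f : L2} (hf : f ∈ H1 y) :
    (f, wderiv y ⟨f, hf⟩) ∈ weakDerivGraph y := by
  rw [← wderiv_graph]
  exact (wderiv y).mem_graph ⟨f, hf⟩

theorem exists_wderiv_eq {f g : L2} (h : (f, g) ∈ weakDerivGraph y) :
    ∃ hf : f ∈ H1 y, wderiv y ⟨f, hf⟩ = g := by
  rw [← wderiv_graph] at h
  obtain ⟨⟨f, hf⟩, rfl, e⟩ := (LinearPMap.mem_graph_iff _).mp h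
  exact ⟨hf, e⟩

theorem mem_weakDerivGraph_iff_coord (f g : L2) :
    (f, g) ∈ weakDerivGraph y ↔ ∀ i φ, IsTest y φ →
      ∫ x, deriv φ x • f x i = -∫ x, φ x • g x i := by
  have e : ∀ φ, IsTest y φ → ∀ i, ((∫ x, deriv φ x • f x) i = ∫ x, deriv φ x • f x i) ∧
      (∫ x, φ x • g x) i = ∫ x, φ x • g x i := fun φ hφ i =>
    ⟨integral_smul_apply (hφ.1.continuous_deriv (by simp)) hφ.2.1.deriv f i,
      integral_smul_apply hφ.1.continuous hφ.2.1 g i⟩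
  constructor
  · intro h i φ hφ
    have := congrArg (fun v : C2 => v i) (h φ hφ)
    simp only [PiLp.neg_apply] at this
    rwa [(e φ hφ i).1, (e φ hφ i).2] at this
  · intro h φ hφ
    refine PiLp.ext fun i => ?_
    dsimp only
    rw [PiLp.neg_apply, (e φ hφ i).1, (e φ hφ i).2]
    exact h i φ hφ

theorem isWeakDeriv_coord {f g : L2} (h : (f, g) ∈ weakDerivGraph y) (i : Fin 2) :
    IsWeakDeriv y (fun x => f x i) fun x => g x i :=
  ⟨(memLp_coord f i).locallyIntegrable (by norm_num),
    (memLp_coord g i).locallyIntegrable (by norm_num),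
    (mem_weakDerivGraph_iff_coord f g).mp h i⟩

theorem isWeakDeriv_conj_coord {f g : L2} (h : (f, g) ∈ weakDerivGraph y) (i : Fin 2) :
    IsWeakDeriv y (fun x => (starRingEnd ℂ) (f x i)) fun x => (starRingEnd ℂ) (g x i) := by
  refine ⟨(memLp_conj_coord f i).locallyIntegrable (by norm_num),
    (memLp_conj_coord g i).locallyIntegrable (by norm_num), fun φ hφ => ?_⟩
  have := congrArg (starRingEnd ℂ) ((isWeakDeriv_coord h i).integral_eq φ hφ)
  rw [map_neg, ← integral_conj, ← integral_conj] at this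
  simpa only [Complex.real_smul, map_mul, Complex.conj_ofReal] using this

theorem hasSideLimits_iff_coord (f : ℝ → C2) (l r : Fin n → C2) :
    HasSideLimits y f l r ↔ ∀ k i, SideLim (fun x => f x i) (y k) (l k i) (r k i) := by
  have key : ∀ (F : Filter ℝ) (a : C2),
      Tendsto f F (𝓝 a) ↔ ∀ i, Tendsto (fun x => f x i) F (𝓝 (a i)) := by
    intro F a
    constructor
    · intro h i
      exact ((EuclideanSpace.proj (𝕜 := ℂ) i : C2 →L[ℂ] ℂ).continuous.tendsto a).comp h
    · intro h
      exact ((PiLp.continuous_toLp 2 fun _ : Fin 2 => ℂ).tendsto a.ofLp).comp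
        (tendsto_pi_nhds.mpr h)
  constructor
  · exact fun h k i => ⟨(key _ _).mp (h k).1 i, (key _ _).mp (h k).2 i⟩
  · exact fun h k => ⟨(key _ _).mpr fun i => (h k i).1, (key _ _).mpr fun i => (h k i).2⟩

theorem SideLim.conj {f : ℝ → ℂ} {x : ℝ} {l r : ℂ} (h : SideLim f x l r) :
    SideLim (fun x => (starRingEnd ℂ) (f x)) x ((starRingEnd ℂ) l) ((starRingEnd ℂ) r) :=
  ⟨(Complex.continuous_conj.tendsto l).comp h.1, (Complex.continuous_conj.tendsto r).comp h.2⟩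

theorem exists_hasSideLimits {f : L2} (hf : f ∈ H1 y) :
    ∃ l r : Fin n → C2, HasSideLimits y f l r := by
  choose l r h using fun k i =>
    (isWeakDeriv_coord (mem_weakDerivGraph y hf) i).exists_sideLim (y k)
  exact ⟨fun k => WithLp.toLp 2 (l k), fun k => WithLp.toLp 2 (r k),
    (hasSideLimits_iff_coord _ _ _).mpr h⟩

/-- Integration by parts for the product of a conjugate component and a component. -/
theorem integral_conj_coord_mul (hy : Function.Injective y) {f f' g g' : L2}
    (hf : (f, f') ∈ weakDerivGraph y) (hg : (g, g') ∈ weakDerivGraph y)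
    {l r m s : Fin n → C2} (hl : HasSideLimits y f l r) (hm : HasSideLimits y g m s)
    (i j : Fin 2) :
    ∫ x, ((starRingEnd ℂ) (f' x i) * g x j + g' x j * (starRingEnd ℂ) (f x i)) =
      -∑ k, ((starRingEnd ℂ) (r k i) * s k j - (starRingEnd ℂ) (l k i) * m k j) :=
  (isWeakDeriv_conj_coord hf i).integral_mul_add hy (isWeakDeriv_coord hg j)
    (integrable_mul_of_memLp (memLp_conj_coord f i) (memLp_coord g j))
    (integrable_mul_of_memLp (memLp_conj_coord f' i) (memLp_coord g j))
    (integrable_mul_of_memLp (memLp_coord g' j) (memLp_conj_coord f i))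
    (fun k => ((hasSideLimits_iff_coord _ _ _).mp hl k i).conj)
    (fun k => (hasSideLimits_iff_coord _ _ _).mp hm k j)

/-- A function which is differentiable off `Y` has its derivative as weak derivative. -/
theorem mem_weakDerivGraph_of_hasDerivAt {f g : L2} {w w' : ℝ → C2} (hf : f =ᵐ[volume] w)
    (hg : g =ᵐ[volume] w') (hd : ∀ x ∉ Set.range y, HasDerivAt w (w' x) x) :
    (f, g) ∈ weakDerivGraph y := by
  intro φ hφ
  have e1 : (fun x => deriv φ x • f x) =ᵐ[volume] fun x => deriv φ x • w x :=
    hf.mono fun x hx => congrArg (deriv φ x • ·) hx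
  have e2 : (fun x => φ x • g x) =ᵐ[volume] fun x => φ x • w' x :=
    hg.mono fun x hx => congrArg (φ x • ·) hx
  have e3 : (fun x => φ x • f x) =ᵐ[volume] fun x => φ x • w x :=
    hf.mono fun x hx => congrArg (φ x • ·) hx
  have i1 := (hφ.integrable_deriv f).congr e1
  have i2 := (hφ.integrable g).congr e2
  have i3 := (integrable_smul_L2 hφ.1.continuous hφ.2.1 f).congr e3
  have hder : ∀ x, HasDerivAt (fun x => φ x • w x) (φ x • w' x + deriv φ x • w x) x := by
    intro x
    by_cases hx : x ∈ Set.range y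
    · have hz : φ =ᶠ[𝓝 x] 0 :=
        notMem_tsupport_iff_eventuallyEq.mp fun hm => hφ.2.2 hm hx
      have hz' : (fun x => φ x • w x) =ᶠ[𝓝 x] fun _ => 0 :=
        hz.mono fun t ht => by simp [ht]
      have e : φ x • w' x + deriv φ x • w x = 0 := by
        rw [hz.deriv_eq, hz.eq_of_nhds]
        simp
      rw [e]
      exact (hasDerivAt_const x (0 : C2)).congr_of_eventuallyEq hz'
    · exact ((hφ.1.differentiable (by simp)).differentiableAt.hasDerivAt).smul (hd x hx)
  have h0 := integral_eq_zero_of_hasDerivAt_of_integrable hder (i2.add i1) i3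
  rw [integral_add i2 i1] at h0
  change ∫ x, deriv φ x • f x = -∫ x, φ x • g x
  rw [integral_congr_ae e1, integral_congr_ae e2]
  exact eq_neg_of_add_eq_zero_right h0

/-- A function in `H¹(ℝ \ Y; ℂ²)` with prescribed limits `a`, `b` at `y_k` and vanishing limits at
the other points of `Y`: a smooth bump function times a step function. -/
theorem exists_hasSideLimits_single (hy : Function.Injective y) (k : Fin n) (a b : C2) :
    ∃ f ∈ H1 y, HasSideLimits y f (Pi.single k a) (Pi.single k b) := by
  classical
  obtain ⟨δ, hδ, hfree⟩ := exists_punctured_free y (y k)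
  let B : ContDiffBump (y k) := ⟨δ / 4, δ / 2, by linarith, by linarith⟩
  have hB : ContDiff ℝ ∞ B := B.contDiff
  have hBs : HasCompactSupport B := B.hasCompactSupport
  let st : ℝ → C2 := fun x => if x < y k then a else b
  have hmem : ∀ η : ℝ → ℝ, Continuous η → HasCompactSupport η →
      MemLp (fun x => η x • st x) 2 (volume : Measure ℝ) := by
    intro η h1 h2
    have hc : ∀ c : C2, MemLp (fun x => η x • c) 2 (volume : Measure ℝ) := fun c =>
      (h1.smul continuous_const).memLp_of_hasCompactSupport h2.smul_right
    have := MemLp.piecewise (s := Set.Iio (y k)) measurableSet_Iio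
      ((hc a).restrict _) ((hc b).restrict _)
    refine (memLp_congr_ae (Eventually.of_forall fun x => ?_)).mp this
    by_cases hx : x < y k
    · simp [st, hx]
    · simp [st, hx]
  have hdc : Continuous (deriv B) := hB.continuous_deriv (by simp)
  let f : L2 := (hmem B hB.continuous hBs).toLp _
  let g : L2 := (hmem (deriv B) hdc hBs.deriv).toLp _
  have hf : f =ᵐ[volume] fun x => B x • st x := MemLp.coeFn_toLp _
  have hg : g =ᵐ[volume] fun x => deriv B x • st x := MemLp.coeFn_toLp _
  have hst : ∀ x, x ≠ y k → ∃ c, st =ᶠ[𝓝 x] fun _ => c := by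
    intro x hx
    rcases lt_or_gt_of_ne hx with h | h
    · exact ⟨a, (eventually_lt_nhds h).mono fun t ht => if_pos ht⟩
    · exact ⟨b, (eventually_gt_nhds h).mono fun t ht => if_neg (not_lt.mpr ht.le)⟩
  obtain ⟨hfm, -⟩ := exists_wderiv_eq (y := y) (mem_weakDerivGraph_of_hasDerivAt hf hg (by
    intro x hx
    obtain ⟨c, hc⟩ := hst x fun e => hx ⟨k, e.symm⟩
    rw [hc.eq_of_nhds]
    exact (((hB.differentiable (by simp)).differentiableAt.hasDerivAt).smul_const
      c).congr_of_eventuallyEq (hc.mono fun t ht => congrArg (B t • ·) ht)))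
  refine ⟨f, hfm, fun j => ?_⟩
  by_cases hjk : j = k
  · subst hjk
    rw [Pi.single_eq_same, Pi.single_eq_same]
    have hlim : ∀ c : C2, Tendsto (fun x => B x • c) (𝓝 (y j)) (𝓝 c) := by
      intro c
      have h1 : B (y j) = 1 := B.one_of_mem_closedBall (Metric.mem_closedBall_self (by
        change 0 ≤ δ / 4
        linarith))
      have : Tendsto (fun x => B x • c) (𝓝 (y j)) (𝓝 (B (y j) • c)) :=
        (hB.continuous.smul (continuous_const (y := c))).tendsto (y j)
      rwa [h1, one_smul] at this
    constructor
    · refine ((hlim a).mono_left (inf_le_left.trans nhdsWithin_le_nhds)).congr' ?_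
      filter_upwards [mem_inf_of_left (self_mem_nhdsWithin (s := Set.Iio (y j))),
        mem_inf_of_right hf] with x h1 h2
      rw [h2]
      simp only [st, if_pos (Set.mem_Iio.mp h1)]
    · refine ((hlim b).mono_left (inf_le_left.trans nhdsWithin_le_nhds)).congr' ?_
      filter_upwards [mem_inf_of_left (self_mem_nhdsWithin (s := Set.Ioi (y j))),
        mem_inf_of_right hf] with x h1 h2
      rw [h2]
      simp only [st, if_neg (not_lt.mpr (Set.mem_Ioi.mp h1).le)]
  · rw [Pi.single_eq_of_ne hjk, Pi.single_eq_of_ne hjk]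
    have hz : ∀ᶠ x in 𝓝 (y j), B x = 0 := by
      have : tsupport B ⊆ Set.Ioo (y k - δ) (y k + δ) := by
        rw [B.tsupport_eq, Real.closedBall_eq_Icc]
        change Set.Icc (y k - δ / 2) (y k + δ / 2) ⊆ _
        exact fun x hx => ⟨by linarith [hx.1], by linarith [hx.2]⟩
      exact notMem_tsupport_iff_eventuallyEq.mp fun hm => hjk (hy (hfree j (this hm)))
    have hz' : ∀ F ≤ 𝓝 (y j), Tendsto f (F ⊓ ae volume) (𝓝 0) := by
      intro F hF
      refine tendsto_const_nhds.congr' ?_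
      filter_upwards [mem_inf_of_left (hF hz), mem_inf_of_right hf] with x h1 h2
      have h1' : B x = 0 := h1
      rw [h2, h1', zero_smul]
    exact ⟨hz' _ nhdsWithin_le_nhds, hz' _ nhdsWithin_le_nhds⟩

theorem exists_mem_H1_hasSideLimits (hy : Function.Injective y) (l r : Fin n → C2) :
    ∃ f ∈ H1 y, HasSideLimits y f l r := by
  classical
  choose f hf hlim using fun k => exists_hasSideLimits_single hy k (l k) (r k)
  refine ⟨∑ k, f k, Submodule.sum_mem _ fun k _ => hf k, ?_⟩
  have key : ∀ s : Finset (Fin n), HasSideLimits y ((∑ k ∈ s, f k : L2) : ℝ → C2)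
      (∑ k ∈ s, Pi.single k (l k)) (∑ k ∈ s, Pi.single k (r k)) := by
    intro s
    induction s using Finset.induction_on with
    | empty => simpa using! HasSideLimits.zero y
    | insert k s hk ih =>
      rw [Finset.sum_insert hk, Finset.sum_insert hk, Finset.sum_insert hk]
      exact (hlim k).add ih
  have := key Finset.univ
  rwa [Finset.univ_sum_single, Finset.univ_sum_single] at this

end Sobolev

/-! ### Test functions with values in `ℂ²` -/

section Test

variable {n : ℕ} {y : Fin n → ℝ}

/-- The class in `L²(ℝ; ℂ²)` of the function with `j`-th component `φ` and vanishing other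
component. -/
def testL2 {φ : ℝ → ℝ} (hφ : Continuous φ) (hs : HasCompactSupport φ) (j : Fin 2) : L2 :=
  MemLp.toLp (fun x => φ x • (EuclideanSpace.single j 1 : C2))
    ((hφ.smul continuous_const).memLp_of_hasCompactSupport hs.smul_right)

theorem testL2_coeFn {φ : ℝ → ℝ} (hφ : Continuous φ) (hs : HasCompactSupport φ) (j : Fin 2) :
    testL2 hφ hs j =ᵐ[volume] fun x => φ x • (EuclideanSpace.single j 1 : C2) :=
  MemLp.coeFn_toLp _

theorem inner_testL2 {φ : ℝ → ℝ} (hφ : Continuous φ) (hs : HasCompactSupport φ) (j : Fin 2)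
    (f : L2) : ⟪testL2 hφ hs j, f⟫_ℂ = ∫ x, φ x • f x j := by
  rw [MeasureTheory.L2.inner_def]
  refine integral_congr_ae ((testL2_coeFn hφ hs j).mono fun x hx => ?_)
  dsimp only
  rw [hx]
  dsimp only
  rw [Complex.real_smul, ← Complex.coe_smul, inner_smul_left, Complex.conj_ofReal,
    EuclideanSpace.inner_single_left]
  simp

/-- The test functions with support off `Y` are dense in `L²(ℝ; ℂ²)`. -/
theorem dense_of_testL2_mem {K : Submodule ℂ L2}
    (h : ∀ φ (hφ : IsTest y φ) j, testL2 hφ.1.continuous hφ.2.1 j ∈ K) : Dense (K : Set L2) := by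
  rw [Submodule.dense_iff_topologicalClosure_eq_top, Submodule.topologicalClosure_eq_top_iff,
    Submodule.eq_bot_iff]
  intro g hg
  have hfin : (Set.range y).Finite := Set.finite_range y
  have key : ∀ j : Fin 2, ∀ᵐ x, x ∈ (Set.range y)ᶜ → g x j = 0 := fun j =>
    hfin.isClosed.isOpen_compl.ae_eq_zero_of_integral_contDiff_smul_eq_zero
      (((memLp_coord g j).locallyIntegrable (by norm_num)).locallyIntegrableOn _)
      fun φ h1 h2 h3 => by
        rw [← inner_testL2 h1.continuous h2]
        exact (Submodule.mem_orthogonal _ _).mp hg _ (h φ ⟨h1, h2, h3⟩ j)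
  have hnull : ∀ᵐ x ∂(volume : Measure ℝ), x ∈ (Set.range y)ᶜ :=
    compl_mem_ae_iff.mpr (hfin.measure_zero _)
  refine Lp.ext ?_
  filter_upwards [key 0, key 1, hnull, Lp.coeFn_zero C2 2 (volume : Measure ℝ)] with x h0 h1 h2 h3
  rw [h3]
  ext i
  fin_cases i
  · exact h0 h2
  · exact h1 h2

theorem matC2_sigma1_apply (v : C2) : matC2 sigma1 v 0 = v 1 ∧ matC2 sigma1 v 1 = v 0 := by
  constructor <;>
    simp [matC2, sigma1, Matrix.toLpLin_apply, dotProduct, Fin.sum_univ_two]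

theorem matC2_sigma3_apply (v : C2) : matC2 sigma3 v 0 = v 0 ∧ matC2 sigma3 v 1 = -v 1 := by
  constructor <;>
    simp [matC2, sigma3, Matrix.toLpLin_apply, dotProduct, Fin.sum_univ_two]

theorem matL2_coeFn (A : Matrix (Fin 2) (Fin 2) ℂ) (f : L2) :
    matL2 A f =ᵐ[volume] fun x => matC2 A (f x) :=
  (matC2 A).coeFn_compLpL f

/-- An operator extending the Dirac operator on test functions maps `φ e_j` to
`-i φ' σ₁ e_j + φ σ₃ e_j / 2`. -/
theorem ExtendsDirac.apply_testL2 {A : L2 →ₗ.[ℂ] L2} (hA : ExtendsDirac y A) {φ : ℝ → ℝ}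
    (hφ : IsTest y φ) (j : Fin 2) :
    ∃ h : testL2 hφ.1.continuous hφ.2.1 j ∈ A.domain, A ⟨_, h⟩ =
      (-Complex.I) • matL2 sigma1 (testL2 (hφ.1.continuous_deriv (by simp)) hφ.2.1.deriv j)
        + (1 / 2 : ℂ) • matL2 sigma3 (testL2 hφ.1.continuous hφ.2.1 j) := by
  obtain ⟨h, e⟩ := hA (fun x => φ x • (EuclideanSpace.single j 1 : C2))
    (hφ.1.smul contDiff_const) hφ.2.1.smul_right
    ((tsupport_smul_subset_left φ _).trans hφ.2.2) _ (testL2_coeFn hφ.1.continuous hφ.2.1 j)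
  refine ⟨h, Lp.ext (e.trans ?_)⟩
  refine EventuallyEq.trans ?_ (Lp.coeFn_add _ _).symm
  filter_upwards [Lp.coeFn_smul (-Complex.I) (matL2 sigma1
      (testL2 (hφ.1.continuous_deriv (by simp)) hφ.2.1.deriv j)),
    Lp.coeFn_smul (1 / 2 : ℂ) (matL2 sigma3 (testL2 hφ.1.continuous hφ.2.1 j)),
    matL2_coeFn sigma1 (testL2 (hφ.1.continuous_deriv (by simp)) hφ.2.1.deriv j),
    matL2_coeFn sigma3 (testL2 hφ.1.continuous hφ.2.1 j),
    testL2_coeFn (hφ.1.continuous_deriv (by simp)) hφ.2.1.deriv j,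
    testL2_coeFn hφ.1.continuous hφ.2.1 j] with x h1 h2 h3 h4 h5 h6
  rw [Pi.add_apply, h1, h2, Pi.smul_apply, Pi.smul_apply, h3, h4, h5, h6]
  congr 3
  exact (((hφ.1.differentiable (by simp)).differentiableAt.hasDerivAt).smul_const _).deriv

theorem mem_H1_of_test {φ : ℝ → C2} (h1 : ContDiff ℝ ∞ φ) (h2 : HasCompactSupport φ) {Ψ : L2}
    (hΨ : Ψ =ᵐ[volume] φ) : ∃ h : Ψ ∈ H1 y, wderiv y ⟨Ψ, h⟩ =ᵐ[volume] deriv φ := by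
  have hc : Continuous (deriv φ) := h1.continuous_deriv (by simp)
  have hm : MemLp (deriv φ) 2 (volume : Measure ℝ) := hc.memLp_of_hasCompactSupport h2.deriv
  obtain ⟨h, e⟩ := exists_wderiv_eq (y := y) (mem_weakDerivGraph_of_hasDerivAt hΨ
    (hm.coeFn_toLp) fun x _ => (h1.differentiable (by simp)).differentiableAt.hasDerivAt)
  exact ⟨h, e ▸ hm.coeFn_toLp⟩

theorem hasSideLimits_of_test {φ : ℝ → C2} (h3 : tsupport φ ⊆ (Set.range y)ᶜ) {Ψ : L2}
    (hΨ : Ψ =ᵐ[volume] φ) : HasSideLimits y Ψ 0 0 := by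
  have key : ∀ k, ∀ F ≤ 𝓝 (y k), Tendsto Ψ (F ⊓ ae volume) (𝓝 0) := by
    intro k F hF
    have hz : ∀ᶠ x in 𝓝 (y k), φ x = 0 :=
      notMem_tsupport_iff_eventuallyEq.mp fun hm => h3 hm ⟨k, rfl⟩
    refine tendsto_const_nhds.congr' ?_
    filter_upwards [mem_inf_of_left (hF hz), mem_inf_of_right hΨ] with x h1 h2
    rw [h2]
    exact Eq.symm h1
  exact fun k => ⟨key k _ nhdsWithin_le_nhds, key k _ nhdsWithin_le_nhds⟩

end Test

/-! ### The Dirac operators -/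

section Dirac

variable {n : ℕ} {y : Fin n → ℝ}

theorem diracMax_apply {Ψ : L2} (h : Ψ ∈ H1 y) : diracMax y ⟨Ψ, h⟩ =
    (1 / 2 : ℂ) • matL2 sigma3 Ψ + (-Complex.I) • matL2 sigma1 (wderiv y ⟨Ψ, h⟩) := rfl

theorem dirac_combination_coeFn (f g : L2) :
    ∀ᵐ x, ((1 / 2 : ℂ) • matL2 sigma3 f + (-Complex.I) • matL2 sigma1 g : L2) x =
      (1 / 2 : ℂ) • matC2 sigma3 (f x) + (-Complex.I) • matC2 sigma1 (g x) := by
  filter_upwards [Lp.coeFn_add ((1 / 2 : ℂ) • matL2 sigma3 f) ((-Complex.I) • matL2 sigma1 g),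
    Lp.coeFn_smul (1 / 2 : ℂ) (matL2 sigma3 f), Lp.coeFn_smul (-Complex.I) (matL2 sigma1 g),
    matL2_coeFn sigma1 g, matL2_coeFn sigma3 f] with x h1 h2 h3 h4 h5
  rw [h1, Pi.add_apply, h2, h3, Pi.smul_apply, Pi.smul_apply, h4, h5]

theorem dirac_combination_coord (f g : L2) :
    ∀ᵐ x, ((1 / 2 : ℂ) • matL2 sigma3 f + (-Complex.I) • matL2 sigma1 g : L2) x 0 =
        f x 0 / 2 - Complex.I * g x 1 ∧
      ((1 / 2 : ℂ) • matL2 sigma3 f + (-Complex.I) • matL2 sigma1 g : L2) x 1 =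
        -f x 1 / 2 - Complex.I * g x 0 := by
  filter_upwards [dirac_combination_coeFn f g] with x hx
  rw [hx]
  simp only [PiLp.add_apply, PiLp.smul_apply, smul_eq_mul, matC2_sigma1_apply, matC2_sigma3_apply]
  constructor <;> ring

theorem matL2_sigma1_sigma1 (f : L2) : matL2 sigma1 (matL2 sigma1 f) = f := by
  refine Lp.ext ?_
  filter_upwards [matL2_coeFn sigma1 f, matL2_coeFn sigma1 (matL2 sigma1 f)] with x h1 h2
  rw [h2, h1]
  ext i
  fin_cases i
  · exact (matC2_sigma1_apply _).1.trans (matC2_sigma1_apply _).2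
  · exact (matC2_sigma1_apply _).2.trans (matC2_sigma1_apply _).1

theorem matL2_sigma3_sigma3 (f : L2) : matL2 sigma3 (matL2 sigma3 f) = f := by
  refine Lp.ext ?_
  filter_upwards [matL2_coeFn sigma3 f, matL2_coeFn sigma3 (matL2 sigma3 f)] with x h1 h2
  rw [h2, h1]
  ext i
  fin_cases i
  · exact (matC2_sigma3_apply _).1.trans (matC2_sigma3_apply _).1
  · refine (matC2_sigma3_apply _).2.trans ?_
    rw [(matC2_sigma3_apply _).2, neg_neg]
    rfl

theorem matL2_sigma1_sigma3 (f : L2) :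
    matL2 sigma1 (matL2 sigma3 f) = -matL2 sigma3 (matL2 sigma1 f) := by
  refine Lp.ext ?_
  filter_upwards [matL2_coeFn sigma1 f, matL2_coeFn sigma3 f,
    matL2_coeFn sigma3 (matL2 sigma1 f), matL2_coeFn sigma1 (matL2 sigma3 f),
    Lp.coeFn_neg (matL2 sigma3 (matL2 sigma1 f))] with x h1 h2 h3 h4 h5
  rw [h5, Pi.neg_apply, h4, h3, h1, h2]
  ext i
  rw [PiLp.neg_apply]
  fin_cases i
  · exact (matC2_sigma1_apply _).1.trans ((matC2_sigma3_apply _).2.trans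
      (congrArg Neg.neg ((matC2_sigma3_apply _).1.trans (matC2_sigma1_apply _).1).symm))
  · refine (matC2_sigma1_apply _).2.trans ((matC2_sigma3_apply _).1.trans ?_)
    exact (neg_eq_iff_eq_neg.mpr ((matC2_sigma3_apply _).2.trans
      (congrArg Neg.neg (matC2_sigma1_apply _).2))).symm

theorem mem_weakDerivGraph_matL2 (A : Matrix (Fin 2) (Fin 2) ℂ) {f g : L2}
    (h : (f, g) ∈ weakDerivGraph y) : (matL2 A f, matL2 A g) ∈ weakDerivGraph y := by
  intro φ hφ
  have key : ∀ (η : ℝ → ℝ) (k : L2), Integrable (fun x => η x • k x) →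
      ∫ x, η x • matL2 A k x = matC2 A (∫ x, η x • k x) := by
    intro η k hk
    rw [← (matC2 A).integral_comp_comm hk]
    refine integral_congr_ae ((matL2_coeFn A k).mono fun x hx => ?_)
    dsimp only
    rw [hx]
    exact ((matC2 A).map_smul_of_tower (η x) (k x)).symm
  have := congrArg (matC2 A) (h φ hφ)
  rw [map_neg] at this
  exact (key _ _ (hφ.integrable_deriv f)).trans
    (this.trans (congrArg Neg.neg (key _ _ (hφ.integrable g)).symm))

/-- Green's identity for the Dirac operator. -/
theorem inner_diracMax_sub (hy : Function.Injective y) {f g : L2} (hf : f ∈ H1 y)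
    (hg : g ∈ H1 y) {l r m s : Fin n → C2} (hl : HasSideLimits y f l r)
    (hm : HasSideLimits y g m s) :
    ⟪diracMax y ⟨f, hf⟩, g⟫_ℂ - ⟪f, diracMax y ⟨g, hg⟩⟫_ℂ =
      ⟪rhoD l r, tauD m s⟫_ℂ - ⟪tauD l r, rhoD m s⟫_ℂ := by
  have hint : ∀ a b : L2, Integrable fun x => ⟪a x, b x⟫_ℂ := fun a b =>
    L2.integrable_inner (𝕜 := ℂ) a b
  set f' := wderiv y ⟨f, hf⟩ with hf'
  set g' := wderiv y ⟨g, hg⟩ with hg'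
  have hfg := mem_weakDerivGraph y hf
  have hgg := mem_weakDerivGraph y hg
  have p1 := integral_conj_coord_mul hy hfg hgg hl hm 1 0
  have p2 := integral_conj_coord_mul hy hfg hgg hl hm 0 1
  have hi : ∀ i j, Integrable fun x =>
      ((starRingEnd ℂ) (f' x i) * g x j + g' x j * (starRingEnd ℂ) (f x i)) := fun i j =>
    (integrable_mul_of_memLp (memLp_conj_coord f' i) (memLp_coord g j)).add
      (integrable_mul_of_memLp (memLp_coord g' j) (memLp_conj_coord f i))
  have e : ⟪diracMax y ⟨f, hf⟩, g⟫_ℂ - ⟪f, diracMax y ⟨g, hg⟩⟫_ℂ =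
      Complex.I * ((∫ x, ((starRingEnd ℂ) (f' x 1) * g x 0 + g' x 0 * (starRingEnd ℂ) (f x 1)))
        + ∫ x, ((starRingEnd ℂ) (f' x 0) * g x 1 + g' x 1 * (starRingEnd ℂ) (f x 0))) := by
    rw [MeasureTheory.L2.inner_def, MeasureTheory.L2.inner_def,
      ← integral_sub (hint _ _) (hint _ _), ← integral_add (hi 1 0) (hi 0 1), ← integral_const_mul]
    refine integral_congr_ae ?_
    filter_upwards [dirac_combination_coord f f', dirac_combination_coord g g'] with x h1 h2
    rw [diracMax_apply, diracMax_apply, ← hf', ← hg', PiLp.inner_apply, PiLp.inner_apply,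
      Fin.sum_univ_two, Fin.sum_univ_two, h1.1, h1.2, h2.1, h2.2]
    simp only [RCLike.inner_apply, map_sub, map_mul, map_div₀, map_neg, Complex.conj_I, map_ofNat]
    ring
  rw [e, p1, p2, ← neg_add, ← Finset.sum_add_distrib, PiLp.inner_apply, PiLp.inner_apply,
    ← Finset.sum_sub_distrib, Fintype.sum_prod_type, mul_neg, Finset.mul_sum,
    ← Finset.sum_neg_distrib]
  refine Finset.sum_congr rfl fun k _ => ?_
  rw [Fin.sum_univ_two]
  simp only [rhoD, tauD, matC2_sigma1_apply, RCLike.inner_apply, PiLp.sub_apply, map_sub, map_mul,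
    map_add, map_div₀, Complex.conj_I, map_ofNat]
  ring

/-- The adjoint of the Dirac operator on test functions is contained in the maximal operator; `A`
may be any extension of it. -/
theorem diracMax_of_forall_test {A : L2 →ₗ.[ℂ] L2} (hA : ExtendsDirac y A) {f w : L2}
    (h : ∀ u : A.domain, ⟪A u, f⟫_ℂ = ⟪(u : L2), w⟫_ℂ) :
    ∃ hf : f ∈ H1 y, diracMax y ⟨f, hf⟩ = w := by
  have hadj : ∀ (B : Matrix (Fin 2) (Fin 2) ℂ) (a b : L2), (∀ u v : C2, ⟪matC2 B u, v⟫_ℂ =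
      ⟪u, matC2 B v⟫_ℂ) → ⟪matL2 B a, b⟫_ℂ = ⟪a, matL2 B b⟫_ℂ := by
    intro B a b hB
    rw [MeasureTheory.L2.inner_def, MeasureTheory.L2.inner_def]
    refine integral_congr_ae ?_
    filter_upwards [matL2_coeFn B a, matL2_coeFn B b] with x h1 h2
    rw [h1, h2, hB]
  have hs1 : ∀ u v : C2, ⟪matC2 sigma1 u, v⟫_ℂ = ⟪u, matC2 sigma1 v⟫_ℂ := fun u v => by
    simp only [PiLp.inner_apply, Fin.sum_univ_two, matC2_sigma1_apply]
    ring
  have hs3 : ∀ u v : C2, ⟪matC2 sigma3 u, v⟫_ℂ = ⟪u, matC2 sigma3 v⟫_ℂ := fun u v => by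
    simp only [PiLp.inner_apply, Fin.sum_univ_two, matC2_sigma3_apply, inner_neg_left,
      inner_neg_right]
  -- the weak derivative of `σ₁ f`, from the identity for `w`
  have hg : (matL2 sigma1 f, (-Complex.I) • ((1 / 2 : ℂ) • matL2 sigma3 f - w)) ∈
      weakDerivGraph y := by
    rw [mem_weakDerivGraph_iff_coord]
    intro i φ hφ
    obtain ⟨hm, e⟩ := hA.apply_testL2 hφ i
    have := h ⟨_, hm⟩
    rw [e, inner_add_left, inner_smul_left, inner_smul_left, hadj _ _ _ hs1, hadj _ _ _ hs3] at this
    rw [← inner_testL2 (hφ.1.continuous_deriv (by simp)) hφ.2.1.deriv,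
      ← inner_testL2 hφ.1.continuous hφ.2.1, inner_smul_right, inner_sub_right, inner_smul_right]
    simp only [map_neg, Complex.conj_I, map_div₀, map_one, map_ofNat] at this
    rw [← this]
    generalize ⟪testL2 (hφ.1.continuous_deriv (by simp)) hφ.2.1.deriv i, matL2 sigma1 f⟫_ℂ = S
    linear_combination S * Complex.I_sq
  obtain ⟨hf, e⟩ := exists_wderiv_eq (mem_weakDerivGraph_matL2 sigma1 hg)
  have hf' : f ∈ H1 y := by rwa [matL2_sigma1_sigma1] at hf
  have e' : wderiv y ⟨f, hf'⟩ =
      matL2 sigma1 ((-Complex.I) • ((1 / 2 : ℂ) • matL2 sigma3 f - w)) := by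
    rw [← e]
    congr 1
    exact Subtype.ext (matL2_sigma1_sigma1 f).symm
  refine ⟨hf', ?_⟩
  rw [diracMax_apply, e', matL2_sigma1_sigma1, smul_smul, neg_mul_neg, Complex.I_mul_I]
  module

theorem extendsDirac_dirac (P : SymPair (C2n n)) : ExtendsDirac y (dirac y P) := by
  intro φ h1 h2 h3 Ψ hΨ
  obtain ⟨hm, hd⟩ := mem_H1_of_test (y := y) h1 h2 hΨ
  have e1 : tauD (0 : Fin n → C2) 0 = 0 := by ext p; simp [tauD]
  have e2 : rhoD (0 : Fin n → C2) 0 = 0 := by ext p; simp [rhoD]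
  have hbc : Ψ ∈ diracBC y P :=
    ⟨0, 0, hasSideLimits_of_test h3 hΨ, by rw [e1, e2]; exact SymPair.BC.zero P⟩
  refine ⟨⟨hbc, hm⟩, ?_⟩
  change diracMax y ⟨Ψ, hm⟩ =ᵐ[volume] _
  rw [diracMax_apply]
  filter_upwards [dirac_combination_coeFn Ψ (wderiv y ⟨Ψ, hm⟩), hΨ, hd] with x h4 h5 h6
  rw [h4, h5, h6, add_comm]

theorem ExtendsDirac.dense_domain {A : L2 →ₗ.[ℂ] L2} (hA : ExtendsDirac y A) :
    Dense (A.domain : Set L2) :=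
  dense_of_testL2_mem (y := y) fun _ hφ j => (hA.apply_testL2 hφ j).1

theorem tauD_rhoD_surjective (t r : C2n n) : ∃ a b : Fin n → C2, tauD a b = t ∧ rhoD a b = r := by
  -- the jump is `-i σ₁ r`
  refine ⟨fun k => WithLp.toLp 2 fun i => t (k, i) + Complex.I / 2 * r (k, 1 - i),
    fun k => WithLp.toLp 2 fun i => t (k, i) - Complex.I / 2 * r (k, 1 - i), ?_, ?_⟩
  · ext ⟨k, i⟩
    simp only [tauD]
    ring
  · ext ⟨k, i⟩
    fin_cases i
    · change Complex.I * matC2 sigma1 _ 0 = r (k, 0)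
      rw [(matC2_sigma1_apply _).1]
      simp only [PiLp.sub_apply, sub_self]
      linear_combination -r (k, 0) * Complex.I_sq
    · change Complex.I * matC2 sigma1 _ 1 = r (k, 1)
      rw [(matC2_sigma1_apply _).2]
      simp only [PiLp.sub_apply, sub_zero]
      linear_combination -r (k, 1) * Complex.I_sq

theorem mem_diracBC_iff {P : SymPair (C2n n)} {f : L2} {l r : Fin n → C2}
    (h : HasSideLimits y f l r) : f ∈ diracBC y P ↔ P.BC (tauD l r) (rhoD l r) := by
  constructor
  · rintro ⟨l', r', h', hb⟩
    obtain ⟨rfl, rfl⟩ := h.unique h'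
    exact hb
  · exact fun hb => ⟨l, r, h, hb⟩

/-- The adjoint is a restriction of the maximal operator, and by Green's identity the boundary
values of its domain annihilate those of `D_{Π,Θ}`, so that they satisfy the same boundary
condition. -/
theorem isSelfAdjoint_dirac (hy : Function.Injective y) (P : SymPair (C2n n)) :
    IsSelfAdjoint (dirac y P) := by
  have hext := extendsDirac_dirac (y := y) P
  have hd := hext.dense_domain
  have hsym : (dirac y P).IsFormalAdjoint (dirac y P) := by
    rintro ⟨f, hfb, hf⟩ ⟨g, hgb, hg⟩
    obtain ⟨l, r, hl⟩ := exists_hasSideLimits hf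
    obtain ⟨m, s, hm⟩ := exists_hasSideLimits hg
    have := inner_diracMax_sub hy hf hg hl hm
    rw [← (P.BC_iff_forall _ _).mp ((mem_diracBC_iff hl).mp hfb) _ _ ((mem_diracBC_iff hm).mp hgb),
      sub_self] at this
    exact sub_eq_zero.mp this
  rw [LinearPMap.isSelfAdjoint_def]
  refine (LinearPMap.eq_of_le_of_domain_eq (hsym.le_adjoint hd)
    (le_antisymm (hsym.le_adjoint hd).1 fun f hf => ?_)).symm
  have hadj := LinearPMap.adjoint_isFormalAdjoint hd
  have hfw : ∀ u : (dirac y P).domain,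
      ⟪dirac y P u, f⟫_ℂ = ⟪(u : L2), (dirac y P).adjoint ⟨f, hf⟩⟫_ℂ := fun u =>
    hadj.symm u ⟨f, hf⟩
  obtain ⟨hf1, e⟩ := diracMax_of_forall_test hext hfw
  obtain ⟨l, r, hl⟩ := exists_hasSideLimits hf1
  refine ⟨(mem_diracBC_iff hl).mpr ((P.BC_iff_forall _ _).mpr fun t' r' hb => ?_), hf1⟩
  obtain ⟨a, b, rfl, rfl⟩ := tauD_rhoD_surjective t' r'
  obtain ⟨g, hg, hm⟩ := exists_mem_H1_hasSideLimits hy a b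
  have h1 := hadj ⟨f, hf⟩ ⟨g, (mem_diracBC_iff hm).mpr hb, hg⟩
  have h2 := inner_diracMax_sub hy hf1 hg hl hm
  rw [e] at h2
  exact (sub_eq_zero.mp ((h2.symm.trans (sub_eq_zero.mpr h1)))).symm

/-- A self-adjoint extension `A` is a restriction of the maximal operator, as `A = A*`. By Green's
identity and the surjectivity of the boundary map, the boundary values of `dom A` form a Lagrangian
subspace, and `dom A` consists of all functions in `H¹` with boundary values in it. -/
theorem existsUnique_eq_dirac (hy : Function.Injective y) {A : L2 →ₗ.[ℂ] L2}
    (hA : IsSelfAdjoint A) (hext : ExtendsDirac y A) : ∃! P : SymPair (C2n n), A = dirac y P := by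
  have hsym := isFormalAdjoint_of_isSelfAdjoint hA
  have hmax : ∀ u : A.domain, ∃ h : (u : L2) ∈ H1 y, diracMax y ⟨u, h⟩ = A u := fun u =>
    diracMax_of_forall_test hext fun v => hsym v u
  let L : Submodule ℂ (C2n n × C2n n) :=
    { carrier := {p | ∃ f ∈ A.domain, ∃ l r, HasSideLimits y f l r ∧
        tauD l r = p.1 ∧ rhoD l r = p.2}
      zero_mem' := ⟨0, A.domain.zero_mem, 0, 0, HasSideLimits.zero y,
        by ext p; simp [tauD], by ext p; simp [rhoD]⟩
      add_mem' := by
        rintro ⟨_, _⟩ ⟨_, _⟩ ⟨f, hf, l, r, hl, rfl, rfl⟩ ⟨g, hg, m, s, hm, rfl, rfl⟩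
        refine ⟨f + g, A.domain.add_mem hf hg, l + m, r + s, hl.add hm, ?_, ?_⟩
        · ext p; simp [tauD]; ring
        · ext p; simp [rhoD]; ring
      smul_mem' := by
        rintro c ⟨_, _⟩ ⟨f, hf, l, r, hl, rfl, rfl⟩
        refine ⟨c • f, A.domain.smul_mem c hf, c • l, c • r, hl.smul c, ?_, ?_⟩
        · ext p; simp [tauD]; ring
        · ext p; simp [rhoD]; ring }
  -- a function in `H¹` is in the domain if its boundary values annihilate `L`
  have hdom : ∀ f : L2, ∀ hf : f ∈ H1 y, ∀ l r, HasSideLimits y f l r →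
      ((∀ q ∈ L, ⟪tauD l r, q.2⟫_ℂ = ⟪rhoD l r, q.1⟫_ℂ) ↔ f ∈ A.domain) := by
    intro f hf l r hl
    constructor
    · intro h
      have : f ∈ A.adjoint.domain := by
        refine LinearPMap.mem_adjoint_domain_of_exists f ⟨diracMax y ⟨f, hf⟩, fun u => ?_⟩
        obtain ⟨hu, e⟩ := hmax u
        obtain ⟨m, s, hm⟩ := exists_hasSideLimits hu
        have h2 := inner_diracMax_sub hy hf hu hl hm
        have h3 : ⟪tauD l r, rhoD m s⟫_ℂ = ⟪rhoD l r, tauD m s⟫_ℂ :=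
          h (tauD m s, rhoD m s) ⟨u, u.2, m, s, hm, rfl, rfl⟩
        rw [h3, sub_self, e] at h2
        exact sub_eq_zero.mp h2
      rwa [LinearPMap.isSelfAdjoint_def.mp hA] at this
    · rintro h ⟨_, _⟩ ⟨g, hg, m, s, hm, rfl, rfl⟩
      obtain ⟨hg1, e1⟩ := hmax ⟨g, hg⟩
      obtain ⟨hf1, e2⟩ := hmax ⟨f, h⟩
      have h2 := inner_diracMax_sub hy hf hg1 hl hm
      rw [e1, e2] at h2
      have h3 : ⟪A ⟨f, h⟩, g⟫_ℂ = ⟪f, A ⟨g, hg⟩⟫_ℂ := hsym ⟨f, h⟩ ⟨g, hg⟩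
      rw [h3, sub_self] at h2
      exact (sub_eq_zero.mp h2.symm).symm
  have hL : ∀ p, p ∈ L ↔ ∀ q ∈ L, ⟪p.1, q.2⟫_ℂ = ⟪p.2, q.1⟫_ℂ := by
    rintro ⟨t, r⟩
    constructor
    · rintro ⟨f, hf, l, r, hl, rfl, rfl⟩
      exact (hdom f (hmax ⟨f, hf⟩).1 l r hl).mpr hf
    · intro h
      obtain ⟨a, b, rfl, rfl⟩ := tauD_rhoD_surjective t r
      obtain ⟨g, hg, hm⟩ := exists_mem_H1_hasSideLimits hy a b
      exact ⟨g, (hdom g hg a b hm).mp h, a, b, hm, rfl, rfl⟩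
  obtain ⟨P, hP⟩ := exists_symPair_of_lagrangian L hL
  have hAP : A = dirac y P := by
    refine LinearPMap.ext ?_ ?_
    · ext f
      constructor
      · intro hf
        obtain ⟨hf1, -⟩ := hmax ⟨f, hf⟩
        obtain ⟨l, r, hl⟩ := exists_hasSideLimits hf1
        exact ⟨(mem_diracBC_iff hl).mpr ((hP _ _).mp ⟨f, hf, l, r, hl, rfl, rfl⟩), hf1⟩
      · rintro ⟨hb, hf1⟩
        obtain ⟨l, r, hl⟩ := exists_hasSideLimits hf1
        exact (hdom f hf1 l r hl).mp ((hL _).mp ((hP _ _).mpr ((mem_diracBC_iff hl).mp hb)))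
    · intro f hf hf'
      exact (hmax ⟨f, hf⟩).2.symm
  refine ⟨P, hAP, fun Q hQ => SymPair.eq_of_BC_iff fun t r => ?_⟩
  obtain ⟨a, b, rfl, rfl⟩ := tauD_rhoD_surjective t r
  obtain ⟨g, hg, hm⟩ := exists_mem_H1_hasSideLimits hy a b
  have : (dirac y Q).domain = (dirac y P).domain := by rw [← hQ, hAP]
  rw [← mem_diracBC_iff hm, ← mem_diracBC_iff hm]
  constructor
  · intro h
    have : g ∈ (dirac y P).domain := this ▸ (⟨h, hg⟩ : g ∈ (dirac y Q).domain)
    exact this.1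
  · intro h
    have : g ∈ (dirac y Q).domain := this ▸ (⟨h, hg⟩ : g ∈ (dirac y P).domain)
    exact this.1

end Dirac

/-! ### The linear maps `N₁`, `N₂` and direct sums on `ℂ⁴ⁿ` -/

section Matrices

variable {n : ℕ}

/-- The `j`-th summand of a vector of `ℂ⁴ⁿ = ℂ²ⁿ ⊕ ℂ²ⁿ`. -/
def part (j : Fin 2) (ξ : C4n n) : C2n n := WithLp.toLp 2 fun p => ξ (j, p)

theorem ext_part {ξ η : C4n n} (h0 : part 0 ξ = part 0 η) (h1 : part 1 ξ = part 1 η) : ξ = η := by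
  ext ⟨j, p⟩
  fin_cases j
  · exact congrArg (fun v : C2n n => v p) h0
  · exact congrArg (fun v : C2n n => v p) h1

theorem dsumVec_part (ξ : C4n n) : dsumVec (part 0 ξ) (part 1 ξ) = ξ :=
  ext_part rfl rfl

theorem part_dsum (T : C2n n →ₗ[ℂ] C2n n) (j : Fin 2) (ξ : C4n n) :
    part j (dsum T ξ) = T (part j ξ) := by
  fin_cases j <;> rfl

theorem inner_eq_part (ξ η : C4n n) :
    ⟪ξ, η⟫_ℂ = ⟪part 0 ξ, part 0 η⟫_ℂ + ⟪part 1 ξ, part 1 η⟫_ℂ := by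
  simp only [PiLp.inner_apply]
  rw [Fintype.sum_prod_type, Fin.sum_univ_two]
  rfl

/-- The flip of the two summands of `ℂ⁴ⁿ = ℂ²ⁿ ⊕ ℂ²ⁿ`. -/
def flipSum : C4n n →ₗ[ℂ] C4n n where
  toFun ξ := dsumVec (part 1 ξ) (part 0 ξ)
  map_add' _ _ := ext_part rfl rfl
  map_smul' _ _ := ext_part rfl rfl

theorem flipSum_dsum (T : C2n n →ₗ[ℂ] C2n n) (ξ : C4n n) :
    flipSum (dsum T ξ) = dsum T (flipSum ξ) :=
  ext_part rfl rfl

theorem flipSum_flipSum (ξ : C4n n) : flipSum (flipSum ξ) = ξ := ext_part rfl rfl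

theorem flipSum_isSymmetric : (flipSum : C4n n →ₗ[ℂ] C4n n).IsSymmetric := by
  intro ξ η
  rw [inner_eq_part, inner_eq_part, add_comm]
  rfl

theorem dsum_isSymmetric {T : C2n n →ₗ[ℂ] C2n n} (hT : T.IsSymmetric) : (dsum T).IsSymmetric := by
  intro ξ η
  rw [inner_eq_part, inner_eq_part, part_dsum, part_dsum, part_dsum, part_dsum, hT, hT]

theorem dsum_dsum (S T R : C2n n →ₗ[ℂ] C2n n) (h : ∀ x, S (T x) = R x) (ξ : C4n n) :
    dsum S (dsum T ξ) = dsum R ξ :=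
  ext_part (by simp only [part_dsum, h]) (by simp only [part_dsum, h])

theorem dsum_eq_iff (T S : C2n n →ₗ[ℂ] C2n n) (ξ η : C4n n) :
    dsum T ξ = dsum S η ↔ T (part 0 ξ) = S (part 0 η) ∧ T (part 1 ξ) = S (part 1 η) := by
  constructor
  · intro h
    exact ⟨congrArg (part 0) h, congrArg (part 1) h⟩
  · rintro ⟨h0, h1⟩
    exact ext_part h0 h1

theorem finrank_range_dsum (T : C2n n →ₗ[ℂ] C2n n) :
    Module.finrank ℂ (LinearMap.range (dsum T)) = 2 * Module.finrank ℂ (LinearMap.range T) := by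
  let e : LinearMap.range (dsum T) ≃ₗ[ℂ] LinearMap.range T × LinearMap.range T :=
    { toFun := fun v => (⟨part 0 v, by
          obtain ⟨_, ξ, rfl⟩ := v
          exact ⟨part 0 ξ, (part_dsum T 0 ξ).symm⟩⟩, ⟨part 1 v, by
          obtain ⟨_, ξ, rfl⟩ := v
          exact ⟨part 1 ξ, (part_dsum T 1 ξ).symm⟩⟩)
      invFun := fun w => ⟨dsumVec w.1 w.2, by
        obtain ⟨⟨_, a, rfl⟩, ⟨_, b, rfl⟩⟩ := w
        exact ⟨dsumVec a b, ext_part rfl rfl⟩⟩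
      map_add' := fun _ _ => rfl
      map_smul' := fun _ _ => rfl
      left_inv := fun v => Subtype.ext (dsumVec_part v.1)
      right_inv := fun _ => rfl }
  rw [e.finrank_eq, Module.finrank_prod, two_mul]

theorem conjU_apply (B : Matrix (Fin n × Fin 2 × Fin 2) (Fin n × Fin 2 × Fin 2) ℂ) (ξ : C4n n)
    (j : Fin 2) (k : Fin n) (i : Fin 2) :
    conjU B ξ (j, k, i) = ∑ q : Fin n × Fin 2 × Fin 2, B (k, j, i) q * ξ (q.2.1, q.1, q.2.2) := rfl

theorem conjU_mul (B C : Matrix (Fin n × Fin 2 × Fin 2) (Fin n × Fin 2 × Fin 2) ℂ) (ξ : C4n n) :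
    conjU B (conjU C ξ) = conjU (B * C) ξ := by
  simp [conjU]

theorem conjU_one (ξ : C4n n) : conjU (1 : Matrix _ _ ℂ) ξ = ξ := by
  simp [conjU]

theorem conjU_inv_left {B : Matrix (Fin n × Fin 2 × Fin 2) (Fin n × Fin 2 × Fin 2) ℂ}
    (h : IsUnit B.det) (ξ : C4n n) : conjU B⁻¹ (conjU B ξ) = ξ := by
  rw [conjU_mul, Matrix.nonsing_inv_mul _ h, conjU_one]

theorem conjU_inv_right {B : Matrix (Fin n × Fin 2 × Fin 2) (Fin n × Fin 2 × Fin 2) ℂ}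
    (h : IsUnit B.det) (ξ : C4n n) : conjU B (conjU B⁻¹ ξ) = ξ := by
  rw [conjU_mul, Matrix.mul_nonsing_inv _ h, conjU_one]

theorem conjU_blockSum_apply (M : Matrix (Fin 4) (Fin 4) ℂ) (ξ : C4n n) (j : Fin 2) (k : Fin n)
    (i : Fin 2) : conjU (blockSum n M) ξ (j, k, i) =
      M (finProdFinEquiv (j, i)) 0 * ξ (0, k, 0) + M (finProdFinEquiv (j, i)) 1 * ξ (0, k, 1) +
      M (finProdFinEquiv (j, i)) 2 * ξ (1, k, 0) + M (finProdFinEquiv (j, i)) 3 * ξ (1, k, 1) := by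
  rw [conjU_apply, Fintype.sum_prod_type, Finset.sum_eq_single k]
  · simp only [Fintype.sum_prod_type, Fin.sum_univ_two, blockSum, Matrix.kroneckerMap_apply,
      Matrix.one_apply_eq, one_mul, Matrix.submatrix_apply]
    rw [← add_assoc]
    rfl
  · intro k' _ hk
    refine Finset.sum_eq_zero fun q _ => ?_
    simp [blockSum, Matrix.kroneckerMap_apply, Matrix.one_apply_ne hk.symm]
  · simp

theorem conjU_M1_apply (ξ : C4n n) (k : Fin n) :
    conjU (blockSum n M1) ξ (0, k, 0) = ξ (0, k, 0) ∧
    conjU (blockSum n M1) ξ (0, k, 1) =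
      Complex.I / 2 * ξ (0, k, 1) + Complex.I * ξ (1, k, 1) ∧
    conjU (blockSum n M1) ξ (1, k, 0) = ξ (0, k, 1) ∧
    conjU (blockSum n M1) ξ (1, k, 1) =
      -Complex.I / 2 * ξ (0, k, 0) + Complex.I * ξ (1, k, 0) := by
  have e0 : finProdFinEquiv ((0 : Fin 2), (0 : Fin 2)) = (0 : Fin 4) := rfl
  have e1 : finProdFinEquiv ((0 : Fin 2), (1 : Fin 2)) = (1 : Fin 4) := rfl
  have e2 : finProdFinEquiv ((1 : Fin 2), (0 : Fin 2)) = (2 : Fin 4) := rfl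
  have e3 : finProdFinEquiv ((1 : Fin 2), (1 : Fin 2)) = (3 : Fin 4) := rfl
  simp only [conjU_blockSum_apply, e0, e1, e2, e3]
  simp [M1]

theorem conjU_M2_apply (ξ : C4n n) (k : Fin n) :
    conjU (blockSum n M2) ξ (0, k, 0) = 1 / 2 * ξ (0, k, 0) + ξ (1, k, 0) ∧
    conjU (blockSum n M2) ξ (0, k, 1) = Complex.I * ξ (0, k, 1) ∧
    conjU (blockSum n M2) ξ (1, k, 0) = -1 / 2 * ξ (0, k, 1) + ξ (1, k, 1) ∧
    conjU (blockSum n M2) ξ (1, k, 1) = Complex.I * ξ (0, k, 0) := by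
  have e0 : finProdFinEquiv ((0 : Fin 2), (0 : Fin 2)) = (0 : Fin 4) := rfl
  have e1 : finProdFinEquiv ((0 : Fin 2), (1 : Fin 2)) = (1 : Fin 4) := rfl
  have e2 : finProdFinEquiv ((1 : Fin 2), (0 : Fin 2)) = (2 : Fin 4) := rfl
  have e3 : finProdFinEquiv ((1 : Fin 2), (1 : Fin 2)) = (3 : Fin 4) := rfl
  simp only [conjU_blockSum_apply, e0, e1, e2, e3]
  simp [M2]

/-- `N₁* N₂` is the flip of the two summands. -/
theorem inner_conjU_M1_conjU_M2 (ξ η : C4n n) :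
    ⟪conjU (blockSum n M1) ξ, conjU (blockSum n M2) η⟫_ℂ = ⟪flipSum ξ, η⟫_ℂ := by
  simp only [PiLp.inner_apply, Fintype.sum_prod_type, Fin.sum_univ_two]
  rw [← Finset.sum_add_distrib, ← Finset.sum_add_distrib]
  refine Finset.sum_congr rfl fun k _ => ?_
  have f0 : ∀ i, flipSum ξ (0, k, i) = ξ (1, k, i) := fun i => rfl
  have f1 : ∀ i, flipSum ξ (1, k, i) = ξ (0, k, i) := fun i => rfl
  obtain ⟨a1, a2, a3, a4⟩ := conjU_M1_apply ξ k
  obtain ⟨b1, b2, b3, b4⟩ := conjU_M2_apply η k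
  simp only [f0, f1, a1, a2, a3, a4, b1, b2, b3, b4, RCLike.inner_apply, map_add, map_mul,
    map_div₀, map_neg, Complex.conj_I, map_ofNat]
  ring_nf
  simp only [Complex.I_sq]
  ring

end Matrices

/-! ### The square of the Dirac operator -/

section Square

variable {n : ℕ} {y : Fin n → ℝ}

theorem HasSideLimits.matL2 (A : Matrix (Fin 2) (Fin 2) ℂ) {f : L2} {l r : Fin n → C2}
    (h : HasSideLimits y f l r) :
    HasSideLimits y (matL2 A f) (fun k => matC2 A (l k)) (fun k => matC2 A (r k)) := by
  have e := (matL2_coeFn A f).symm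
  exact fun k => ⟨((((matC2 A).continuous.tendsto _).comp (h k).1)).congr'
      (e.filter_mono inf_le_right),
    ((((matC2 A).continuous.tendsto _).comp (h k).2)).congr' (e.filter_mono inf_le_right)⟩

theorem wderiv_eq_of_mem {f g : L2} (h : (f, g) ∈ weakDerivGraph y) (hf : f ∈ H1 y) :
    wderiv y ⟨f, hf⟩ = g := by
  obtain ⟨_, e⟩ := exists_wderiv_eq h
  exact e

theorem dirac_combination_mem_weakDerivGraph {f f' g g' : L2} (hf : (f, f') ∈ weakDerivGraph y)
    (hg : (g, g') ∈ weakDerivGraph y) :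
    ((1 / 2 : ℂ) • matL2 sigma3 f + (-Complex.I) • matL2 sigma1 g,
      (1 / 2 : ℂ) • matL2 sigma3 f' + (-Complex.I) • matL2 sigma1 g') ∈ weakDerivGraph y := by
  have := (weakDerivGraph y).add_mem
    ((weakDerivGraph y).smul_mem (1 / 2 : ℂ) (mem_weakDerivGraph_matL2 sigma3 hf))
    ((weakDerivGraph y).smul_mem (-Complex.I) (mem_weakDerivGraph_matL2 sigma1 hg))
  rwa [Prod.smul_mk, Prod.smul_mk, Prod.mk_add_mk] at this

theorem diracMax_mem_weakDerivGraph {f : L2} (hf : f ∈ H1 y) (h2 : wderiv y ⟨f, hf⟩ ∈ H1 y) :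
    (diracMax y ⟨f, hf⟩, (1 / 2 : ℂ) • matL2 sigma3 (wderiv y ⟨f, hf⟩) +
      (-Complex.I) • matL2 sigma1 (wderiv y ⟨_, h2⟩)) ∈ weakDerivGraph y := by
  rw [diracMax_apply]
  exact dirac_combination_mem_weakDerivGraph (mem_weakDerivGraph y hf) (mem_weakDerivGraph y h2)

/-- `DΨ` is in `H¹` exactly when `Ψ'` is, because `σ₁` is invertible. -/
theorem diracMax_mem_H1_iff {f : L2} (hf : f ∈ H1 y) :
    diracMax y ⟨f, hf⟩ ∈ H1 y ↔ wderiv y ⟨f, hf⟩ ∈ H1 y := by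
  have hmat : ∀ (A : Matrix (Fin 2) (Fin 2) ℂ) (g : L2), g ∈ H1 y → matL2 A g ∈ H1 y :=
    fun A g hg => (exists_wderiv_eq (mem_weakDerivGraph_matL2 A (mem_weakDerivGraph y hg))).1
  constructor
  · intro h
    have e : wderiv y ⟨f, hf⟩ = Complex.I • matL2 sigma1
        (diracMax y ⟨f, hf⟩ - (1 / 2 : ℂ) • matL2 sigma3 f) := by
      rw [diracMax_apply, add_sub_cancel_left, map_smul, matL2_sigma1_sigma1, smul_smul,
        mul_neg, Complex.I_mul_I, neg_neg, one_smul]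
    rw [e]
    exact Submodule.smul_mem _ _ (hmat _ _ (Submodule.sub_mem _ h
      (Submodule.smul_mem _ _ (hmat _ _ hf))))
  · intro h
    exact (exists_wderiv_eq (diracMax_mem_weakDerivGraph hf h)).1

/-- The square of the maximal Dirac operator acts as `-d²/dx² + 1/4`, because `σ₁` and `σ₃`
anticommute. -/
theorem diracMax_diracMax {f : L2} (hf : f ∈ H1 y) (h2 : wderiv y ⟨f, hf⟩ ∈ H1 y)
    (hD : diracMax y ⟨f, hf⟩ ∈ H1 y) :
    diracMax y ⟨_, hD⟩ = (1 / 4 : ℂ) • f + -wderiv y ⟨_, h2⟩ := by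
  rw [diracMax_apply hD, wderiv_eq_of_mem (diracMax_mem_weakDerivGraph hf h2) hD, diracMax_apply]
  simp only [map_add, map_smul, matL2_sigma1_sigma1, matL2_sigma3_sigma3, matL2_sigma1_sigma3]
  generalize matL2 sigma3 (matL2 sigma1 (wderiv y ⟨f, hf⟩)) = u
  simp only [smul_add, smul_smul, smul_neg, neg_mul_neg, Complex.I_mul_I]
  module

theorem hasSideLimits_diracMax {f : L2} (hf : f ∈ H1 y) {l r l' r' : Fin n → C2}
    (h : HasSideLimits y f l r) (h' : HasSideLimits y (wderiv y ⟨f, hf⟩) l' r') :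
    HasSideLimits y (diracMax y ⟨f, hf⟩)
      (fun k => (1 / 2 : ℂ) • matC2 sigma3 (l k) + (-Complex.I) • matC2 sigma1 (l' k))
      (fun k => (1 / 2 : ℂ) • matC2 sigma3 (r k) + (-Complex.I) • matC2 sigma1 (r' k)) :=
  ((h.matL2 sigma3).smul (1 / 2 : ℂ)).add ((h'.matL2 sigma1).smul (-Complex.I))

/-- The boundary values of `Ψ` and `D Ψ` determine those for the Schrödinger operator through `N₁`
and `N₂`. -/
theorem tauH_rhoH_eq (l r l' r' : Fin n → C2) :
    let L : Fin n → C2 := fun k =>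
      (1 / 2 : ℂ) • matC2 sigma3 (l k) + (-Complex.I) • matC2 sigma1 (l' k)
    let R : Fin n → C2 := fun k =>
      (1 / 2 : ℂ) • matC2 sigma3 (r k) + (-Complex.I) • matC2 sigma1 (r' k)
    conjU (blockSum n M1) (dsumVec (tauD l r) (tauD L R)) = tauH l r l' r' ∧
      conjU (blockSum n M2) (dsumVec (rhoD l r) (rhoD L R)) = rhoH l r l' r' := by
  intro L R
  constructor
  · ext ⟨j, k, i⟩
    obtain ⟨a1, a2, a3, a4⟩ := conjU_M1_apply (dsumVec (tauD l r) (tauD L R)) k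
    fin_cases j <;> fin_cases i
    · refine a1.trans ?_
      simp [dsumVec, tauD, tauH, tauS]
    · refine a2.trans ?_
      simp [dsumVec, tauD, tauH, tauS, L, R, matC2_sigma1_apply, matC2_sigma3_apply]
      ring_nf
      simp only [Complex.I_sq]
      ring
    · refine a3.trans ?_
      simp [dsumVec, tauD, tauH, tauS]
    · refine a4.trans ?_
      simp [dsumVec, tauD, tauH, tauS, L, R, matC2_sigma1_apply, matC2_sigma3_apply]
      ring_nf
      simp only [Complex.I_sq]
      ring
  · ext ⟨j, k, i⟩
    obtain ⟨a1, a2, a3, a4⟩ := conjU_M2_apply (dsumVec (rhoD l r) (rhoD L R)) k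
    fin_cases j <;> fin_cases i
    · refine a1.trans ?_
      simp [dsumVec, rhoD, rhoH, rhoS, L, R, matC2_sigma1_apply, matC2_sigma3_apply]
      ring_nf
      simp only [Complex.I_sq]
      ring
    · refine a2.trans ?_
      simp [dsumVec, rhoD, rhoH, rhoS, L, R, matC2_sigma1_apply]
      ring_nf
      simp only [Complex.I_sq]
      ring
    · refine a3.trans ?_
      simp [dsumVec, rhoD, rhoH, rhoS, L, R, matC2_sigma1_apply, matC2_sigma3_apply]
      ring_nf
      simp only [Complex.I_sq]
      ring
    · refine a4.trans ?_
      simp [dsumVec, rhoD, rhoH, rhoS, L, R, matC2_sigma1_apply]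
      ring_nf
      simp only [Complex.I_sq]
      ring

theorem mem_schrBC_iff {Q : SymPair (C4n n)} {f : L2} (hf : f ∈ H1 y) {l r l' r' : Fin n → C2}
    (h : HasSideLimits y f l r) (h' : HasSideLimits y (wderiv y ⟨f, hf⟩) l' r') :
    f ∈ schrBC y Q ↔ Q.BC (tauH l r l' r') (rhoH l r l' r') := by
  constructor
  · rintro ⟨_, m, s, m', s', k, k', hb⟩
    obtain ⟨rfl, rfl⟩ := h.unique k
    obtain ⟨rfl, rfl⟩ := h'.unique k'
    exact hb
  · exact fun hb => ⟨hf, l, r, l', r', h, h', hb⟩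

/-- `D² = Ĥ + 1/4` as soon as the boundary condition of `Q`, transported by `N₁` and `N₂`, is the
one of `Π ⊕ Π`, `Θ ⊕ Θ`. -/
theorem pcomp_dirac_eq {P : SymPair (C2n n)} {Q : SymPair (C4n n)}
    (hQ : ∀ t r, Q.BC (conjU (blockSum n M1) t) (conjU (blockSum n M2) r) ↔
      dsum P.proj r = r ∧ dsum P.proj t = dsum P.ext r) :
    pcomp (dirac y P) (dirac y P) = addConst (schr y Q) (1 / 4) := by
  have hQ' : ∀ a b c d : C2n n, Q.BC (conjU (blockSum n M1) (dsumVec a b))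
      (conjU (blockSum n M2) (dsumVec c d)) ↔ P.BC a c ∧ P.BC b d := by
    intro a b c d
    rw [hQ, dsum_eq_iff, P.BC_iff, P.BC_iff]
    constructor
    · rintro ⟨h1, h2, h3⟩
      exact ⟨⟨congrArg (part 0) h1, h2⟩, ⟨congrArg (part 1) h1, h3⟩⟩
    · rintro ⟨⟨h1, h2⟩, ⟨h3, h4⟩⟩
      exact ⟨ext_part h1 h3, h2, h4⟩
  have hbc : ∀ (f : L2) (hf : f ∈ H1 y) (h2 : wderiv y ⟨f, hf⟩ ∈ H1 y),
      f ∈ schrBC y Q ↔ f ∈ diracBC y P ∧ diracMax y ⟨f, hf⟩ ∈ diracBC y P := by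
    intro f hf h2
    obtain ⟨l, r, h⟩ := exists_hasSideLimits hf
    obtain ⟨l', r', h'⟩ := exists_hasSideLimits h2
    rw [mem_schrBC_iff hf h h', mem_diracBC_iff h, mem_diracBC_iff (hasSideLimits_diracMax hf h h'),
      ← hQ', (tauH_rhoH_eq l r l' r').1, (tauH_rhoH_eq l r l' r').2]
  refine LinearPMap.ext ?_ ?_
  · ext f
    constructor
    · rintro ⟨⟨hb, hf⟩, hDb, hD⟩
      have h2 := (diracMax_mem_H1_iff hf).mp hD
      exact ⟨(hbc f hf h2).mpr ⟨hb, hDb⟩, hf, h2⟩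
    · rintro ⟨hb, hf, h2⟩
      obtain ⟨hb1, hb2⟩ := (hbc f hf h2).mp hb
      exact ⟨⟨hb1, hf⟩, hb2, (diracMax_mem_H1_iff hf).mpr h2⟩
  · rintro f ⟨⟨hb, hf⟩, hDb, hD⟩ hf'
    exact diracMax_diracMax hf ((diracMax_mem_H1_iff hf).mp hD) hD

theorem extendsSchr_schr (Q : SymPair (C4n n)) : ExtendsSchr y (schr y Q) := by
  intro φ h1 h2 h3 Ψ hΨ
  obtain ⟨hm, hd⟩ := mem_H1_of_test (y := y) h1 h2 hΨ
  have h1' : ContDiff ℝ ∞ (deriv φ) := (contDiff_infty_iff_deriv.mp h1).2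
  have h3' : tsupport (deriv φ) ⊆ (Set.range y)ᶜ := (tsupport_deriv_subset (𝕜 := ℝ)).trans h3
  obtain ⟨hm', hd'⟩ := mem_H1_of_test (y := y) h1' h2.deriv hd
  have hbc : Ψ ∈ schrBC y Q := by
    rw [mem_schrBC_iff hm (hasSideLimits_of_test h3 hΨ) (hasSideLimits_of_test h3' hd)]
    have e1 : tauH (0 : Fin n → C2) 0 0 0 = 0 := by
      simpa using tauH_smul (0 : ℂ) (0 : Fin n → C2) 0 0 0
    have e2 : rhoH (0 : Fin n → C2) 0 0 0 = 0 := by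
      simpa using rhoH_smul (0 : ℂ) (0 : Fin n → C2) 0 0 0
    rw [e1, e2]
    exact SymPair.BC.zero Q
  refine ⟨⟨hbc, hm, hm'⟩, ?_⟩
  change ((-wderiv y ⟨_, hm'⟩ : L2) : ℝ → C2) =ᵐ[volume] _
  filter_upwards [Lp.coeFn_neg (wderiv y ⟨_, hm'⟩), hd'] with x h4 h5
  rw [h4, Pi.neg_apply, h5]

theorem dense_schr_domain (Q : SymPair (C4n n)) : Dense ((schr y Q).domain : Set L2) :=
  dense_of_testL2_mem (y := y) fun φ hφ j =>
    (extendsSchr_schr Q (fun x => φ x • (EuclideanSpace.single j 1 : C2))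
      (hφ.1.smul contDiff_const) hφ.2.1.smul_right
      ((tsupport_smul_subset_left φ _).trans hφ.2.2) _
      (testL2_coeFn hφ.1.continuous hφ.2.1 j)).1

end Square

end DiracSchr

end

open DiracSchr in
theorem mainTheorem1 {n : ℕ} (y : Fin n → ℝ) (hy : StrictMono y) :
    ((∀ P : SymPair (C2n n), IsSelfAdjoint (dirac y P) ∧ ExtendsDirac y (dirac y P)) ∧
      ∀ A : L2 →ₗ.[ℂ] L2, IsSelfAdjoint A → ExtendsDirac y A →
        ∃! P : SymPair (C2n n), A = dirac y P) ∧
    ∀ P : SymPair (C2n n), ∃ Q : SymPair (C4n n),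
      -- the projector `Π̂`
      LinearMap.range Q.proj = LinearMap.range (conjU (blockSum n M2) ∘ₗ dsum P.proj) ∧
      LinearMap.range Q.proj =
        LinearMap.range (conjU (blockSum n M2) ∘ₗ dsum P.proj ∘ₗ conjU (blockSum n M1)⁻¹) ∧
      (∃ (N : LinearMap.range (dsum P.proj) →ₗ[ℂ] C4n n)
          (N' : C4n n →ₗ[ℂ] LinearMap.range (dsum P.proj))
          (G : LinearMap.range (dsum P.proj) ≃ₗ[ℂ] LinearMap.range (dsum P.proj)),
        N = conjU (blockSum n M2) ∘ₗ (LinearMap.range (dsum P.proj)).subtype ∧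
        N' = LinearMap.adjoint (𝕜 := ℂ) (E := LinearMap.range (dsum P.proj)) (F := C4n n) N ∧
        G.toLinearMap = N' ∘ₗ N ∧
        Q.proj = N ∘ₗ G.symm.toLinearMap ∘ₗ N') ∧
      Module.finrank ℂ (LinearMap.range Q.proj) =
        2 * Module.finrank ℂ (LinearMap.range P.proj) ∧
      -- the operator `Θ̂`
      (∃ K : LinearMap.range Q.proj ≃ₗ[ℂ] LinearMap.range Q.proj,
        (∀ v : LinearMap.range Q.proj, (K v : C4n n) =
          conjU (blockSum n M2) (dsum P.proj (conjU (blockSum n M1)⁻¹ v))) ∧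
        ∀ v : LinearMap.range Q.proj, (K (Q.op v) : C4n n) =
          conjU (blockSum n M2) (dsum P.ext (conjU (blockSum n M2)⁻¹ v))) ∧
      (P.proj = LinearMap.id → Q.proj = LinearMap.id ∧
        ∀ v : LinearMap.range Q.proj, (Q.op v : C4n n) =
          conjU (blockSum n M1) (dsum P.ext (conjU (blockSum n M2)⁻¹ v))) ∧
      -- the square of `D_{Π,Θ}`
      IsSelfAdjoint (schr y Q) ∧ ExtendsSchr y (schr y Q) ∧
      pcomp (dirac y P) (dirac y P) = addConst (schr y Q) (1 / 4) ∧
      -- resolvents and spectra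
      (∀ z : ℂ, (z ∈ resolventSet (dirac y P) ∧ -z ∈ resolventSet (dirac y P)) ↔
        z ^ 2 - 1 / 4 ∈ resolventSet (schr y Q)) ∧
      (∀ z : ℂ, (z ∈ spectrum (dirac y P) ∨ -z ∈ spectrum (dirac y P)) ↔
        z ^ 2 - 1 / 4 ∈ spectrum (schr y Q)) ∧
      ∀ (z : ℂ) (R S : L2 →L[ℂ] L2), IsResolventAt (dirac y P) z R →
        IsResolventAt (schr y Q) (z ^ 2 - 1 / 4) S →
        ∀ Φ : L2, ∃ h : S Φ ∈ (dirac y P).domain,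
          R Φ = dirac y P ⟨S Φ, h⟩ + z • S Φ := by
  have hinj := hy.injective
  refine ⟨⟨fun P => ⟨isSelfAdjoint_dirac hinj P, extendsDirac_dirac P⟩,
    fun A hA hext => existsUnique_eq_dirac hinj hA hext⟩, fun P => ?_⟩
  obtain ⟨u1, u2⟩ := isUnit_det_blockSum n
  obtain ⟨Q, q1, q2, q3, q4, q5, q6, q7⟩ := exists_symPair_hat (T := dsum P.proj) (E := dsum P.ext)
    (J := flipSum) (N₁ := conjU (blockSum n M1)) (N₂ := conjU (blockSum n M2))
    (N₁' := conjU (blockSum n M1)⁻¹) (N₂' := conjU (blockSum n M2)⁻¹)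
    ⟨LinearMap.ext fun ξ => dsum_dsum _ _ _
      (LinearMap.congr_fun P.isProj.isIdempotentElem) ξ, dsum_isSymmetric P.isProj.isSymmetric⟩
    (dsum_isSymmetric P.ext_isSymmetric) (dsum_dsum _ _ _ P.proj_ext) flipSum_isSymmetric
    flipSum_flipSum (flipSum_dsum _) (flipSum_dsum _) inner_conjU_M1_conjU_M2
    (conjU_inv_right u1) (conjU_inv_left u1) (conjU_inv_right u2) (conjU_inv_left u2)
  have hsq := pcomp_dirac_eq (y := y) q7
  have hD := isSelfAdjoint_dirac hinj P
  have hres : ∀ z : ℂ, (z ∈ resolventSet (dirac y P) ∧ -z ∈ resolventSet (dirac y P)) ↔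
      z ^ 2 - 1 / 4 ∈ resolventSet (schr y Q) := by
    intro z
    rw [mem_resolventSet_pcomp_iff hD.isClosed, hsq]
    exact exists_congr fun R => isResolventAt_addConst _ _ _ R
  refine ⟨Q, q1, q2, q3, q4.trans (finrank_range_dsum _), q5, fun hP => q6 ?_, ?_,
    extendsSchr_schr Q, hsq, hres, fun z => ?_, fun z R S hR hS => ?_⟩
  · rw [hP]
    exact LinearMap.ext fun ξ => ext_part rfl rfl
  · refine isSelfAdjoint_of_pcomp_eq_addConst hD (1 / 4) ?_ (dense_schr_domain Q)
    rw [hsq]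
    norm_num
  · simp only [DiracSchr.spectrum, Set.mem_compl_iff, ← hres]
    tauto
  · refine resolvent_eq_of_resolvent_pcomp hR ?_
    rw [hsq]
    exact (isResolventAt_addConst _ _ _ S).mpr hS
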